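/- **Lemma (label generating functions).** For $\tau$ in the upper half-plane put $q=e^{2\pi i\tau}$, $q^{1/2}=e^{\pi i\tau}$, $\eta_m=\eta(m\tau)$ ($\eta$ the Dedekind eta function), and $$z=\frac{4\eta_1^4\eta_4^8}{\eta_2^{12}},\qquad \tilde z=\frac{\eta_1^8\eta_4^4}{\eta_2^{12}},\qquad F=\theta(\tau)^2,\quad \theta(\tau)=1+2\sum_{n\ge1}q^{n^2}.$$ For integers $k\ge1$ let $$\mathrm{Eis}_k(\tau)=q^{1/2}\sum_{\substack{n\ge1\\ n\ \mathrm{odd}}}\frac{n^{k-1}\bigl((-1)^{k-1}q\bigr)^{(n-1)/2}}{1+q^n},\qquad \widetilde{\mathrm{Eis}}_k(\tau)=\sum_{n\ge1}\frac{n^{k-1}(-q)^n}{1+q^{2n}}.$$ Then there are polynomials $\mu_k$ ($k\ge1$) and $\nu_k$ ($k\ge1$ odd) with complex coefficients such that $\nu_1=1$ and, for all $\tau$ in the upper half-plane, $$\mathrm{Eis}_k(\tau)=\tfrac14F^kz\tilde z\,\mu_k(z^2)\ (k\text{ even}),\qquad \mathrm{Eis}_k(\tau)=\tfrac14F^kz\,\mu_k(z^2)\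 (k\text{ odd}),\qquad \widetilde{\mathrm{Eis}}_k(\tau)=\tfrac14F^k\tilde z\,\nu_k(z^2)\ (k>1\text{ odd}).$$ For any such polynomials, $\mu_k\in\mathbb Z[x]$ for all $k\ge1$ and $\nu_k\in\mathbb Z[x/4]$ for all odd $k\ge1$; and for every $x\in\mathbb C$ and every choice of the square roots $\sqrt x$, $\sqrt{1-x}$, the exponential generating functions $$\mathrm{SD}(t)=\sum_{\substack{k\ge1\\ k\ \mathrm{even}}}\frac{\mu_k(x)}{(k-1)!}t^{k-1},\quad \mathrm{NC}(t)=\sum_{\substack{k\ge1\\ k\ \mathrm{odd}}}\frac{\mu_k(x)}{(k-1)!}t^{k-1},\quad \mathrm{CD}(t)=\sum_{\substack{k\ge1\\ k\ \mathrm{odd}}}\frac{\nu_k(x)}{(k-1)!}t^{k-1}$$ converge for all complex $t$ in a neighbourhood of $0$ (which may depend on $x$), and there $$\begin{aligned}\mathrm{SD}(t)&=-i\,\mathrm{sd}(it,\sqrt x)=\mathrm{sd}(t,\sqrt{1-x}),\\ \mathrm{NC}(t)&=\mathrm{cn}(it,\sqrt x)=\mathrm{nc}(t,\sqrt{1-x}),\\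 \mathrm{CD}(t)&=\mathrm{nd}\bigl(\tfrac{it}{2},\sqrt x\bigr)=\mathrm{cd}\bigl(\tfrac t2,\sqrt{1-x}\bigr).\end{aligned}$$ Here $\mathrm{sn}(u,\kappa),\mathrm{cn}(u,\kappa),\mathrm{dn}(u,\kappa)$ are the Jacobi elliptic functions of modulus $\kappa$, that is, the solutions near $u=0$ of $\mathrm{sn}'=\mathrm{cn}\,\mathrm{dn}$, $\mathrm{cn}'=-\mathrm{sn}\,\mathrm{dn}$, $\mathrm{dn}'=-\kappa^2\,\mathrm{sn}\,\mathrm{cn}$ (derivatives in $u$) with values $0,1,1$ at $u=0$, and $\mathrm{sd}=\mathrm{sn}/\mathrm{dn}$, $\mathrm{nc}=1/\mathrm{cn}$, $\mathrm{nd}=1/\mathrm{dn}$, $\mathrm{cd}=\mathrm{cn}/\mathrm{dn}$. -/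

import Mathlib

namespace LabelGF

open scoped Real

/-! ### Jacobi elliptic functions

`sn(·, κ)`, `cn(·, κ)`, `dn(·, κ)` are the solutions of
`sn' = cn dn`, `cn' = - sn dn`, `dn' = - κ² sn cn` with `sn 0 = 0`, `cn 0 = 1`, `dn 0 = 1`,
for an arbitrary complex modulus `κ`.  They are built here as the sums of their Maclaurin series,
whose coefficients are forced by the differential equations. -/

/-- The `n`-th Maclaurin coefficients of `(sn(u, κ), cn(u, κ), dn(u, κ))`. -/
noncomputable def jacobiCoeff (κ : ℂ) : ℕ → ℂ × ℂ × ℂ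
  | 0 => (0, 1, 1)
  | n + 1 =>
    ((∑ i : Fin (n + 1), (jacobiCoeff κ i).2.1 * (jacobiCoeff κ (n - (i : ℕ))).2.2) / (n + 1),
     -(∑ i : Fin (n + 1), (jacobiCoeff κ i).1 * (jacobiCoeff κ (n - (i : ℕ))).2.2) / (n + 1),
     -κ ^ 2 * (∑ i : Fin (n + 1), (jacobiCoeff κ i).1 * (jacobiCoeff κ (n - (i : ℕ))).2.1) / (n + 1))
termination_by n => n
decreasing_by all_goals omega

/-- The Jacobi elliptic function `sn(u, κ)` of modulus `κ`. -/
noncomputable def sn (u κ : ℂ) : ℂ := ∑' n : ℕ, (jacobiCoeff κ n).1 * u ^ n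

/-- The Jacobi elliptic function `cn(u, κ)` of modulus `κ`. -/
noncomputable def cn (u κ : ℂ) : ℂ := ∑' n : ℕ, (jacobiCoeff κ n).2.1 * u ^ n

/-- The Jacobi elliptic function `dn(u, κ)` of modulus `κ`. -/
noncomputable def dn (u κ : ℂ) : ℂ := ∑' n : ℕ, (jacobiCoeff κ n).2.2 * u ^ n

/-- `sd = sn / dn`. -/
noncomputable def sd (u κ : ℂ) : ℂ := sn u κ / dn u κ

/-- `nc = 1 / cn`. -/
noncomputable def nc (u κ : ℂ) : ℂ := 1 / cn u κ

/-- `nd = 1 / dn`. -/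
noncomputable def nd (u κ : ℂ) : ℂ := 1 / dn u κ

/-- `cd = cn / dn`. -/
noncomputable def cd (u κ : ℂ) : ℂ := cn u κ / dn u κ

theorem sn_zero (κ : ℂ) : sn 0 κ = 0 := by
  rw [sn, tsum_eq_single 0 (fun n hn => by simp [hn])]
  simp [jacobiCoeff]

theorem cn_zero (κ : ℂ) : cn 0 κ = 1 := by
  rw [cn, tsum_eq_single 0 (fun n hn => by simp [hn])]
  simp [jacobiCoeff]

theorem dn_zero (κ : ℂ) : dn 0 κ = 1 := by
  rw [dn, tsum_eq_single 0 (fun n hn => by simp [hn])]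
  simp [jacobiCoeff]

theorem norm_sum_fin_le {n : ℕ} {C : ℝ} {a b : ℕ → ℂ} (hC : 0 ≤ C)
    (ha : ∀ i ≤ n, ‖a i‖ ≤ C ^ i) (hb : ∀ i ≤ n, ‖b i‖ ≤ C ^ i) :
    ‖(∑ i : Fin (n + 1), a i * b (n - (i : ℕ))) / ((n : ℂ) + 1)‖ ≤ C ^ n := by
  have hn : (0 : ℝ) < n + 1 := by positivity
  have hcast : ‖(n : ℂ) + 1‖ = n + 1 := by
    have : ((n : ℂ) + 1) = ((n + 1 : ℕ) : ℂ) := by push_cast; rfl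
    rw [this, Complex.norm_natCast]; push_cast; rfl
  rw [norm_div, hcast, div_le_iff₀ hn]
  calc ‖∑ i : Fin (n + 1), a i * b (n - i)‖
      ≤ ∑ i : Fin (n + 1), ‖a i * b (n - i)‖ := norm_sum_le _ _
    _ ≤ ∑ _i : Fin (n + 1), C ^ n := by
        refine Finset.sum_le_sum fun i _ => ?_
        have hi : (i : ℕ) ≤ n := by omega
        rw [norm_mul]
        calc ‖a i‖ * ‖b (n - i)‖ ≤ C ^ (i : ℕ) * C ^ (n - i : ℕ) :=
              mul_le_mul (ha _ hi) (hb _ (Nat.sub_le _ _)) (norm_nonneg _) (by positivity)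
          _ = C ^ n := by rw [← pow_add]; congr 1; omega
    _ = C ^ n * (n + 1) := by simp [mul_comm]

/-- The coefficients grow at most geometrically, so the Maclaurin series converge near `0`. -/
theorem norm_jacobiCoeff_le (κ : ℂ) (n : ℕ) :
    ‖(jacobiCoeff κ n).1‖ ≤ max 1 (‖κ‖ ^ 2) ^ n ∧ ‖(jacobiCoeff κ n).2.1‖ ≤ max 1 (‖κ‖ ^ 2) ^ n ∧
      ‖(jacobiCoeff κ n).2.2‖ ≤ max 1 (‖κ‖ ^ 2) ^ n := by
  have h1 : (1 : ℝ) ≤ max 1 (‖κ‖ ^ 2) := le_max_left _ _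
  have h2 : ‖κ‖ ^ 2 ≤ max 1 (‖κ‖ ^ 2) := le_max_right _ _
  generalize max 1 (‖κ‖ ^ 2) = C at h1 h2
  have hC : 0 ≤ C := by linarith
  induction n using Nat.strong_induction_on with
  | _ n ih =>
    rcases n with _ | n
    · simp [jacobiCoeff]
    · have hs : ∀ i ≤ n, ‖(jacobiCoeff κ i).1‖ ≤ C ^ i := fun i hi => (ih i (by omega)).1
      have hc : ∀ i ≤ n, ‖(jacobiCoeff κ i).2.1‖ ≤ C ^ i := fun i hi => (ih i (by omega)).2.1
      have hd : ∀ i ≤ n, ‖(jacobiCoeff κ i).2.2‖ ≤ C ^ i := fun i hi => (ih i (by omega)).2.2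
      have hle : C ^ n ≤ C ^ (n + 1) := pow_le_pow_right₀ h1 (Nat.le_succ n)
      have e1 := norm_sum_fin_le (a := fun i => (jacobiCoeff κ i).2.1)
        (b := fun i => (jacobiCoeff κ i).2.2) hC hc hd
      have e2 := norm_sum_fin_le (a := fun i => (jacobiCoeff κ i).1)
        (b := fun i => (jacobiCoeff κ i).2.2) hC hs hd
      have e3 := norm_sum_fin_le (a := fun i => (jacobiCoeff κ i).1)
        (b := fun i => (jacobiCoeff κ i).2.1) hC hs hc
      rw [jacobiCoeff]
      refine ⟨e1.trans hle, ?_, ?_⟩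
      · rw [neg_div, norm_neg]
        exact e2.trans hle
      · rw [mul_div_assoc, norm_mul, norm_neg, norm_pow, pow_succ, mul_comm]
        exact mul_le_mul e3 h2 (by positivity) (pow_nonneg hC n)

theorem summable_norm_coeff {C : ℝ} {a : ℕ → ℂ} (ha : ∀ n, ‖a n‖ ≤ C ^ n) {u : ℂ}
    (hC : 0 ≤ C) (hu : C * ‖u‖ < 1) : Summable fun n => ‖a n * u ^ n‖ := by
  refine Summable.of_nonneg_of_le (fun _ => norm_nonneg _) (fun n => ?_)
    (summable_geometric_of_lt_one (by positivity) hu)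
  rw [norm_mul, norm_pow, mul_pow]
  exact mul_le_mul_of_nonneg_right (ha n) (by positivity)

theorem hasDerivAt_tsum_coeff {C : ℝ} {a : ℕ → ℂ} (ha : ∀ n, ‖a n‖ ≤ C ^ n) {u : ℂ}
    (hC : 0 < C) (hu : C * ‖u‖ < 1) :
    HasDerivAt (fun v => ∑' n, a n * v ^ n) (∑' n : ℕ, ((n : ℂ) + 1) * a (n + 1) * u ^ n) u := by
  obtain ⟨r, hr1, hr2⟩ := exists_between (show ‖u‖ < 1 / C by rwa [lt_div_iff₀' hC])
  have hr0 : 0 ≤ r := (norm_nonneg u).trans hr1.le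
  have hCr : C * r < 1 := by rwa [lt_div_iff₀' hC] at hr2
  have hsum : Summable fun n : ℕ => (n : ℝ) * C ^ n * r ^ (n - 1) := by
    rw [← summable_nat_add_iff 1]
    have h := summable_pow_mul_geometric_of_norm_lt_one 1
      (r := C * r) (by rw [Real.norm_of_nonneg (by positivity)]; exact hCr)
    have h' := summable_geometric_of_lt_one (by positivity) hCr
    refine ((h.add h').mul_left C).congr fun n => ?_
    simp only [Nat.add_sub_cancel, mul_pow]
    push_cast
    ring
  have key := hasDerivAt_tsum_of_isPreconnected (g := fun n v => a n * v ^ n)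
    (g' := fun n v => a n * (n * v ^ (n - 1))) (t := Metric.ball (0 : ℂ) r) (y₀ := 0) (y := u)
    hsum Metric.isOpen_ball (convex_ball _ _).isPreconnected
    (fun n v _ => (hasDerivAt_pow n v).const_mul (a n))
    (fun n v hv => by
      have hv' : ‖v‖ ≤ r := by simpa using (Metric.mem_ball.1 hv).le
      rw [norm_mul, norm_mul, norm_pow, Complex.norm_natCast]
      calc ‖a n‖ * (n * ‖v‖ ^ (n - 1)) ≤ C ^ n * (n * r ^ (n - 1)) := by
            gcongr
            exact ha n
        _ = _ := by ring)
    (Metric.mem_ball_self ((norm_nonneg u).trans_lt hr1))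
    (summable_of_ne_finset_zero (s := {0}) (fun n hn => by
      have : n ≠ 0 := by simpa using hn
      simp [this]))
    (by simpa using hr1)
  refine key.congr_deriv ?_
  have hs : Summable fun n : ℕ => a n * (n * u ^ (n - 1)) := by
    refine Summable.of_norm_bounded hsum fun n => ?_
    rw [norm_mul, norm_mul, norm_pow, Complex.norm_natCast]
    calc ‖a n‖ * (n * ‖u‖ ^ (n - 1)) ≤ C ^ n * (n * r ^ (n - 1)) := by
          gcongr
          exact ha n
      _ = _ := by ring
  rw [hs.tsum_eq_zero_add]
  simp only [Nat.cast_zero, zero_mul, mul_zero, zero_add, Nat.add_sub_cancel]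
  refine tsum_congr fun n => ?_
  push_cast
  ring

theorem tsum_coeff_mul {C : ℝ} {a b : ℕ → ℂ} (ha : ∀ n, ‖a n‖ ≤ C ^ n) (hb : ∀ n, ‖b n‖ ≤ C ^ n)
    {u : ℂ} (hC : 0 ≤ C) (hu : C * ‖u‖ < 1) :
    (∑' n, a n * u ^ n) * (∑' n, b n * u ^ n) =
      ∑' n : ℕ, (∑ i : Fin (n + 1), a i * b (n - (i : ℕ))) * u ^ n := by
  rw [tsum_mul_tsum_eq_tsum_sum_range_of_summable_norm (summable_norm_coeff ha hC hu)
    (summable_norm_coeff hb hC hu)]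
  refine tsum_congr fun n => ?_
  rw [Fin.sum_univ_eq_sum_range (fun i : ℕ => a i * b (n - i)) (n + 1), Finset.sum_mul]
  refine Finset.sum_congr rfl fun i hi => ?_
  have hi' : i ≤ n := by simpa [Nat.lt_succ_iff] using hi
  calc a i * u ^ i * (b (n - i) * u ^ (n - i)) = a i * b (n - i) * (u ^ i * u ^ (n - i)) := by ring
    _ = _ := by rw [← pow_add, Nat.add_sub_cancel' hi']

/-- The differential equation of `sn`. -/
theorem hasDerivAt_sn {u κ : ℂ} (hu : max 1 (‖κ‖ ^ 2) * ‖u‖ < 1) :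
    HasDerivAt (fun v => sn v κ) (cn u κ * dn u κ) u := by
  have hC : (0 : ℝ) < max 1 (‖κ‖ ^ 2) := lt_max_of_lt_left one_pos
  have h := hasDerivAt_tsum_coeff (a := fun n => (jacobiCoeff κ n).1)
    (fun n => (norm_jacobiCoeff_le κ n).1) hC hu
  rw [cn, dn, tsum_coeff_mul (a := fun n => (jacobiCoeff κ n).2.1)
    (b := fun n => (jacobiCoeff κ n).2.2) (fun n => (norm_jacobiCoeff_le κ n).2.1)
    (fun n => (norm_jacobiCoeff_le κ n).2.2) hC.le hu]
  refine h.congr_deriv ?_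
  refine tsum_congr fun n => ?_
  have hn : (n : ℂ) + 1 ≠ 0 := Nat.cast_add_one_ne_zero n
  rw [jacobiCoeff]
  field_simp

/-- The differential equation of `cn`. -/
theorem hasDerivAt_cn {u κ : ℂ} (hu : max 1 (‖κ‖ ^ 2) * ‖u‖ < 1) :
    HasDerivAt (fun v => cn v κ) (-(sn u κ * dn u κ)) u := by
  have hC : (0 : ℝ) < max 1 (‖κ‖ ^ 2) := lt_max_of_lt_left one_pos
  have h := hasDerivAt_tsum_coeff (a := fun n => (jacobiCoeff κ n).2.1)
    (fun n => (norm_jacobiCoeff_le κ n).2.1) hC hu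
  rw [sn, dn, tsum_coeff_mul (a := fun n => (jacobiCoeff κ n).1)
    (b := fun n => (jacobiCoeff κ n).2.2) (fun n => (norm_jacobiCoeff_le κ n).1)
    (fun n => (norm_jacobiCoeff_le κ n).2.2) hC.le hu, ← tsum_neg]
  refine h.congr_deriv ?_
  refine tsum_congr fun n => ?_
  have hn : (n : ℂ) + 1 ≠ 0 := Nat.cast_add_one_ne_zero n
  rw [jacobiCoeff]
  field_simp

/-- The differential equation of `dn`. -/
theorem hasDerivAt_dn {u κ : ℂ} (hu : max 1 (‖κ‖ ^ 2) * ‖u‖ < 1) :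
    HasDerivAt (fun v => dn v κ) (-κ ^ 2 * (sn u κ * cn u κ)) u := by
  have hC : (0 : ℝ) < max 1 (‖κ‖ ^ 2) := lt_max_of_lt_left one_pos
  have h := hasDerivAt_tsum_coeff (a := fun n => (jacobiCoeff κ n).2.2)
    (fun n => (norm_jacobiCoeff_le κ n).2.2) hC hu
  rw [sn, cn, tsum_coeff_mul (a := fun n => (jacobiCoeff κ n).1)
    (b := fun n => (jacobiCoeff κ n).2.1) (fun n => (norm_jacobiCoeff_le κ n).1)
    (fun n => (norm_jacobiCoeff_le κ n).2.1) hC.le hu, ← tsum_mul_left]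
  refine h.congr_deriv ?_
  refine tsum_congr fun n => ?_
  have hn : (n : ℂ) + 1 ≠ 0 := Nat.cast_add_one_ne_zero n
  rw [jacobiCoeff]
  field_simp

/-! ### Modular functions and Eisenstein series

Throughout `q = exp (2 π i τ)` and `q ^ (1/2) = exp (π i τ)`, with `τ` in the upper half-plane. -/

/-- `q = exp (2 π i τ)`. -/
noncomputable def nome (τ : UpperHalfPlane) : ℂ := Complex.exp (2 * π * Complex.I * τ)

/-- `η_m(τ) = η(m τ)`, with `η` the Dedekind eta function. -/
noncomputable def etaScaled (m : ℕ) (τ : UpperHalfPlane) : ℂ := ModularForm.eta (m * τ)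

/-- `z = 4 η₁⁴ η₄⁸ / η₂¹²`. -/
noncomputable def z (τ : UpperHalfPlane) : ℂ :=
  4 * etaScaled 1 τ ^ 4 * etaScaled 4 τ ^ 8 / etaScaled 2 τ ^ 12

/-- `z̃ = η₁⁸ η₄⁴ / η₂¹²`. -/
noncomputable def zTilde (τ : UpperHalfPlane) : ℂ :=
  etaScaled 1 τ ^ 8 * etaScaled 4 τ ^ 4 / etaScaled 2 τ ^ 12

/-- `θ(τ) = 1 + 2 ∑_{n ≥ 1} q ^ (n²)`. -/
noncomputable def theta (τ : UpperHalfPlane) : ℂ := 1 + 2 * ∑' n : ℕ, nome τ ^ ((n + 1) ^ 2)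

/-- `F = θ²`. -/
noncomputable def F (τ : UpperHalfPlane) : ℂ := theta τ ^ 2

/-- `Eis_k(τ) = q^{1/2} ∑_{n ≥ 1 odd} n^{k-1} ((-1)^{k-1} q)^{(n-1)/2} / (1 + q^n)`, for `k ≥ 1`;
the summation variable is `m`, with `n = 2 m + 1`. -/
noncomputable def Eis (k : ℕ) (τ : UpperHalfPlane) : ℂ :=
  Complex.exp (π * Complex.I * τ) *
    ∑' m : ℕ, ((2 * m + 1 : ℕ) : ℂ) ^ (k - 1) * ((-1) ^ (k - 1) * nome τ) ^ m /
      (1 + nome τ ^ (2 * m + 1))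

/-- `Eĩs_k(τ) = ∑_{n ≥ 1} n^{k-1} (-q)^n / (1 + q^{2n})`, for `k ≥ 1`;
the summation variable is `m`, with `n = m + 1`. -/
noncomputable def EisTilde (k : ℕ) (τ : UpperHalfPlane) : ℂ :=
  ∑' m : ℕ, ((m + 1 : ℕ) : ℂ) ^ (k - 1) * (-nome τ) ^ (m + 1) / (1 + nome τ ^ (2 * (m + 1)))

/-- The relations that define the polynomials `μ_k` (`k ≥ 1`) and `ν_k` (`k ≥ 1` odd).
The values `μ 0` and `ν k` for even `k` play no role. -/
structure LabelRelations (μ ν : ℕ → Polynomial ℂ) : Prop where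
  eis_even : ∀ k, 1 ≤ k → Even k → ∀ τ : UpperHalfPlane,
    Eis k τ = 1 / 4 * F τ ^ k * z τ * zTilde τ * (μ k).eval (z τ ^ 2)
  eis_odd : ∀ k, Odd k → ∀ τ : UpperHalfPlane,
    Eis k τ = 1 / 4 * F τ ^ k * z τ * (μ k).eval (z τ ^ 2)
  eisTilde_odd : ∀ k, 1 < k → Odd k → ∀ τ : UpperHalfPlane,
    EisTilde k τ = 1 / 4 * F τ ^ k * zTilde τ * (ν k).eval (z τ ^ 2)
  nu_one : ν 1 = 1

end LabelGF

/-! The Jacobi functions solve a system `S' = αCD`, `C' = βSD`, `D' = γSC`, and so do the generating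
functions of the Eisenstein series. A solution is determined by its values at the origin, and
solutions with compatible constants are rescalings of one another (`IsEulerTriple.eq_scale`). The
theorem thus reduces to a differential system for Lambert series and a computation of initial
values.

Put `p = q^{1/2}`. Take `1/(p^n + p^{-n})` on odd `n` and on even `n`, and `1/(p^{-n} - p^n)` on odd
`n`, as Fourier coefficients; the moments `∑ ω^n n^m f(n)` are Taylor coefficients of the three
Fourier series at a point given by `ω`. Multiplying two series convolves the coefficients. The
addition theorems for `sinh` and `cosh` split each summand into a multiple of `tanh j + tanh(N-j)`
or `coth j + tanh(N-j)`; these sums telescope to `N`, and a factor `N` is a derivative. This gives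
`isEulerTriple_moment`. The point `ω = 1` yields `Eis_k` for odd `k`; the quarter-period shift `ω =
i` yields `Eis_k` for even `k` and the second family for odd `k > 1`.

The values at the origin are Kronecker sums `∑ x^j/(1 - yQ^j)`, evaluated as theta quotients by
`kronSum_mul_thetaSum_mul_thetaSum` and then as products by the Jacobi triple product `thetaSum_eq`.
They are `F/2`, `Fz/2` and `Fz̃/2` up to a factor `i` (`moment_values_eq`). The first integral `D² -
C²` is the same at both points, whence `z̃² = 1 - z²`. Rescaling time by `F` leaves triples with
constants `(1, 1, x)` and `(1, -x, 1-x)` at `x = z²`, whose Taylor coefficients are polynomials in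
`x`. They are unique because `z²` takes infinitely many values.

Integrality of `μ_k` is visible in the recursion; for `ν_k` it comes from a differential ring over
`ℤ[x/4]` (`half_pow_mul_eulerC_mem`). The imaginary transformation `t ↦ it` and division of a triple
by one of its components (`div_serD`) identify the generating functions with Jacobi quotients. -/

namespace LabelGF

open scoped Nat

/-! ### Euler triples: the recursion for Taylor coefficients, rescaling and uniqueness. -/

section BinomialConvolution

variable {R : Type*} [CommRing R]

/-- The binomial convolution, i.e. the product of exponential generating functions. -/
def binomConv (f g : ℕ → R) (n : ℕ) : R :=
  ∑ ij ∈ Finset.HasAntidiagonal.antidiagonal n, (n.choose ij.1 : R) * (f ij.1 * g ij.2)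

/-- The Taylor coefficients (times factorials) of a solution of
`S' = α C D`, `C' = β S D`, `D' = γ S C`. -/
structure IsEulerTriple (α β γ : R) (S C D : ℕ → R) : Prop where
  fst : ∀ n, S (n + 1) = α * binomConv C D n
  snd : ∀ n, C (n + 1) = β * binomConv S D n
  trd : ∀ n, D (n + 1) = γ * binomConv S C n

/-- The solution of `S' = α C D`, `C' = β S D`, `D' = γ S C` with initial value `(0, 1, 1)`. -/
def eulerTriple (α β γ : R) : ℕ → R × R × R
  | 0 => (0, 1, 1)
  | n + 1 =>
    (α * ∑ i : Fin (n + 1), (n.choose i : R) *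
        ((eulerTriple α β γ i).2.1 * (eulerTriple α β γ (n - (i : ℕ))).2.2),
     β * ∑ i : Fin (n + 1), (n.choose i : R) *
        ((eulerTriple α β γ i).1 * (eulerTriple α β γ (n - (i : ℕ))).2.2),
     γ * ∑ i : Fin (n + 1), (n.choose i : R) *
        ((eulerTriple α β γ i).1 * (eulerTriple α β γ (n - (i : ℕ))).2.1))
termination_by n => n
decreasing_by all_goals omega

def eulerS (α β γ : R) (n : ℕ) : R := (eulerTriple α β γ n).1
def eulerC (α β γ : R) (n : ℕ) : R := (eulerTriple α β γ n).2.1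
def eulerD (α β γ : R) (n : ℕ) : R := (eulerTriple α β γ n).2.2

@[simp] theorem eulerS_zero (α β γ : R) : eulerS α β γ 0 = 0 := by simp [eulerS, eulerTriple]
@[simp] theorem eulerC_zero (α β γ : R) : eulerC α β γ 0 = 1 := by simp [eulerC, eulerTriple]
@[simp] theorem eulerD_zero (α β γ : R) : eulerD α β γ 0 = 1 := by simp [eulerD, eulerTriple]

theorem binomConv_eq_sum_fin (f g : ℕ → R) (n : ℕ) :
    binomConv f g n = ∑ i : Fin (n + 1), (n.choose i : R) * (f i * g (n - (i : ℕ))) := by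
  rw [binomConv, Finset.Nat.sum_antidiagonal_eq_sum_range_succ_mk,
    Fin.sum_univ_eq_sum_range (fun i : ℕ => (n.choose i : R) * (f i * g (n - i))) (n + 1)]

theorem isEulerTriple_euler (α β γ : R) :
    IsEulerTriple α β γ (eulerS α β γ) (eulerC α β γ) (eulerD α β γ) := by
  refine ⟨fun n => ?_, fun n => ?_, fun n => ?_⟩ <;> rw [binomConv_eq_sum_fin]
  · rw [eulerS, eulerTriple]; rfl
  · rw [eulerC, eulerTriple]; rfl
  · rw [eulerD, eulerTriple]; rfl

theorem binomConv_congr {f g f' g' : ℕ → R} {n : ℕ} (hf : ∀ i ≤ n, f i = f' i)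
    (hg : ∀ i ≤ n, g i = g' i) : binomConv f g n = binomConv f' g' n := by
  refine Finset.sum_congr rfl fun ij hij => ?_
  rw [hf _ (Finset.HasAntidiagonal.antidiagonal.fst_le hij), hg _ (Finset.HasAntidiagonal.antidiagonal.snd_le hij)]

theorem binomConv_scale (f g : ℕ → R) (a b l : R) (n : ℕ) :
    binomConv (fun i => a * l ^ i * f i) (fun i => b * l ^ i * g i) n =
      a * b * l ^ n * binomConv f g n := by
  rw [binomConv, binomConv, Finset.mul_sum]
  refine Finset.sum_congr rfl fun ij hij => ?_
  rw [← Finset.HasAntidiagonal.mem_antidiagonal.1 hij, pow_add]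
  ring

/-- Solutions with the initial values `(0, C₀, D₀)` are rescalings of the normalized one. -/
theorem IsEulerTriple.eq_scale {A B Γ α β γ σ c d l : R} {S C D : ℕ → R}
    (h : IsEulerTriple A B Γ S C D) (hS : S 0 = 0) (hC : C 0 = c) (hD : D 0 = d)
    (h1 : A * (c * d) = l * σ * α) (h2 : B * (σ * d) = l * c * β)
    (h3 : Γ * (σ * c) = l * d * γ) (n : ℕ) :
    S n = σ * l ^ n * eulerS α β γ n ∧ C n = c * l ^ n * eulerC α β γ n ∧
      D n = d * l ^ n * eulerD α β γ n := by
  induction n using Nat.strong_induction_on with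
  | _ n ih =>
    rcases n with _ | n
    · simp [hS, hC, hD]
    · have iS : ∀ i ≤ n, S i = σ * l ^ i * eulerS α β γ i := fun i hi => (ih i (by omega)).1
      have iC : ∀ i ≤ n, C i = c * l ^ i * eulerC α β γ i := fun i hi => (ih i (by omega)).2.1
      have iD : ∀ i ≤ n, D i = d * l ^ i * eulerD α β γ i := fun i hi => (ih i (by omega)).2.2
      have e := isEulerTriple_euler α β γ
      refine ⟨?_, ?_, ?_⟩
      · rw [h.fst, e.fst, binomConv_congr iC iD, binomConv_scale, pow_succ]
        linear_combination (l ^ n * binomConv (eulerC α β γ) (eulerD α β γ) n) * h1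
      · rw [h.snd, e.snd, binomConv_congr iS iD, binomConv_scale, pow_succ]
        linear_combination (l ^ n * binomConv (eulerS α β γ) (eulerD α β γ) n) * h2
      · rw [h.trd, e.trd, binomConv_congr iS iC, binomConv_scale, pow_succ]
        linear_combination (l ^ n * binomConv (eulerS α β γ) (eulerC α β γ) n) * h3

theorem map_binomConv {R' : Type*} [CommRing R'] (ψ : R →+* R') (f g : ℕ → R) (n : ℕ) :
    ψ (binomConv f g n) = binomConv (fun i => ψ (f i)) (fun i => ψ (g i)) n := by
  simp [binomConv]

theorem IsEulerTriple.map {R' : Type*} [CommRing R'] (ψ : R →+* R') {α β γ : R} {S C D : ℕ → R}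
    (h : IsEulerTriple α β γ S C D) : IsEulerTriple (ψ α) (ψ β) (ψ γ)
      (fun i => ψ (S i)) (fun i => ψ (C i)) (fun i => ψ (D i)) := by
  refine ⟨fun n => ?_, fun n => ?_, fun n => ?_⟩ <;> rw [← map_binomConv, ← map_mul]
  · rw [h.fst]
  · rw [h.snd]
  · rw [h.trd]

/-- Homomorphisms carry solutions to solutions and the solution is unique. Applied to evaluation at
a point, this reads off the values of a polynomial solution. -/
theorem map_euler {R' : Type*} [CommRing R'] (ψ : R →+* R') (α β γ : R) (n : ℕ) :
    ψ (eulerS α β γ n) = eulerS (ψ α) (ψ β) (ψ γ) n ∧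
    ψ (eulerC α β γ n) = eulerC (ψ α) (ψ β) (ψ γ) n ∧
    ψ (eulerD α β γ n) = eulerD (ψ α) (ψ β) (ψ γ) n := by
  have := ((isEulerTriple_euler α β γ).map ψ).eq_scale (α := ψ α) (β := ψ β) (γ := ψ γ)
    (σ := 1) (c := 1) (d := 1) (l := 1) (by simp) (by simp) (by simp) (by simp) (by simp)
    (by simp) n
  simpa using this

theorem binomConv_mem (A : Subring R) {f g : ℕ → R} {n : ℕ} (hf : ∀ i ≤ n, f i ∈ A)
    (hg : ∀ i ≤ n, g i ∈ A) : binomConv f g n ∈ A :=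
  A.sum_mem fun _ hij => A.mul_mem (natCast_mem A _)
    (A.mul_mem (hf _ (Finset.HasAntidiagonal.antidiagonal.fst_le hij)) (hg _ (Finset.HasAntidiagonal.antidiagonal.snd_le hij)))

theorem euler_mem (A : Subring R) {α β γ : R} (hα : α ∈ A) (hβ : β ∈ A) (hγ : γ ∈ A) (n : ℕ) :
    eulerS α β γ n ∈ A ∧ eulerC α β γ n ∈ A ∧ eulerD α β γ n ∈ A := by
  induction n using Nat.strong_induction_on with
  | _ n ih =>
    rcases n with _ | n
    · simp [A.zero_mem, A.one_mem]
    · have e := isEulerTriple_euler α β γ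
      rw [e.fst, e.snd, e.trd]
      exact ⟨A.mul_mem hα (binomConv_mem A (fun i hi => (ih i (by omega)).2.1)
          fun i hi => (ih i (by omega)).2.2),
        A.mul_mem hβ (binomConv_mem A (fun i hi => (ih i (by omega)).1)
          fun i hi => (ih i (by omega)).2.2),
        A.mul_mem hγ (binomConv_mem A (fun i hi => (ih i (by omega)).1)
          fun i hi => (ih i (by omega)).2.1)⟩

/-- Time reversal `l = -1` preserves the system if `S` changes sign, so `S` is odd and `C`, `D` are
even. -/
theorem euler_neg (α β γ : R) (n : ℕ) :
    eulerS α β γ n = -1 * (-1) ^ n * eulerS α β γ n ∧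
    eulerC α β γ n = 1 * (-1) ^ n * eulerC α β γ n ∧
    eulerD α β γ n = 1 * (-1) ^ n * eulerD α β γ n :=
  (isEulerTriple_euler α β γ).eq_scale (by simp) (by simp) (by simp) (by ring) (by ring)
    (by ring) n

theorem eulerS_even [IsDomain R] [CharZero R] (α β γ : R) {n : ℕ} (hn : Even n) :
    eulerS α β γ n = 0 := by
  have h := (euler_neg α β γ n).1
  rw [hn.neg_one_pow] at h
  exact self_eq_neg.1 (by linear_combination h)

theorem eulerC_odd [IsDomain R] [CharZero R] (α β γ : R) {n : ℕ} (hn : Odd n) :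
    eulerC α β γ n = 0 := by
  have h := (euler_neg α β γ n).2.1
  rw [hn.neg_one_pow] at h
  exact self_eq_neg.1 (by linear_combination h)

end BinomialConvolution

/-! ### Exponential generating functions, differential equations and first integrals. -/

section Series

open PowerSeries

variable {R : Type*} [CommRing R] [Algebra ℂ R]

theorem factorial_cast_ne_zero (n : ℕ) : (n ! : ℂ) ≠ 0 :=
  Nat.cast_ne_zero.2 n.factorial_ne_zero

/-- The power series with Taylor coefficients `f n`, i.e. the exponential generating function. -/
noncomputable def egf (f : ℕ → R) : R⟦X⟧ := PowerSeries.mk fun n => ((n ! : ℂ)⁻¹) • f n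

theorem coeff_egf (f : ℕ → R) (n : ℕ) : coeff n (egf f) = ((n ! : ℂ)⁻¹) • f n := by
  simp [egf]

theorem egf_injective {f g : ℕ → R} (h : egf f = egf g) : f = g := by
  funext n
  have h1 := congrArg (coeff n) h
  rw [coeff_egf, coeff_egf] at h1
  exact smul_right_injective R (inv_ne_zero (factorial_cast_ne_zero n)) h1

theorem egf_mul (f g : ℕ → R) : egf f * egf g = egf (binomConv f g) := by
  ext n
  rw [coeff_mul, coeff_egf, binomConv, Finset.smul_sum]
  refine Finset.sum_congr rfl fun ij hij => ?_
  rw [coeff_egf, coeff_egf, smul_mul_smul_comm]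
  obtain ⟨i, j⟩ := ij
  obtain rfl := Finset.HasAntidiagonal.mem_antidiagonal.1 hij
  have h : ((i + j).choose i : R) = algebraMap ℂ R ((i + j).choose i) := by simp
  rw [h, ← Algebra.smul_def, smul_smul]
  congr 1
  have h1 : ((i + j).choose i : ℂ) * i ! * j ! = (i + j)! := by
    have := Nat.choose_mul_factorial_mul_factorial (Nat.le_add_right i j)
    rw [Nat.add_sub_cancel_left] at this
    exact_mod_cast this
  have hi := factorial_cast_ne_zero (i)
  have hj := factorial_cast_ne_zero (j)
  have hij := factorial_cast_ne_zero (i + j)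
  field_simp
  linear_combination -h1

theorem derivative_egf (f : ℕ → R) : d⁄dX R (egf f) = egf fun n => f (n + 1) := by
  ext n
  rw [coeff_derivative, coeff_egf, coeff_egf]
  have h : ((n : R) + 1) = algebraMap ℂ R (n + 1) := by simp
  rw [h, mul_comm, ← Algebra.smul_def, smul_smul, Nat.factorial_succ]
  congr 1
  have hi := factorial_cast_ne_zero (n)
  have hn : (n : ℂ) + 1 ≠ 0 := Nat.cast_add_one_ne_zero n
  push_cast
  field_simp

theorem egf_const_mul (a : R) (f : ℕ → R) : egf (fun n => a * f n) = C a * egf f := by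
  ext n
  rw [coeff_egf, coeff_C_mul, coeff_egf, mul_smul_comm]

theorem exists_egf (f : R⟦X⟧) : ∃ g, egf g = f := by
  refine ⟨fun n => (n ! : ℂ) • coeff n f, ?_⟩
  ext n
  rw [coeff_egf, smul_smul, inv_mul_cancel₀ (factorial_cast_ne_zero n), one_smul]

theorem constantCoeff_egf (f : ℕ → R) : constantCoeff (egf f) = f 0 := by
  rw [← coeff_zero_eq_constantCoeff_apply, coeff_egf]; simp

variable (α β γ : R)

noncomputable def serS : R⟦X⟧ := egf (eulerS α β γ)
noncomputable def serC : R⟦X⟧ := egf (eulerC α β γ)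
noncomputable def serD : R⟦X⟧ := egf (eulerD α β γ)

theorem derivative_serS : d⁄dX R (serS α β γ) = C α * (serC α β γ * serD α β γ) := by
  rw [serS, serC, serD, derivative_egf, egf_mul, ← egf_const_mul]
  exact congrArg egf (funext (isEulerTriple_euler α β γ).fst)

theorem derivative_serC : d⁄dX R (serC α β γ) = C β * (serS α β γ * serD α β γ) := by
  rw [serS, serC, serD, derivative_egf, egf_mul, ← egf_const_mul]
  exact congrArg egf (funext (isEulerTriple_euler α β γ).snd)

theorem derivative_serD : d⁄dX R (serD α β γ) = C γ * (serS α β γ * serC α β γ) := by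
  rw [serS, serC, serD, derivative_egf, egf_mul, ← egf_const_mul]
  exact congrArg egf (funext (isEulerTriple_euler α β γ).trd)

@[simp] theorem constantCoeff_serS : constantCoeff (serS α β γ) = 0 := by
  simp [serS, constantCoeff_egf]
@[simp] theorem constantCoeff_serC : constantCoeff (serC α β γ) = 1 := by
  simp [serC, constantCoeff_egf]
@[simp] theorem constantCoeff_serD : constantCoeff (serD α β γ) = 1 := by
  simp [serD, constantCoeff_egf]

variable {α β γ}

/-- Over a `ℂ`-algebra every power series is an exponential generating function, so this is
`IsEulerTriple.eq_scale` with trivial factors. -/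
theorem ser_unique {s c d : R⟦X⟧} (hs : d⁄dX R s = C α * (c * d)) (hc : d⁄dX R c = C β * (s * d))
    (hd : d⁄dX R d = C γ * (s * c)) (s0 : constantCoeff s = 0) (c0 : constantCoeff c = 1)
    (d0 : constantCoeff d = 1) :
    s = serS α β γ ∧ c = serC α β γ ∧ d = serD α β γ := by
  obtain ⟨s, rfl⟩ := exists_egf s
  obtain ⟨c, rfl⟩ := exists_egf c
  obtain ⟨d, rfl⟩ := exists_egf d
  rw [derivative_egf, egf_mul, ← egf_const_mul] at hs hc hd
  rw [constantCoeff_egf] at s0 c0 d0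
  have h : IsEulerTriple α β γ s c d :=
    ⟨congrFun (egf_injective hs), congrFun (egf_injective hc), congrFun (egf_injective hd)⟩
  have key := h.eq_scale (α := α) (β := β) (γ := γ) (σ := 1) (l := 1) s0 c0 d0 (by ring) (by ring)
    (by ring)
  refine ⟨congrArg egf (funext fun n => ?_), congrArg egf (funext fun n => ?_),
    congrArg egf (funext fun n => ?_)⟩
  · simpa using (key n).1
  · simpa using (key n).2.1
  · simpa using (key n).2.2

omit [Algebra ℂ R] in
theorem eq_of_derivative_eq_zero [IsAddTorsionFree R] {f : R⟦X⟧} {a : R} (h : d⁄dX R f = 0)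
    (h0 : constantCoeff f = a) : f = C a :=
  derivative.ext (by simp [h]) (by simp [h0])

variable (α β γ)

/-- The quadratic first integrals. -/
theorem serC_sq [IsAddTorsionFree R] :
    C α * serC α β γ ^ 2 - C β * serS α β γ ^ 2 = C α := by
  refine eq_of_derivative_eq_zero ?_ (by simp)
  simp only [map_sub, Derivation.leibniz, Derivation.leibniz_pow, derivative_C, derivative_serS,
    derivative_serC, smul_eq_mul, nsmul_eq_mul]
  push_cast
  ring

theorem serD_sq [IsAddTorsionFree R] :
    C α * serD α β γ ^ 2 - C γ * serS α β γ ^ 2 = C α := by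
  refine eq_of_derivative_eq_zero ?_ (by simp)
  simp only [map_sub, Derivation.leibniz, Derivation.leibniz_pow, derivative_C, derivative_serS,
    derivative_serD, smul_eq_mul, nsmul_eq_mul]
  push_cast
  ring

end Series

/-! ### Symmetry and quotients of triples. -/

section Quotients

open PowerSeries

/-- The system is symmetric under exchanging `C` with `D` together with `β` with `γ`. -/
theorem ser_swap (β γ : ℂ) : serS 1 β γ = serS 1 γ β ∧ serD 1 β γ = serC 1 γ β ∧
    serC 1 β γ = serD 1 γ β := by
  refine ser_unique ?_ ?_ ?_ (by simp) (by simp) (by simp)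
  · rw [derivative_serS, mul_comm (serC _ _ _)]
  · rw [derivative_serD]
  · rw [derivative_serC]

/-- Dividing a solution by its third component. -/
theorem div_serD (β γ : ℂ) :
    serS 1 (-γ) (β - γ) * serD 1 β γ = serS 1 β γ ∧
    serC 1 (-γ) (β - γ) * serD 1 β γ = 1 ∧
    serD 1 (-γ) (β - γ) * serD 1 β γ = serC 1 β γ := by
  set s := serS 1 β γ with hs
  set c := serC 1 β γ with hc
  set d := serD 1 β γ with hd
  have hd0 : constantCoeff d ≠ 0 := by simp [hd]
  have hmul : d * d⁻¹ = 1 := PowerSeries.mul_inv_cancel d hd0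
  have e1 : d ^ 2 - C γ * s ^ 2 = 1 := by simpa using serD_sq 1 β γ
  have e2 : c ^ 2 - C β * s ^ 2 = 1 := by simpa using serC_sq 1 β γ
  have Ds : d⁄dX ℂ s = c * d := by simpa using derivative_serS 1 β γ
  have Dc : d⁄dX ℂ c = C β * (s * d) := derivative_serC 1 β γ
  have Dd : d⁄dX ℂ d = C γ * (s * c) := derivative_serD 1 β γ
  have key := ser_unique (α := (1 : ℂ)) (β := -γ) (γ := β - γ) (s := s * d⁻¹) (c := d⁻¹)
    (d := c * d⁻¹) ?_ ?_ ?_ (by simp [hs]) (by simp [hd]) (by simp [hc, hd])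
  · rw [← key.1, ← key.2.1, ← key.2.2]
    exact ⟨by linear_combination s * hmul, by linear_combination hmul,
      by linear_combination c * hmul⟩
  -- Quotient rule: `(s/d)' = c(d² - γs²)/d²`, and the bracket is `1` by the first integral. The
  -- third equation works likewise, with both first integrals.
  · rw [Derivation.leibniz, derivative_inv', Ds, Dd]
    simp only [smul_eq_mul, map_one]
    linear_combination c * (d⁻¹) ^ 2 * e1 - c * d⁻¹ * d * hmul
  · rw [derivative_inv', Dd]
    simp only [map_neg]
    ring
  · rw [Derivation.leibniz, derivative_inv', Dc, Dd]
    simp only [smul_eq_mul, map_sub]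
    linear_combination s * (d⁻¹) ^ 2 * (C β * e1 - C γ * e2) - s * C β * d⁻¹ * d * hmul

end Quotients

/-! ### Integrality of the Taylor coefficients after halving the argument. -/

section Integrality

open PowerSeries

/-- By the Leibniz rule the subring generated by `T` is stable under differentiation, and its
elements have constant term in `A`. Taylor coefficients times factorials are the constant terms of
iterated derivatives, so no denominators enter. -/
theorem constantCoeff_iterate_derivative_mem {R : Type*} [CommRing R] (A : Subring R)
    {T : Set R⟦X⟧} (h0 : ∀ f ∈ T, constantCoeff f ∈ A)
    (hT : ∀ f ∈ T, d⁄dX R f ∈ Subring.closure T) {f : R⟦X⟧} (hf : f ∈ T) (n : ℕ) :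
    constantCoeff ((d⁄dX R)^[n] f) ∈ A := by
  have hcl : ∀ g ∈ Subring.closure T, d⁄dX R g ∈ Subring.closure T := fun g hg => by
    induction hg using Subring.closure_induction with
    | mem g hg => exact hT g hg
    | zero => simp
    | one => simp
    | add a b _ _ ha hb => rw [map_add]; exact Subring.add_mem _ ha hb
    | neg a _ ha => rw [map_neg]; exact Subring.neg_mem _ ha
    | mul a b ha' hb' ha hb =>
      rw [Derivation.leibniz]
      exact Subring.add_mem _ (Subring.mul_mem _ ha' hb) (Subring.mul_mem _ hb' ha)
  have hit : (d⁄dX R)^[n] f ∈ Subring.closure T := by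
    induction n with
    | zero => exact Subring.subset_closure hf
    | succ n ih => rw [Function.iterate_succ_apply']; exact hcl _ ih
  have hle : Subring.closure T ≤ A.comap (constantCoeff (R := R)) :=
    Subring.closure_le.2 fun g hg => h0 g hg
  exact hle hit

/-- The Taylor coefficients of `cd(t/2)` are integer polynomials in `y = x/4`. -/
theorem half_pow_mul_eulerC_mem {R : Type*} [CommRing R] [Algebra ℂ R] [IsAddTorsionFree R]
    (A : Subring R) {x y h : R} (hh2 : 2 * h = 1) (hxy : x = 4 * y) (hA : y ∈ A) (n : ℕ) :
    h ^ n * eulerC 1 (-x) (1 - x) n ∈ A := by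
  have hC2 : 2 * C h = 1 := by
    rw [← map_ofNat (C (R := R)) 2, ← map_mul, hh2, map_one]
  have hCx : C x = 4 * C y := by
    rw [← map_ofNat (C (R := R)) 4, ← map_mul, hxy]
  -- Multiplying all three constants by `h = 1/2` is the substitution `t ↦ t/2`. The constants of
  -- this system still contain `1/2`; the closed system over `ℤ[y]` uses `c`, `2s²` and their first
  -- derivatives instead.
  set s := serS h (-(h * x)) (h * (1 - x)) with hs
  set c := serC h (-(h * x)) (h * (1 - x)) with hc
  set d := serD h (-(h * x)) (h * (1 - x)) with hd
  have e1 : C h * c ^ 2 - C (-(h * x)) * s ^ 2 = C h := serC_sq h (-(h * x)) (h * (1 - x))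
  have e2 : C h * d ^ 2 - C (h * (1 - x)) * s ^ 2 = C h := serD_sq h (-(h * x)) (h * (1 - x))
  have Ds : d⁄dX _ s = C h * (c * d) := derivative_serS h (-(h * x)) (h * (1 - x))
  have Dc : d⁄dX _ c = C (-(h * x)) * (s * d) := derivative_serC h (-(h * x)) (h * (1 - x))
  have Dd : d⁄dX _ d = C (h * (1 - x)) * (s * c) := derivative_serD h (-(h * x)) (h * (1 - x))
  simp only [map_neg, map_mul, map_sub, map_one, hCx] at e1 e2 Dc Dd
  have c2 : c ^ 2 = 1 - 4 * C y * s ^ 2 := by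
    linear_combination 2 * e1 - (c ^ 2 + 4 * C y * s ^ 2 - 1) * hC2
  have d2 : d ^ 2 = 1 + (1 - 4 * C y) * s ^ 2 := by
    linear_combination 2 * e2 - (d ^ 2 - (1 - 4 * C y) * s ^ 2 - 1) * hC2
  have DP : d⁄dX _ (2 * s ^ 2) = 2 * (s * c * d) := by
    rw [Derivation.leibniz, Derivation.leibniz_pow, Ds]
    have : d⁄dX R (2 : R⟦X⟧) = 0 := by
      rw [← map_ofNat (C (R := R)) 2, derivative_C]
    rw [this]
    simp only [smul_eq_mul, nsmul_eq_mul]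
    push_cast
    linear_combination (2 * s * c * d) * hC2
  have DV : d⁄dX _ (d⁄dX _ c) = -(C y * c * (1 + (1 - 4 * C y) * (2 * s ^ 2))) := by
    rw [Dc]
    have : -(C h * (4 * C y)) * (s * d) = C (-(h * (4 * y))) * (s * d) := by
      rw [map_neg, map_mul, map_mul, map_ofNat]
    rw [this, Derivation.leibniz, derivative_C, Derivation.leibniz, Ds, Dd]
    simp only [smul_eq_mul, map_neg, map_mul, map_ofNat]
    linear_combination (-(4 * C h ^ 2 * C y * c)) * d2 +
      (-(C y * c * (1 + (1 - 4 * C y) * (2 * s ^ 2))) * (2 * C h + 1)) * hC2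
  have DQ : d⁄dX _ (d⁄dX _ (2 * s ^ 2)) =
      1 + (1 - 8 * C y) * (2 * s ^ 2) - 3 * C y * (1 - 4 * C y) * (2 * s ^ 2) ^ 2 := by
    rw [DP, ← map_ofNat (C (R := R)) 2, Derivation.leibniz, derivative_C,
      Derivation.leibniz, Derivation.leibniz, Ds, Dc, Dd]
    simp only [smul_eq_mul, map_ofNat]
    linear_combination (c ^ 2 * d ^ 2 - 4 * C y * s ^ 2 * d ^ 2 +
        (1 - 4 * C y) * s ^ 2 * c ^ 2) * hC2 +
      (c ^ 2 - 4 * C y * s ^ 2) * d2 + (1 + 2 * (1 - 4 * C y) * s ^ 2) * c2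
  -- The generators have constant terms `y, 1, 0, 0, 0`; `DV` and `DQ` express the second
  -- derivatives of `c` and `2s²` with coefficients in `ℤ[y]`.
  have key := constantCoeff_iterate_derivative_mem A
    (T := {C y, c, d⁄dX _ c, 2 * s ^ 2, d⁄dX _ (2 * s ^ 2)}) ?_ ?_ (f := c) (by simp) n
  · rw [constantCoeff_iterate_derivative, hc, serC, coeff_egf] at key
    have e : eulerC h (-(h * x)) (h * (1 - x)) n = 1 * h ^ n * eulerC 1 (-x) (1 - x) n :=
      ((isEulerTriple_euler h (-(h * x)) (h * (1 - x))).eq_scale (by simp) (by simp) (by simp)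
        (σ := 1) (c := 1) (d := 1) (l := h) (by ring) (by ring) (by ring) n).2.1
    rw [← nsmul_eq_mul, ← Nat.cast_smul_eq_nsmul ℂ, smul_smul,
      mul_inv_cancel₀ (factorial_cast_ne_zero n), one_smul, e, one_mul] at key
    exact key
  · intro f hf
    simp only [Set.mem_insert_iff, Set.mem_singleton_iff] at hf
    rcases hf with rfl | rfl | rfl | rfl | rfl
    · simpa using hA
    · simp [hc, A.one_mem]
    · rw [Dc]; simp [hs, A.zero_mem]
    · simp [hs, A.zero_mem]
    · rw [DP]; simp [hs, A.zero_mem]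
  · set T : Set R⟦X⟧ := {C y, c, d⁄dX _ c, 2 * s ^ 2, d⁄dX _ (2 * s ^ 2)} with hT
    have my : C y ∈ Subring.closure T := Subring.subset_closure (by simp [hT])
    have mc : c ∈ Subring.closure T := Subring.subset_closure (by simp [hT])
    have mV : d⁄dX _ c ∈ Subring.closure T := Subring.subset_closure (by simp [hT])
    have mP : 2 * s ^ 2 ∈ Subring.closure T := Subring.subset_closure (by simp [hT])
    have mQ : d⁄dX _ (2 * s ^ 2) ∈ Subring.closure T := Subring.subset_closure (by simp [hT])
    generalize Subring.closure T = B at *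
    have num : ∀ k : ℕ, [k.AtLeastTwo] → (OfNat.ofNat k : R⟦X⟧) ∈ B := fun k _ =>
      ofNat_mem B k
    intro f hf
    simp only [hT, Set.mem_insert_iff, Set.mem_singleton_iff] at hf
    rcases hf with rfl | rfl | rfl | rfl | rfl
    · rw [derivative_C]; exact B.zero_mem
    · exact mV
    · rw [DV]
      exact B.neg_mem (B.mul_mem (B.mul_mem my mc) (B.add_mem B.one_mem (B.mul_mem
        (B.sub_mem B.one_mem (B.mul_mem (num 4) my)) mP)))
    · exact mQ
    · rw [DQ]
      exact B.sub_mem (B.add_mem B.one_mem (B.mul_mem (B.sub_mem B.one_mem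
        (B.mul_mem (num 8) my)) mP)) (B.mul_mem (B.mul_mem (B.mul_mem (num 3) my)
        (B.sub_mem B.one_mem (B.mul_mem (num 4) my))) (B.pow_mem mP 2))

end Integrality

/-! ### Convergence near the origin and identification with Jacobi quotients. -/

section Evaluation

open PowerSeries Filter Topology

/-- The coefficients grow at most geometrically. -/
def HasGeomBound (f : ℂ⟦X⟧) : Prop := ∃ K : ℝ, 0 < K ∧ ∀ n, ‖coeff n f‖ ≤ K ^ n

/-- The sum of a power series at a point. -/
noncomputable def seriesEval (f : ℂ⟦X⟧) (t : ℂ) : ℂ := ∑' n, coeff n f * t ^ n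

theorem eventually_mul_norm_lt_one (K : ℝ) : ∀ᶠ t in 𝓝 (0 : ℂ), K * ‖t‖ < 1 := by
  have : Tendsto (fun t : ℂ => K * ‖t‖) (𝓝 0) (𝓝 (K * ‖(0 : ℂ)‖)) :=
    (continuous_const.mul continuous_norm).tendsto 0
  exact this.eventually (gt_mem_nhds (by simp))

theorem HasGeomBound.hasSum {f : ℂ⟦X⟧} (hf : HasGeomBound f) :
    ∀ᶠ t in 𝓝 (0 : ℂ), HasSum (fun n => coeff n f * t ^ n) (seriesEval f t) := by
  obtain ⟨K, hK, h⟩ := hf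
  filter_upwards [eventually_mul_norm_lt_one K] with t ht
  exact (summable_norm_coeff h hK.le ht).of_norm.hasSum

theorem HasGeomBound.seriesEval_mul {f g : ℂ⟦X⟧} (hf : HasGeomBound f) (hg : HasGeomBound g) :
    ∀ᶠ t in 𝓝 (0 : ℂ), seriesEval (f * g) t = seriesEval f t * seriesEval g t := by
  obtain ⟨K, hK, h⟩ := hf
  obtain ⟨L, hL, h'⟩ := hg
  filter_upwards [eventually_mul_norm_lt_one (max K L)] with t ht
  have hM : 0 ≤ max K L := hK.le.trans (le_max_left _ _)
  rw [seriesEval, seriesEval, seriesEval, tsum_coeff_mul (C := max K L)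
    (fun n => (h n).trans (pow_le_pow_left₀ hK.le (le_max_left _ _) n))
    (fun n => (h' n).trans (pow_le_pow_left₀ hL.le (le_max_right _ _) n)) hM ht]
  refine tsum_congr fun n => ?_
  rw [coeff_mul, Finset.Nat.sum_antidiagonal_eq_sum_range_succ_mk,
    Fin.sum_univ_eq_sum_range (fun i : ℕ => coeff i f * coeff (n - i) g) (n + 1)]

theorem HasGeomBound.eventually_ne_zero {f : ℂ⟦X⟧} (hf : HasGeomBound f)
    (h0 : constantCoeff f ≠ 0) : ∀ᶠ t in 𝓝 (0 : ℂ), seriesEval f t ≠ 0 := by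
  obtain ⟨K, hK, h⟩ := hf
  have hd := hasDerivAt_tsum_coeff h hK (u := 0) (by simp)
  refine hd.continuousAt.eventually_ne ?_
  rw [tsum_eq_single 0 (fun n hn => by simp [hn])]
  simpa using h0

/-- A coefficient is a sum of `n + 1` products divided by `n + 1`, so each step of the recursion
costs at most one factor `K`. -/
theorem norm_coeff_ser_le {K : ℝ} (hK : 1 ≤ K) {α β γ : ℂ} (hα : ‖α‖ ≤ K) (hβ : ‖β‖ ≤ K)
    (hγ : ‖γ‖ ≤ K) (n : ℕ) : ‖coeff n (serS α β γ)‖ ≤ K ^ n ∧ ‖coeff n (serC α β γ)‖ ≤ K ^ n ∧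
      ‖coeff n (serD α β γ)‖ ≤ K ^ n := by
  have hK0 : 0 ≤ K := by linarith
  have step : ∀ {f g h : ℂ⟦X⟧} {a : ℂ} {n : ℕ}, d⁄dX ℂ f = C a * (g * h) → ‖a‖ ≤ K →
      (∀ i ≤ n, ‖coeff i g‖ ≤ K ^ i) → (∀ i ≤ n, ‖coeff i h‖ ≤ K ^ i) →
      ‖coeff (n + 1) f‖ ≤ K ^ (n + 1) := by
    intro f g h a n hf ha hg hh
    have e := congrArg (coeff n) hf
    have hn : (n : ℂ) + 1 ≠ 0 := Nat.cast_add_one_ne_zero n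
    rw [coeff_derivative, coeff_C_mul, coeff_mul, Finset.Nat.sum_antidiagonal_eq_sum_range_succ_mk,
      ← Fin.sum_univ_eq_sum_range (fun i : ℕ => coeff i g * coeff (n - i) h) (n + 1),
      ← eq_div_iff hn, mul_div_assoc] at e
    rw [e, norm_mul, pow_succ, mul_comm]
    exact mul_le_mul (norm_sum_fin_le (a := fun i => coeff i g) (b := fun i => coeff i h) hK0 hg hh)
      ha (norm_nonneg _) (pow_nonneg hK0 n)
  induction n using Nat.strong_induction_on with
  | _ n ih =>
    rcases n with _ | n
    · simp [coeff_zero_eq_constantCoeff]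
    · have is : ∀ i ≤ n, ‖coeff i (serS α β γ)‖ ≤ K ^ i := fun i hi => (ih i (by omega)).1
      have ic : ∀ i ≤ n, ‖coeff i (serC α β γ)‖ ≤ K ^ i := fun i hi => (ih i (by omega)).2.1
      have id : ∀ i ≤ n, ‖coeff i (serD α β γ)‖ ≤ K ^ i := fun i hi => (ih i (by omega)).2.2
      exact ⟨step (derivative_serS α β γ) hα ic id, step (derivative_serC α β γ) hβ is id,
        step (derivative_serD α β γ) hγ is ic⟩

theorem hasGeomBound_ser (α β γ : ℂ) : HasGeomBound (serS α β γ) ∧ HasGeomBound (serC α β γ) ∧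
    HasGeomBound (serD α β γ) := by
  have hK : 1 ≤ 1 + ‖α‖ + ‖β‖ + ‖γ‖ := by linarith [norm_nonneg α, norm_nonneg β, norm_nonneg γ]
  have h := norm_coeff_ser_le hK (α := α) (β := β) (γ := γ)
    (by linarith [norm_nonneg α, norm_nonneg β, norm_nonneg γ])
    (by linarith [norm_nonneg α, norm_nonneg β, norm_nonneg γ])
    (by linarith [norm_nonneg α, norm_nonneg β, norm_nonneg γ])
  exact ⟨⟨_, by linarith, fun n => (h n).1⟩, ⟨_, by linarith, fun n => (h n).2.1⟩,
    ⟨_, by linarith, fun n => (h n).2.2⟩⟩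

theorem jacobiCoeff_eq (κ : ℂ) (n : ℕ) :
    (jacobiCoeff κ n).1 = coeff n (serS 1 (-1) (-κ ^ 2)) ∧
    (jacobiCoeff κ n).2.1 = coeff n (serC 1 (-1) (-κ ^ 2)) ∧
    (jacobiCoeff κ n).2.2 = coeff n (serD 1 (-1) (-κ ^ 2)) := by
  have step : ∀ {f g h : ℂ⟦X⟧} {a : ℂ} {n : ℕ}, d⁄dX ℂ f = C a * (g * h) →
      coeff (n + 1) f = a * (∑ i : Fin (n + 1), coeff i g * coeff (n - (i : ℕ)) h) / (n + 1) := by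
    intro f g h a n hf
    have e := congrArg (coeff n) hf
    have hn : (n : ℂ) + 1 ≠ 0 := Nat.cast_add_one_ne_zero n
    rw [coeff_derivative, coeff_C_mul, coeff_mul, Finset.Nat.sum_antidiagonal_eq_sum_range_succ_mk,
      ← Fin.sum_univ_eq_sum_range (fun i : ℕ => coeff i g * coeff (n - i) h) (n + 1),
      ← eq_div_iff hn] at e
    exact e
  induction n using Nat.strong_induction_on with
  | _ n ih =>
    rcases n with _ | n
    · simp [coeff_zero_eq_constantCoeff, jacobiCoeff]
    · have is : ∀ i ≤ n, (jacobiCoeff κ i).1 = coeff i (serS 1 (-1) (-κ ^ 2)) := fun i hi => (ih i (by omega)).1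
      have ic : ∀ i ≤ n, (jacobiCoeff κ i).2.1 = coeff i (serC 1 (-1) (-κ ^ 2)) := fun i hi => (ih i (by omega)).2.1
      have id : ∀ i ≤ n, (jacobiCoeff κ i).2.2 = coeff i (serD 1 (-1) (-κ ^ 2)) := fun i hi => (ih i (by omega)).2.2
      rw [step (derivative_serS 1 (-1) (-κ ^ 2)), step (derivative_serC 1 (-1) (-κ ^ 2)),
        step (derivative_serD 1 (-1) (-κ ^ 2)), jacobiCoeff]
      refine ⟨?_, ?_, ?_⟩
      · rw [one_mul]
        refine congrArg (· / ((n : ℂ) + 1)) ?_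
        refine Finset.sum_congr rfl fun i _ => ?_
        rw [ic _ (by omega), id _ (by omega)]
      · rw [neg_one_mul]
        refine congrArg (fun a => -a / ((n : ℂ) + 1)) ?_
        refine Finset.sum_congr rfl fun i _ => ?_
        rw [is _ (by omega), id _ (by omega)]
      · refine congrArg (fun a => -κ ^ 2 * a / ((n : ℂ) + 1)) ?_
        refine Finset.sum_congr rfl fun i _ => ?_
        rw [is _ (by omega), ic _ (by omega)]

theorem sn_eq_seriesEval (u κ : ℂ) : sn u κ = seriesEval (serS 1 (-1) (-κ ^ 2)) u := by
  simp_rw [sn, seriesEval, (jacobiCoeff_eq κ _).1]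

theorem cn_eq_seriesEval (u κ : ℂ) : cn u κ = seriesEval (serC 1 (-1) (-κ ^ 2)) u := by
  simp_rw [cn, seriesEval, (jacobiCoeff_eq κ _).2.1]

theorem dn_eq_seriesEval (u κ : ℂ) : dn u κ = seriesEval (serD 1 (-1) (-κ ^ 2)) u := by
  simp_rw [dn, seriesEval, (jacobiCoeff_eq κ _).2.2]

/-- Jacobi's imaginary transformation, as rescaling of time by `l = i`. -/
theorem euler_I (x : ℂ) (n : ℕ) :
    eulerS 1 1 x n = -Complex.I * Complex.I ^ n * eulerS 1 (-1) (-x) n ∧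
    eulerC 1 1 x n = 1 * Complex.I ^ n * eulerC 1 (-1) (-x) n ∧
    eulerD 1 1 x n = 1 * Complex.I ^ n * eulerD 1 (-1) (-x) n :=
  (isEulerTriple_euler 1 1 x).eq_scale (by simp) (by simp) (by simp)
    (by simp) (by simp) (by simp [mul_comm]) n

theorem seriesEval_imaginary (x t : ℂ) :
    seriesEval (serS 1 1 x) t = -Complex.I * seriesEval (serS 1 (-1) (-x)) (Complex.I * t) ∧
    seriesEval (serC 1 1 x) t = seriesEval (serC 1 (-1) (-x)) (Complex.I * t) ∧
    seriesEval (serD 1 1 x) t = seriesEval (serD 1 (-1) (-x)) (Complex.I * t) := by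
  refine ⟨?_, ?_, ?_⟩
  · rw [seriesEval, seriesEval, ← tsum_mul_left]
    refine tsum_congr fun n => ?_
    rw [serS, serS, coeff_egf, coeff_egf, (euler_I x n).1, smul_eq_mul, smul_eq_mul]
    ring
  · refine tsum_congr fun n => ?_
    rw [serC, serC, coeff_egf, coeff_egf, (euler_I x n).2.1, smul_eq_mul, smul_eq_mul]
    ring
  · refine tsum_congr fun n => ?_
    rw [serD, serD, coeff_egf, coeff_egf, (euler_I x n).2.2, smul_eq_mul, smul_eq_mul]
    ring

/-- From two factorizations to equality of quotients near `0`. -/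
theorem eventually_seriesEval_eq_div {f g h : ℂ⟦X⟧} (e : f * g = h) (hf : HasGeomBound f)
    (hg : HasGeomBound g) (g0 : constantCoeff g ≠ 0) :
    ∀ᶠ t in 𝓝 (0 : ℂ), seriesEval f t = seriesEval h t / seriesEval g t := by
  filter_upwards [hf.seriesEval_mul hg, hg.eventually_ne_zero g0] with t h1 h2
  rw [eq_div_iff h2, ← h1, e]

theorem seriesEval_one (t : ℂ) : seriesEval 1 t = 1 := by
  rw [seriesEval, tsum_eq_single 0 (fun n hn => by simp [coeff_one, hn])]
  simp

variable {x κ κ' : ℂ} (hκ : κ ^ 2 = x) (hκ' : κ' ^ 2 = 1 - x)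

include hκ hκ' in
-- The triple for `(1, -x, 1-x)` is a quotient by the third component in two ways: of `(1, 1, x)`,
-- which is modulus `κ` at `it`, and, up to a swap, of `(1, -1, -(1-x))`, which is modulus `κ'` at
-- `t`. Dividing the latter by its second component gives `(1, 1, x)`, hence `nc`.
theorem eventually_jacobi_quotients : ∀ᶠ t in 𝓝 (0 : ℂ),
    (seriesEval (serS 1 (-x) (1 - x)) t = sd t κ' ∧
      -Complex.I * sd (Complex.I * t) κ = sd t κ') ∧
    (seriesEval (serC 1 1 x) t = nc t κ' ∧ cn (Complex.I * t) κ = nc t κ') ∧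
    (seriesEval (serC 1 (-x) (1 - x)) t = cd t κ' ∧ nd (Complex.I * t) κ = cd t κ') := by
  obtain ⟨a1, a2, a3⟩ := div_serD 1 x
  obtain ⟨b1, b2, b3⟩ := div_serD (-1) (-(1 - x))
  obtain ⟨c1, c2, c3⟩ := div_serD (-(1 - x)) (-1)
  rw [neg_neg, show -1 - -(1 - x) = -x by ring, (ser_swap _ _).1] at b1
  rw [neg_neg, show -1 - -(1 - x) = -x by ring, (ser_swap _ _).2.1] at b3
  rw [neg_neg, show -(1 - x) - -1 = x by ring, (ser_swap _ _).2.1] at c2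
  have g1 := hasGeomBound_ser 1 (-x) (1 - x)
  have g2 := hasGeomBound_ser 1 1 x
  have g3 := hasGeomBound_ser 1 (-1) (-(1 - x))
  filter_upwards [eventually_seriesEval_eq_div a1 g1.1 g2.2.2 (by simp),
    eventually_seriesEval_eq_div a2 g1.2.1 g2.2.2 (by simp),
    eventually_seriesEval_eq_div b1 g1.1 g3.2.2 (by simp),
    eventually_seriesEval_eq_div b3 g1.2.1 g3.2.2 (by simp),
    eventually_seriesEval_eq_div c2 g2.2.1 g3.2.1 (by simp)] with t h1 h2 h3 h4 h5
  rw [(seriesEval_imaginary x t).1, (seriesEval_imaginary x t).2.2] at h1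
  rw [(seriesEval_imaginary x t).2.2, seriesEval_one] at h2
  have h6 := h5
  rw [(seriesEval_imaginary x t).2.1] at h6
  simp only [sd, nc, cd, nd, sn_eq_seriesEval, cn_eq_seriesEval, dn_eq_seriesEval, hκ, hκ']
  rw [seriesEval_one] at h5 h6
  refine ⟨⟨h3, ?_⟩, ⟨h5, h6⟩, ⟨h4, ?_⟩⟩
  · rw [← h3, h1, mul_div_assoc]
  · rw [← h4, h2]

theorem hasSum_odd_of_even_eq_zero {f : ℕ → ℂ} {a : ℂ} (h : HasSum f a)
    (h0 : ∀ n, Even n → f n = 0) : HasSum (fun j => f (2 * j + 1)) a := by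
  have hinj : Function.Injective fun j : ℕ => 2 * j + 1 := fun a b h => by simpa using h
  refine (hinj.hasSum_iff fun n hn => h0 n ?_).2 h
  rw [← Nat.not_odd_iff_even]
  rintro ⟨m, rfl⟩
  exact hn ⟨m, rfl⟩

theorem hasSum_even_of_odd_eq_zero {f : ℕ → ℂ} {a : ℂ} (h : HasSum f a)
    (h0 : ∀ n, Odd n → f n = 0) : HasSum (fun j => f (2 * j)) a := by
  have hinj : Function.Injective fun j : ℕ => 2 * j := fun a b h => by simpa using h
  refine (hinj.hasSum_iff fun n hn => h0 n ?_).2 h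
  rw [← Nat.not_even_iff_odd, even_iff_exists_two_mul]
  rintro ⟨m, rfl⟩
  exact hn ⟨m, rfl⟩

theorem eventually_hasSum_serS (α β γ : ℂ) : ∀ᶠ t in 𝓝 (0 : ℂ), HasSum (fun j : ℕ =>
    eulerS α β γ (2 * j + 1) / ((2 * j + 1)! : ℂ) * t ^ (2 * j + 1))
    (seriesEval (serS α β γ) t) := by
  filter_upwards [(hasGeomBound_ser α β γ).1.hasSum] with t h
  refine (hasSum_odd_of_even_eq_zero h fun n hn => ?_).congr_fun fun j => ?_
  · rw [serS, coeff_egf, eulerS_even _ _ _ hn]; simp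
  · rw [serS, coeff_egf, smul_eq_mul, inv_mul_eq_div]

theorem eventually_hasSum_serC (α β γ : ℂ) : ∀ᶠ t in 𝓝 (0 : ℂ), HasSum (fun j : ℕ =>
    eulerC α β γ (2 * j) / ((2 * j)! : ℂ) * t ^ (2 * j)) (seriesEval (serC α β γ) t) := by
  filter_upwards [(hasGeomBound_ser α β γ).2.1.hasSum] with t h
  refine (hasSum_even_of_odd_eq_zero h fun n hn => ?_).congr_fun fun j => ?_
  · rw [serC, coeff_egf, eulerC_odd _ _ _ hn]; simp
  · rw [serC, coeff_egf, smul_eq_mul, inv_mul_eq_div]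

end Evaluation

open Filter Topology

/-! ### Telescoping over the integers, and moments of exponentially decaying sequences. -/

section IntSums

theorem hasSum_int_telescope {H : ℤ → ℂ} {L M : ℂ} (hs : Summable fun j => H (j + 1) - H j)
    (hL : Tendsto H atTop (𝓝 L)) (hM : Tendsto H atBot (𝓝 M)) :
    HasSum (fun j => H (j + 1) - H j) (L - M) := by
  have h1 : HasSum (fun n : ℕ => H ((n : ℤ) + 1) - H n) (L - H 0) := by
    have hs' : Summable fun n : ℕ => H ((n : ℤ) + 1) - H n :=
      hs.comp_injective (i := ((↑) : ℕ → ℤ)) Nat.cast_injective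
    refine hs'.hasSum_iff_tendsto_nat.2 ?_
    have e : ∀ n : ℕ, ∑ i ∈ Finset.range n, (H ((i : ℤ) + 1) - H i) = H n - H 0 := fun n => by
      have := Finset.sum_range_sub (fun i : ℕ => H i) n
      simpa using this
    simp_rw [e]
    exact (hL.comp tendsto_natCast_atTop_atTop).sub_const _
  have h2 : HasSum (fun n : ℕ => H (-((n : ℤ) + 1) + 1) - H (-((n : ℤ) + 1))) (H 0 - M) := by
    have hinj : Function.Injective fun n : ℕ => -((n : ℤ) + 1) := fun a b h => by
      simp only at h; omega
    have hs' : Summable fun n : ℕ => H (-((n : ℤ) + 1) + 1) - H (-((n : ℤ) + 1)) :=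
      hs.comp_injective hinj
    refine hs'.hasSum_iff_tendsto_nat.2 ?_
    have e : ∀ n : ℕ, ∑ i ∈ Finset.range n, (H (-((i : ℤ) + 1) + 1) - H (-((i : ℤ) + 1))) =
        H 0 - H (-(n : ℤ)) := fun n => by
      have := Finset.sum_range_sub' (fun i : ℕ => H (-(i : ℤ))) n
      simpa using this
    simp_rw [e]
    exact (hM.comp (tendsto_neg_atTop_atBot.comp tendsto_natCast_atTop_atTop)).const_sub _
  have := HasSum.of_nat_of_neg_add_one (f := fun j => H (j + 1) - H j) h1 h2
  simpa using this

/-- `h` itself need not be summable. A shift by `N * d` is a chain of `N` shifts by `d`, and after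
translating the index each contributes `c`. -/
theorem hasSum_int_shift {h : ℤ → ℂ} {d : ℤ} {c : ℂ} (hc : HasSum (fun j => h (j + d) - h j) c)
    (N : ℤ) : HasSum (fun j => h (j + N * d) - h j) (N * c) := by
  induction N using Int.induction_on with
  | zero => simp
  | succ n ih =>
    have := (((Equiv.addRight ((n : ℤ) * d)).hasSum_iff).2 hc).add ih
    convert this using 1
    · funext j
      simp only [Function.comp, Equiv.coe_addRight]
      rw [show j + ((n : ℤ) + 1) * d = j + n * d + d by ring]
      ring
    · push_cast; ring
  | pred n ih =>
    have := ih.sub (((Equiv.addRight ((-(n : ℤ) - 1) * d)).hasSum_iff).2 hc)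
    rw [show ((-(n : ℤ) : ℤ) : ℂ) * c - c = ((-(n : ℤ) - 1 : ℤ) : ℂ) * c by push_cast; ring] at this
    refine this.congr_fun fun j => ?_
    simp only [Function.comp, Equiv.coe_addRight]
    rw [show j + -(n : ℤ) * d = j + (-(n : ℤ) - 1) * d + d by ring]
    ring

/-- Exponential decay of a doubly infinite sequence. -/
def ExpDecay (f : ℤ → ℂ) : Prop :=
  ∃ C r : ℝ, 0 ≤ r ∧ r < 1 ∧ ∀ n, ‖f n‖ ≤ C * r ^ n.natAbs

theorem ExpDecay.summable_norm_pow_mul {f : ℤ → ℂ} (hf : ExpDecay f) (m : ℕ) :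
    Summable fun n : ℤ => ‖(n : ℂ) ^ m * f n‖ := by
  obtain ⟨C, r, hr0, hr1, h⟩ := hf
  have hs : Summable fun n : ℕ => C * ((n : ℝ) ^ m * r ^ n) :=
    (summable_pow_mul_geometric_of_norm_lt_one m
      (by rwa [Real.norm_of_nonneg hr0])).mul_left C
  refine Summable.of_nat_of_neg ?_ ?_
  · refine hs.of_nonneg_of_le (fun _ => norm_nonneg _) fun n => ?_
    have := mul_le_mul_of_nonneg_left (h n) (show 0 ≤ (n : ℝ) ^ m by positivity)
    simp only [Int.natAbs_natCast] at this
    rw [norm_mul, norm_pow, Int.cast_natCast, Complex.norm_natCast]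
    linarith
  · refine hs.of_nonneg_of_le (fun _ => norm_nonneg _) fun n => ?_
    have := mul_le_mul_of_nonneg_left (h (-n)) (show 0 ≤ (n : ℝ) ^ m by positivity)
    simp only [Int.natAbs_neg, Int.natAbs_natCast] at this
    rw [norm_mul, norm_pow, Int.cast_neg, Int.cast_natCast, norm_neg, Complex.norm_natCast]
    linarith

theorem ExpDecay.summable_norm {f : ℤ → ℂ} (hf : ExpDecay f) : Summable fun n => ‖f n‖ := by
  simpa using hf.summable_norm_pow_mul 0

theorem ExpDecay.summable {f : ℤ → ℂ} (hf : ExpDecay f) : Summable f := hf.summable_norm.of_norm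

theorem ExpDecay.bounded {f : ℤ → ℂ} (hf : ExpDecay f) : ∃ B, ∀ n, ‖f n‖ ≤ B := by
  obtain ⟨C, r, hr0, hr1, h⟩ := hf
  refine ⟨|C|, fun n => (h n).trans ?_⟩
  calc C * r ^ n.natAbs ≤ |C| * 1 :=
        mul_le_mul (le_abs_self C) (pow_le_one₀ hr0 hr1.le) (by positivity) (abs_nonneg C)
    _ = |C| := mul_one _

theorem ExpDecay.summable_mul {f g : ℤ → ℂ} (hf : ExpDecay f) {B : ℝ} (hg : ∀ n, ‖g n‖ ≤ B) :
    Summable fun n => f n * g n := by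
  refine Summable.of_norm_bounded (hf.summable_norm.mul_right B) fun n => ?_
  rw [norm_mul]
  exact mul_le_mul_of_nonneg_left (hg n) (norm_nonneg _)

/-- The moments of a doubly infinite sequence twisted by the character `n ↦ ω ^ n`. -/
noncomputable def moment (ω : ℂ) (f : ℤ → ℂ) (m : ℕ) : ℂ := ∑' n : ℤ, ω ^ n * ((n : ℂ) ^ m * f n)

theorem ExpDecay.summable_norm_moment {ω : ℂ} (hω : ‖ω‖ = 1) {f : ℤ → ℂ} (hf : ExpDecay f) (m : ℕ) :
    Summable fun n : ℤ => ‖ω ^ n * ((n : ℂ) ^ m * f n)‖ := by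
  simpa [norm_mul, hω] using hf.summable_norm_pow_mul m

/-- The bijection `(N, j) ↦ (j, N - j)`. -/
def convEquiv : ℤ × ℤ ≃ ℤ × ℤ where
  toFun x := (x.2, x.1 - x.2)
  invFun x := (x.1 + x.2, x.1)
  left_inv x := by simp
  right_inv x := by simp

theorem hasSum_conv_of_hasSum_prod {F : ℤ × ℤ → ℂ} {a : ℂ} (hF : HasSum F a) :
    HasSum (fun N => ∑' j, F (j, N - j)) a := by
  have h := convEquiv.hasSum_iff.2 hF
  exact h.prod_fiberwise fun N => (h.summable.prod_factor N).hasSum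

/-- Moments are the derivatives at `0` of `∑ ω^n f(n) e^{nt}`, and multiplying two such series
convolves `f` with `g`. Concretely, `(j + k)^m` is expanded by the binomial theorem and the double
sum is regrouped by `N = j + k`. -/
theorem hasSum_binomConv_moment {ω : ℂ} (hω : ‖ω‖ = 1) {f g : ℤ → ℂ} (hf : ExpDecay f)
    (hg : ExpDecay g) (m : ℕ) :
    HasSum (fun N : ℤ => ω ^ N * ((N : ℂ) ^ m * ∑' j, f j * g (N - j)))
      (binomConv (moment ω f) (moment ω g) m) := by
  have hω0 : ω ≠ 0 := by rintro rfl; simp at hω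
  have hsum : ∀ i k, HasSum (fun x : ℤ × ℤ =>
      (ω ^ x.1 * ((x.1 : ℂ) ^ i * f x.1)) * (ω ^ x.2 * ((x.2 : ℂ) ^ k * g x.2)))
      (moment ω f i * moment ω g k) := fun i k => by
    rw [moment, moment, tsum_mul_tsum_of_summable_norm
          (hf.summable_norm_moment hω _) (hg.summable_norm_moment hω _)]
    exact (summable_mul_of_summable_norm (hf.summable_norm_moment hω i)
      (hg.summable_norm_moment hω k)).hasSum
  have hS : HasSum (fun x : ℤ × ℤ =>
      ω ^ (x.1 + x.2) * (((x.1 + x.2 : ℤ) : ℂ) ^ m * (f x.1 * g x.2)))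
      (binomConv (moment ω f) (moment ω g) m) := by
    have h := hasSum_sum (s := Finset.HasAntidiagonal.antidiagonal m) fun (ij : ℕ × ℕ) _ =>
      (hsum ij.1 ij.2).mul_left (m.choose ij.1 : ℂ)
    refine h.congr_fun fun x => ?_
    push_cast
    rw [(Commute.all (x.1 : ℂ) (x.2 : ℂ)).add_pow', zpow_add₀ hω0, Finset.sum_mul, Finset.mul_sum]
    refine Finset.sum_congr rfl fun ij _ => ?_
    rw [nsmul_eq_mul]
    ring
  refine (hasSum_conv_of_hasSum_prod hS).congr_fun fun N => ?_
  simp only [add_sub_cancel]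
  rw [tsum_mul_left, tsum_mul_left]

theorem binomConv_moment {ω : ℂ} (hω : ‖ω‖ = 1) {f g : ℤ → ℂ} (hf : ExpDecay f) (hg : ExpDecay g)
    (m : ℕ) : binomConv (moment ω f) (moment ω g) m =
      moment ω (fun N => ∑' j, f j * g (N - j)) m :=
  (hasSum_binomConv_moment hω hf hg m).tsum_eq.symm

end IntSums

/-! ### Convolutions of hyperbolic coefficients and the differential system for Lambert series. -/

section Hyperbolic

variable {p : ℂ}

/-- `1 / (p ^ n + p ^ (-n))`. -/
noncomputable def sechCoeff (p : ℂ) (n : ℤ) : ℂ := 1 / (p ^ n + p ^ (-n))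

/-- `1 / (p ^ (-n) - p ^ n)`. -/
noncomputable def cschCoeff (p : ℂ) (n : ℤ) : ℂ := 1 / (p ^ (-n) - p ^ n)

noncomputable def tanhCoeff (p : ℂ) (n : ℤ) : ℂ := (p ^ (-n) - p ^ n) * sechCoeff p n
noncomputable def cothCoeff (p : ℂ) (n : ℤ) : ℂ := (p ^ n + p ^ (-n)) * cschCoeff p n

theorem sechCoeff_neg (p : ℂ) (n : ℤ) : sechCoeff p (-n) = sechCoeff p n := by
  rw [sechCoeff, sechCoeff, neg_neg, add_comm]

theorem cschCoeff_neg (p : ℂ) (n : ℤ) : cschCoeff p (-n) = -cschCoeff p n := by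
  rw [cschCoeff, cschCoeff, neg_neg, ← neg_sub, one_div, one_div, inv_neg]

theorem tanhCoeff_neg (p : ℂ) (n : ℤ) : tanhCoeff p (-n) = -tanhCoeff p n := by
  rw [tanhCoeff, tanhCoeff, sechCoeff_neg, neg_neg]; ring

theorem cothCoeff_neg (p : ℂ) (n : ℤ) : cothCoeff p (-n) = -cothCoeff p n := by
  rw [cothCoeff, cothCoeff, cschCoeff_neg, neg_neg]; ring

theorem sechCoeff_natCast (hp0 : p ≠ 0) (n : ℕ) :
    sechCoeff p n = p ^ n / (1 + p ^ (2 * n)) := by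
  have h : p ^ n ≠ 0 := pow_ne_zero n hp0
  rw [sechCoeff, zpow_neg, zpow_natCast, two_mul, pow_add, add_comm, one_div, div_eq_mul_inv]
  have : (p ^ n)⁻¹ + p ^ n = (p ^ n)⁻¹ * (1 + p ^ n * p ^ n) := by field_simp
  rw [this, mul_inv, inv_inv]

theorem cschCoeff_natCast (hp0 : p ≠ 0) (n : ℕ) :
    cschCoeff p n = p ^ n / (1 - p ^ (2 * n)) := by
  have h : p ^ n ≠ 0 := pow_ne_zero n hp0
  rw [cschCoeff, zpow_neg, zpow_natCast, two_mul, pow_add, one_div, div_eq_mul_inv]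
  have : (p ^ n)⁻¹ - p ^ n = (p ^ n)⁻¹ * (1 - p ^ n * p ^ n) := by field_simp
  rw [this, mul_inv, inv_inv]

theorem norm_one_add_ge (hp1 : ‖p‖ < 1) {e : ℂ} (he : ‖e‖ = 1) {n : ℕ} (hn : n ≠ 0) :
    1 - ‖p‖ ≤ ‖1 + e * p ^ (2 * n)‖ := by
  have h1 : ‖e * p ^ (2 * n)‖ ≤ ‖p‖ := by
    rw [norm_mul, he, one_mul, norm_pow]
    exact pow_le_of_le_one (norm_nonneg _) hp1.le (by omega)
  have h2 := norm_sub_norm_le (1 : ℂ) (-(e * p ^ (2 * n)))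
  rw [norm_neg, sub_neg_eq_add, norm_one] at h2
  linarith

theorem zpow_add_zpow_neg_ne_zero (hp0 : p ≠ 0) (hp1 : ‖p‖ < 1) (n : ℤ) :
    p ^ n + p ^ (-n) ≠ 0 := by
  intro h
  have h1 : ‖p‖ ^ n = ‖p‖ ^ (-n) := by
    rw [← norm_zpow, ← norm_zpow, eq_neg_of_add_eq_zero_left h, norm_neg]
  have h2 := zpow_right_injective₀ (norm_pos_iff.2 hp0) hp1.ne h1
  obtain rfl : n = 0 := by omega
  norm_num at h

theorem zpow_neg_sub_zpow_ne_zero (hp0 : p ≠ 0) (hp1 : ‖p‖ < 1) {n : ℤ} (hn : n ≠ 0) :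
    p ^ (-n) - p ^ n ≠ 0 := by
  intro h
  have h1 : ‖p‖ ^ n = ‖p‖ ^ (-n) := by
    rw [← norm_zpow, ← norm_zpow, sub_eq_zero.1 h]
  have h2 := zpow_right_injective₀ (norm_pos_iff.2 hp0) hp1.ne h1
  omega

theorem norm_sechCoeff_le (hp0 : p ≠ 0) (hp1 : ‖p‖ < 1) (n : ℤ) :
    ‖sechCoeff p n‖ ≤ (1 - ‖p‖)⁻¹ * ‖p‖ ^ n.natAbs := by
  have hpos : 0 < 1 - ‖p‖ := by linarith
  have key : ∀ n : ℕ, ‖sechCoeff p n‖ ≤ (1 - ‖p‖)⁻¹ * ‖p‖ ^ n := fun n => by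
    rw [sechCoeff_natCast hp0, norm_div, norm_pow, div_eq_inv_mul]
    refine mul_le_mul_of_nonneg_right (inv_anti₀ hpos ?_) (by positivity)
    rcases eq_or_ne n 0 with rfl | hn
    · norm_num
      linarith [norm_nonneg p]
    · simpa using norm_one_add_ge hp1 (e := 1) (by simp) hn
  obtain ⟨k, rfl | rfl⟩ := n.eq_nat_or_neg
  · exact key k
  · simpa [sechCoeff_neg] using key k

theorem norm_cschCoeff_le (hp0 : p ≠ 0) (hp1 : ‖p‖ < 1) (n : ℤ) :
    ‖cschCoeff p n‖ ≤ (1 - ‖p‖)⁻¹ * ‖p‖ ^ n.natAbs := by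
  have hpos : 0 < 1 - ‖p‖ := by linarith
  have key : ∀ n : ℕ, ‖cschCoeff p n‖ ≤ (1 - ‖p‖)⁻¹ * ‖p‖ ^ n := fun n => by
    rcases eq_or_ne n 0 with rfl | hn
    -- At `n = 0` the coefficient is `1 / 0 = 0` by convention; only odd indices are used later.
    · simpa [cschCoeff] using hp1.le
    · rw [cschCoeff_natCast hp0, norm_div, norm_pow, div_eq_inv_mul]
      refine mul_le_mul_of_nonneg_right (inv_anti₀ hpos ?_) (by positivity)
      simpa [← sub_eq_add_neg] using norm_one_add_ge hp1 (e := -1) (by simp) hn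
  obtain ⟨k, rfl | rfl⟩ := n.eq_nat_or_neg
  · exact key k
  · simpa [cschCoeff_neg] using key k

theorem expDecay_sechCoeff (hp0 : p ≠ 0) (hp1 : ‖p‖ < 1) : ExpDecay (sechCoeff p) :=
  ⟨_, _, norm_nonneg p, hp1, norm_sechCoeff_le hp0 hp1⟩

theorem expDecay_cschCoeff (hp0 : p ≠ 0) (hp1 : ‖p‖ < 1) : ExpDecay (cschCoeff p) :=
  ⟨_, _, norm_nonneg p, hp1, norm_cschCoeff_le hp0 hp1⟩

/-- Restriction of a sequence to the integers congruent to `r` modulo `2`. -/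
def parity (r : ℤ) (f : ℤ → ℂ) (n : ℤ) : ℂ := if Even (n + r) then f n else 0

theorem ExpDecay.parity {f : ℤ → ℂ} (hf : ExpDecay f) (r : ℤ) : ExpDecay (parity r f) := by
  obtain ⟨C, s, h0, h1, h⟩ := hf
  refine ⟨C, s, h0, h1, fun n => ?_⟩
  rw [LabelGF.parity]
  split_ifs
  · exact h n
  · rw [norm_zero]; exact (norm_nonneg _).trans (h n)

theorem tendsto_tanhCoeff_atTop (hp0 : p ≠ 0) (hp1 : ‖p‖ < 1) :
    Tendsto (tanhCoeff p) atTop (𝓝 1) := by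
  have h0 : Tendsto (fun n : ℤ => 2 * ‖sechCoeff p n‖) atTop (𝓝 0) := by
    have := ((expDecay_sechCoeff hp0 hp1).summable_norm.tendsto_cofinite_zero).const_mul 2
    rw [mul_zero] at this
    exact this.mono_left atTop_le_cofinite
  rw [tendsto_iff_norm_sub_tendsto_zero]
  refine squeeze_zero' (Eventually.of_forall fun _ => norm_nonneg _) ?_ h0
  filter_upwards [eventually_ge_atTop 0] with n hn
  have e : tanhCoeff p n - 1 = -(2 * p ^ n * sechCoeff p n) := by
    have := zpow_add_zpow_neg_ne_zero hp0 hp1 n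
    rw [tanhCoeff, sechCoeff]
    field_simp
    ring
  rw [e, norm_neg, norm_mul, norm_mul, norm_zpow, Complex.norm_two]
  lift n to ℕ using hn
  rw [zpow_natCast]
  exact mul_le_mul_of_nonneg_right
    (mul_le_of_le_one_right two_pos.le (pow_le_one₀ (norm_nonneg _) hp1.le)) (norm_nonneg _)

theorem tendsto_tanhCoeff_atBot (hp0 : p ≠ 0) (hp1 : ‖p‖ < 1) :
    Tendsto (tanhCoeff p) atBot (𝓝 (-1)) := by
  have := ((tendsto_tanhCoeff_atTop hp0 hp1).comp tendsto_neg_atBot_atTop).neg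
  refine this.congr fun n => ?_
  simp [tanhCoeff_neg]

/-- Telescoping inside one residue class modulo `2`: the sum is the difference of the limits `1` and
`-1`. -/
theorem hasSum_parity_tanhCoeff (hp0 : p ≠ 0) (hp1 : ‖p‖ < 1) (r : ℤ) :
    HasSum (fun j => parity r (tanhCoeff p) (j + 2) - parity r (tanhCoeff p) j) 2 := by
  obtain ⟨B, hB⟩ := (expDecay_sechCoeff hp0 hp1).bounded
  have hs : Summable fun j => parity r (tanhCoeff p) (j + 2) - parity r (tanhCoeff p) j := by
    have h1 := ((expDecay_sechCoeff hp0 hp1).parity r).summable_mul (g := fun j =>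
      sechCoeff p (j + 2)) (fun n => hB (n + 2))
    -- Subtraction formula for `tanh`: the difference is `2(p^{-2} - p²)` times the product of the
    -- two `sech` coefficients, which decays.
    refine (h1.mul_left (2 * (p ^ (-2 : ℤ) - p ^ (2 : ℤ)))).congr fun j => ?_
    have hpar : Even (j + 2 + r) ↔ Even (j + r) := by
      rw [show j + 2 + r = j + r + 2 by ring]; simp [Int.even_add]
    simp only [parity, hpar]
    split_ifs
    · have a1 := zpow_add_zpow_neg_ne_zero hp0 hp1 j
      have a2 := zpow_add_zpow_neg_ne_zero hp0 hp1 (j + 2)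
      rw [tanhCoeff, tanhCoeff, sechCoeff, sechCoeff]
      field_simp
      rw [neg_add, zpow_add₀ hp0, zpow_add₀ hp0, zpow_neg, zpow_neg]
      have := zpow_ne_zero j hp0
      field_simp
      ring
    · simp
  -- The sum of two neighbours turns a step of `2` into a step of `1`; exactly one of the two lies
  -- in the residue class, so the limits are those of `tanhCoeff`.
  have key := hasSum_int_telescope
    (H := fun j => parity r (tanhCoeff p) j + parity r (tanhCoeff p) (j + 1)) (L := 1) (M := -1)
    (hs.congr fun j => by ring_nf) ?_ ?_
  · convert key using 1
    · funext j; ring_nf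
    · norm_num
  · have e : ∀ j, (if Even (j + r) then tanhCoeff p j else tanhCoeff p (j + 1)) =
        parity r (tanhCoeff p) j + parity r (tanhCoeff p) (j + 1) := fun j => by
      have : Even (j + 1 + r) ↔ ¬ Even (j + r) := by
        rw [show j + 1 + r = j + r + 1 by ring, Int.even_add_one]
      simp only [parity, this]
      split_ifs <;> simp
    refine Tendsto.congr e (Tendsto.if' (tendsto_tanhCoeff_atTop hp0 hp1)
      ((tendsto_tanhCoeff_atTop hp0 hp1).comp (tendsto_atTop_add_const_right _ 1 tendsto_id)))
  · have e : ∀ j, (if Even (j + r) then tanhCoeff p j else tanhCoeff p (j + 1)) =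
        parity r (tanhCoeff p) j + parity r (tanhCoeff p) (j + 1) := fun j => by
      have : Even (j + 1 + r) ↔ ¬ Even (j + r) := by
        rw [show j + 1 + r = j + r + 1 by ring, Int.even_add_one]
      simp only [parity, this]
      split_ifs <;> simp
    refine Tendsto.congr e (Tendsto.if' (tendsto_tanhCoeff_atBot hp0 hp1)
      ((tendsto_tanhCoeff_atBot hp0 hp1).comp (tendsto_atBot_add_const_right _ 1 tendsto_id)))

/-- Averaging over `j` and `-j` removes the odd `u` and leaves half of `tanh(N-j) + tanh(N+j) =
tanh(j+N) - tanh(j-N)`. This is a shift by `2N` in one residue class, that is, `N` shifts by `2`,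
each contributing `2`. -/
theorem tsum_parity_add_tanhCoeff (hp0 : p ≠ 0) (hp1 : ‖p‖ < 1) (r N : ℤ) {u : ℤ → ℂ}
    (hu : ∀ j, u (-j) = -u j)
    (hs : Summable (parity r fun j => u j + tanhCoeff p (N - j))) :
    ∑' j, parity r (fun j => u j + tanhCoeff p (N - j)) j = N := by
  set f := parity r fun j => u j + tanhCoeff p (N - j) with hf
  have h1 : HasSum f (∑' j, f j) := hs.hasSum
  have h2 : HasSum (f ∘ Equiv.neg ℤ) (∑' j, f j) := (Equiv.neg ℤ).hasSum_iff.2 h1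
  have h3 := hasSum_int_shift (hasSum_parity_tanhCoeff hp0 hp1 (r + N)) N
  have h4 := (Equiv.subRight N).hasSum_iff.2 h3
  have e : ∀ j, f j + (f ∘ Equiv.neg ℤ) j = ((fun j => parity (r + N) (tanhCoeff p) (j + N * 2) -
      parity (r + N) (tanhCoeff p) j) ∘ Equiv.subRight N) j := fun j => by
    change f j + f (-j) = _
    have p1 : Even (-j + r) ↔ Even (j + r) := by simp [Int.even_add]
    have p2 : Even (j - N + N * 2 + (r + N)) ↔ Even (j + r) := by
      rw [show j - N + N * 2 + (r + N) = j + r + 2 * N by ring]; simp [Int.even_add]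
    have p3 : Even (j - N + (r + N)) ↔ Even (j + r) := by
      rw [show j - N + (r + N) = j + r by ring]
    simp only [hf, parity, Function.comp, Equiv.subRight_apply, p1, p2, p3]
    split_ifs
    · rw [hu, show j - N + N * 2 = N - -j by ring, ← neg_sub N j, tanhCoeff_neg]
      ring
    · simp
  have h5 := (h1.add h2).unique (h4.congr_fun e)
  have h6 : (2 : ℂ) ≠ 0 := two_ne_zero
  apply mul_left_cancel₀ h6
  linear_combination h5

/-- The convolution of hyperbolic coefficients of given parities. -/
theorem tsum_parity_mul_sechCoeff (hp0 : p ≠ 0) (hp1 : ‖p‖ < 1) {r s N : ℤ}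
    (hN : Even (N + r + s)) {f u : ℤ → ℂ} {k : ℂ} (hf : ExpDecay f) (hk : k ≠ 0)
    (hu : ∀ j, u (-j) = -u j) (h : ∀ j, Even (j + r) →
      f j * sechCoeff p (N - j) = k / 2 * (u j + tanhCoeff p (N - j))) :
    ∑' j, parity r f j * parity s (sechCoeff p) (N - j) = N * k / 2 := by
  have e : ∀ j, parity r f j * parity s (sechCoeff p) (N - j) =
      k / 2 * parity r (fun j => u j + tanhCoeff p (N - j)) j := fun j => by
    by_cases hj : Even (j + r)
    · have : Even (N - j + s) := by
        rw [show N - j + s = (N + r + s) - (j + r) by ring]; exact hN.sub hj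
      simp only [parity, hj, this, if_true, h j hj]
    · simp [parity, hj]
  obtain ⟨B, hB⟩ := ((expDecay_sechCoeff hp0 hp1).parity s).bounded
  have hs : Summable (parity r fun j => u j + tanhCoeff p (N - j)) := by
    have h1 := (hf.parity r).summable_mul (g := fun j => parity s (sechCoeff p) (N - j))
      (fun n => hB (N - n))
    refine (h1.mul_left (2 / k)).congr fun j => ?_
    rw [e]
    field_simp
  rw [tsum_congr e, tsum_mul_left, tsum_parity_add_tanhCoeff hp0 hp1 r N hu hs]
  ring

theorem tsum_parity_mul_eq_zero {r s N : ℤ} (hN : ¬ Even (N + r + s)) (f g : ℤ → ℂ) :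
    ∑' j, parity r f j * parity s g (N - j) = 0 := by
  rw [← tsum_zero (α := ℂ) (β := ℤ)]
  refine tsum_congr fun j => ?_
  by_cases hj : Even (j + r)
  · have : ¬ Even (N - j + s) := fun h => hN (by
      rw [show N + r + s = (j + r) + (N - j + s) by ring]; exact hj.add h)
    simp [parity, this]
  · simp [parity, hj]

/-- This is `sinh(a+b) = cosh a cosh b (tanh a + tanh b)`. -/
theorem sech_mul_sech (hp0 : p ≠ 0) (hp1 : ‖p‖ < 1) {N : ℤ} (hN : N ≠ 0) (j : ℤ) :
    sechCoeff p j * sechCoeff p (N - j) =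
      cschCoeff p N / 2 * (tanhCoeff p j + tanhCoeff p (N - j)) := by
  have h1 := zpow_add_zpow_neg_ne_zero hp0 hp1 j
  have h2 := zpow_add_zpow_neg_ne_zero hp0 hp1 (N - j)
  have h3 := zpow_neg_sub_zpow_ne_zero hp0 hp1 hN
  obtain ⟨k, rfl⟩ : ∃ k, N = j + k := ⟨N - j, by ring⟩
  rw [add_sub_cancel_left] at *
  rw [tanhCoeff, tanhCoeff, sechCoeff, sechCoeff, cschCoeff]
  field_simp
  rw [neg_add, zpow_add₀ hp0, zpow_add₀ hp0]
  have e1 : p ^ j * p ^ (-j) = 1 := by rw [← zpow_add₀ hp0]; simp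
  have e2 : p ^ k * p ^ (-k) = 1 := by rw [← zpow_add₀ hp0]; simp
  ring

/-- This is `cosh(a+b) = sinh a cosh b (coth a + tanh b)`. -/
theorem csch_mul_sech (hp0 : p ≠ 0) (hp1 : ‖p‖ < 1) (N : ℤ) {j : ℤ} (hj : j ≠ 0) :
    cschCoeff p j * sechCoeff p (N - j) =
      sechCoeff p N / 2 * (cothCoeff p j + tanhCoeff p (N - j)) := by
  have h1 := zpow_neg_sub_zpow_ne_zero hp0 hp1 hj
  have h2 := zpow_add_zpow_neg_ne_zero hp0 hp1 (N - j)
  have h3 := zpow_add_zpow_neg_ne_zero hp0 hp1 N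
  obtain ⟨k, rfl⟩ : ∃ k, N = j + k := ⟨N - j, by ring⟩
  rw [add_sub_cancel_left] at *
  rw [cothCoeff, tanhCoeff, sechCoeff, sechCoeff, cschCoeff]
  field_simp
  rw [neg_add, zpow_add₀ hp0, zpow_add₀ hp0]
  ring

theorem sechCoeff_ne_zero (hp0 : p ≠ 0) (hp1 : ‖p‖ < 1) (N : ℤ) : sechCoeff p N ≠ 0 :=
  one_div_ne_zero (zpow_add_zpow_neg_ne_zero hp0 hp1 N)

theorem cschCoeff_ne_zero (hp0 : p ≠ 0) (hp1 : ‖p‖ < 1) {N : ℤ} (hN : N ≠ 0) :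
    cschCoeff p N ≠ 0 :=
  one_div_ne_zero (zpow_neg_sub_zpow_ne_zero hp0 hp1 hN)

/-- A factor `N` in the coefficients raises the moment by one: it is the derivative in the
differential system. -/
theorem moment_half_mul (ω : ℂ) {f g : ℤ → ℂ} (h : ∀ N : ℤ, f N = N * g N / 2) (m : ℕ) :
    moment ω g (m + 1) = 2 * moment ω f m := by
  rw [moment, moment, ← tsum_mul_left]
  refine tsum_congr fun n => ?_
  rw [h]
  ring

/-- The Lambert series form of the differential equations of the Jacobi elliptic functions. -/
theorem isEulerTriple_moment (hp0 : p ≠ 0) (hp1 : ‖p‖ < 1) {ω : ℂ} (hω : ‖ω‖ = 1) :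
    IsEulerTriple 2 2 2 (moment ω (parity 1 (cschCoeff p))) (moment ω (parity 1 (sechCoeff p)))
      (moment ω (parity 0 (sechCoeff p))) := by
  have dS := (expDecay_cschCoeff hp0 hp1).parity 1
  have dC := (expDecay_sechCoeff hp0 hp1).parity 1
  have dD := (expDecay_sechCoeff hp0 hp1).parity 0
  refine ⟨fun n => ?_, fun n => ?_, fun n => ?_⟩
  · rw [binomConv_moment hω dC dD]
    refine moment_half_mul ω (fun N => ?_) n
    by_cases hN : Even (N + 1)
    · have hN0 : N ≠ 0 := by rintro rfl; exact absurd hN (by decide)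
      rw [tsum_parity_mul_sechCoeff hp0 hp1 (by simpa using hN) (expDecay_sechCoeff hp0 hp1)
        (cschCoeff_ne_zero hp0 hp1 hN0) (tanhCoeff_neg p) fun j _ => sech_mul_sech hp0 hp1 hN0 j]
      simp [parity, hN]
    · rw [tsum_parity_mul_eq_zero (by simpa using hN)]
      simp [parity, hN]
  · rw [binomConv_moment hω dS dD]
    refine moment_half_mul ω (fun N => ?_) n
    by_cases hN : Even (N + 1)
    · rw [tsum_parity_mul_sechCoeff hp0 hp1 (by simpa using hN) (expDecay_cschCoeff hp0 hp1)
        (sechCoeff_ne_zero hp0 hp1 N) (cothCoeff_neg p) fun j hj => csch_mul_sech hp0 hp1 N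
          (by rintro rfl; exact absurd hj (by decide))]
      simp [parity, hN]
    · rw [tsum_parity_mul_eq_zero (by simpa using hN)]
      simp [parity, hN]
  · rw [binomConv_moment hω dS dC]
    refine moment_half_mul ω (fun N => ?_) n
    have h2 : Even (N + 1 + 1) ↔ Even (N + 0) := by
      rw [show N + 1 + 1 = N + 0 + 2 by ring]; simp
    by_cases hN : Even (N + 0)
    · rw [tsum_parity_mul_sechCoeff hp0 hp1 (h2.2 hN) (expDecay_cschCoeff hp0 hp1)
        (sechCoeff_ne_zero hp0 hp1 N) (cothCoeff_neg p) fun j hj => csch_mul_sech hp0 hp1 N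
          (by rintro rfl; exact absurd hj (by decide))]
      simp only [parity, hN, if_true]
    · rw [tsum_parity_mul_eq_zero (mt h2.1 hN)]
      simp only [parity, hN, if_false]; ring

theorem sq_eq_binomConv (f : ℕ → ℂ) : f 0 ^ 2 = binomConv f f 0 := by
  simp [binomConv, sq]

/-- The first integral `D² - C²` does not depend on the twist. -/
theorem moment_sq_sub_sq (hp0 : p ≠ 0) (hp1 : ‖p‖ < 1) {ω : ℂ} (hω : ‖ω‖ = 1) :
    moment ω (parity 0 (sechCoeff p)) 0 ^ 2 - moment ω (parity 1 (sechCoeff p)) 0 ^ 2 =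
      moment 1 (parity 0 (sechCoeff p)) 0 ^ 2 - moment 1 (parity 1 (sechCoeff p)) 0 ^ 2 := by
  have dC := (expDecay_sechCoeff hp0 hp1).parity 1
  have dD := (expDecay_sechCoeff hp0 hp1).parity 0
  set cD : ℤ → ℂ := fun N => ∑' j, parity 0 (sechCoeff p) j * parity 0 (sechCoeff p) (N - j)
  set cC : ℤ → ℂ := fun N => ∑' j, parity 1 (sechCoeff p) j * parity 1 (sechCoeff p) (N - j)
  -- For even `N ≠ 0` both convolutions are `N * cschCoeff p N / 2`, and for odd `N` both vanish.
  -- Only `N = 0` survives in the difference, where the twist `ω^0` is `1`.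
  have hcc : ∀ N, N ≠ 0 → cD N = cC N := fun N hN => by
    have h2 : Even (N + 1 + 1) ↔ Even (N + 0 + 0) := by
      rw [show N + 1 + 1 = N + 0 + 0 + 2 by ring]; simp
    by_cases hE : Even (N + 0 + 0)
    · simp only [cD, cC]
      rw [tsum_parity_mul_sechCoeff hp0 hp1 hE (expDecay_sechCoeff hp0 hp1)
        (cschCoeff_ne_zero hp0 hp1 hN) (tanhCoeff_neg p) fun j _ => sech_mul_sech hp0 hp1 hN j,
        tsum_parity_mul_sechCoeff hp0 hp1 (h2.2 hE) (expDecay_sechCoeff hp0 hp1)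
        (cschCoeff_ne_zero hp0 hp1 hN) (tanhCoeff_neg p) fun j _ => sech_mul_sech hp0 hp1 hN j]
    · simp only [cD, cC]
      rw [tsum_parity_mul_eq_zero hE, tsum_parity_mul_eq_zero (mt h2.1 hE)]
  have key : ∀ ω : ℂ, ‖ω‖ = 1 → moment ω (parity 0 (sechCoeff p)) 0 ^ 2 -
      moment ω (parity 1 (sechCoeff p)) 0 ^ 2 = cD 0 - cC 0 := fun ω hω => by
    rw [sq_eq_binomConv, sq_eq_binomConv]
    refine ((hasSum_binomConv_moment hω dD dD 0).sub (hasSum_binomConv_moment hω dC dC 0)).unique ?_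
    convert hasSum_single (0 : ℤ) fun N hN => ?_ using 1
    · simp [cD, cC]
    · rw [show ∑' j, parity 0 (sechCoeff p) j * parity 0 (sechCoeff p) (N - j) = cD N from rfl,
        hcc N hN, sub_self]
  rw [key ω hω, key 1 (by simp)]

end Hyperbolic

/-! ### Infinite products and the Jacobi triple product. -/

section TripleProduct

/-- The `q`-Pochhammer symbol `(x; Q)_∞`. -/
noncomputable def qPoch (Q x : ℂ) : ℂ := ∏' i : ℕ, (1 - x * Q ^ i)

variable {Q : ℂ}

theorem summable_norm_mul_pow (hQ : ‖Q‖ < 1) (x : ℂ) : Summable fun i : ℕ => ‖x * Q ^ i‖ := by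
  simp_rw [norm_mul, norm_pow]
  exact (summable_geometric_of_lt_one (norm_nonneg _) hQ).mul_left _

theorem multipliable_qPoch (hQ : ‖Q‖ < 1) (x : ℂ) : Multipliable fun i : ℕ => 1 - x * Q ^ i := by
  simp_rw [sub_eq_add_neg]
  exact multipliable_one_add_of_summable (by simpa using summable_norm_mul_pow hQ x)

theorem tendsto_prod_qPoch (hQ : ‖Q‖ < 1) (x : ℂ) :
    Tendsto (fun n => ∏ i ∈ Finset.range n, (1 - x * Q ^ i)) atTop (𝓝 (qPoch Q x)) :=
  (multipliable_qPoch hQ x).hasProd.tendsto_prod_nat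

theorem qPoch_ne_zero (hQ : ‖Q‖ < 1) {x : ℂ} (hx : ∀ i : ℕ, 1 - x * Q ^ i ≠ 0) :
    qPoch Q x ≠ 0 := by
  rw [qPoch]
  simp_rw [sub_eq_add_neg]
  refine tprod_one_add_ne_zero_of_summable (f := fun i => -(x * Q ^ i)) ?_ ?_
  · exact fun i => by simpa [sub_eq_add_neg] using hx i
  · simpa using summable_norm_mul_pow hQ x

theorem one_sub_mul_pow_ne_zero (hQ : ‖Q‖ < 1) {x : ℂ} (hx : ‖x‖ < 1) (i : ℕ) :
    1 - x * Q ^ i ≠ 0 := by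
  intro h
  have h1 : ‖x * Q ^ i‖ = 1 := by rw [← sub_eq_zero.1 h, norm_one]
  rw [norm_mul, norm_pow] at h1
  have h2 : ‖Q‖ ^ i ≤ 1 := pow_le_one₀ (norm_nonneg _) hQ.le
  nlinarith [norm_nonneg x]

theorem qPoch_ne_zero_of_norm_lt (hQ : ‖Q‖ < 1) {x : ℂ} (hx : ‖x‖ < 1) : qPoch Q x ≠ 0 :=
  qPoch_ne_zero hQ (one_sub_mul_pow_ne_zero hQ hx)

theorem qPoch_eq_one_sub_mul (hQ : ‖Q‖ < 1) (x : ℂ) :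
    qPoch Q x = (1 - x) * qPoch Q (x * Q) := by
  refine tendsto_nhds_unique ((tendsto_prod_qPoch hQ x).comp (tendsto_add_atTop_nat 1)) ?_
  refine ((tendsto_prod_qPoch hQ (x * Q)).const_mul (1 - x)).congr fun n => ?_
  rw [Function.comp, Finset.prod_range_succ']
  simp only [pow_zero, mul_one]
  rw [mul_comm]
  congr 1
  refine Finset.prod_congr rfl fun i _ => ?_
  ring

theorem continuous_qPoch (hQ : ‖Q‖ < 1) : Continuous (qPoch Q) := by
  rw [continuous_iff_continuousAt]
  intro x
  have h := tendsto_tprod_one_add_of_dominated_convergence (𝓕 := 𝓝 x)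
    (f := fun (y : ℂ) (i : ℕ) => -(y * Q ^ i)) (g := fun i => -(x * Q ^ i))
    (bound := fun i => (‖x‖ + 1) * ‖Q‖ ^ i)
    ((summable_geometric_of_lt_one (norm_nonneg _) hQ).mul_left _)
    (fun k => by
      have : Continuous fun y : ℂ => -(y * Q ^ k) := by fun_prop
      exact this.tendsto x) ?_
  · change Tendsto (fun y => ∏' i : ℕ, (1 - y * Q ^ i)) _ (𝓝 (∏' i : ℕ, (1 - x * Q ^ i)))
    simpa [sub_eq_add_neg] using h
  · filter_upwards [Metric.ball_mem_nhds x one_pos] with y hy k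
    rw [norm_neg, norm_mul, norm_pow]
    refine mul_le_mul_of_nonneg_right ?_ (by positivity)
    have h1 : ‖y - x‖ < 1 := by simpa [dist_eq_norm] using hy
    have h2 := norm_add_le (y - x) x
    rw [sub_add_cancel] at h2
    linarith

theorem qPoch_mul_qPoch_neg (hQ : ‖Q‖ < 1) (x : ℂ) :
    qPoch Q x * qPoch Q (-x) = qPoch (Q ^ 2) (x ^ 2) := by
  rw [qPoch, qPoch, ← (multipliable_qPoch hQ x).tprod_mul (multipliable_qPoch hQ (-x))]
  refine tprod_congr fun i => ?_
  ring

theorem norm_sq_lt_one (hQ : ‖Q‖ < 1) : ‖Q ^ 2‖ < 1 := by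
  rw [norm_pow]; exact pow_lt_one₀ (norm_nonneg _) hQ two_ne_zero

theorem qPoch_sq_mul (hQ : ‖Q‖ < 1) (x : ℂ) :
    qPoch (Q ^ 2) x * qPoch (Q ^ 2) (x * Q) = qPoch Q x := by
  have h1 := multipliable_qPoch (norm_sq_lt_one hQ) x
  have h2 := multipliable_qPoch (norm_sq_lt_one hQ) (x * Q)
  rw [qPoch, qPoch, qPoch, ← tprod_even_mul_odd (f := fun i => 1 - x * Q ^ i)]
  · congr 1
    · exact tprod_congr fun i => by ring
    · exact tprod_congr fun i => by ring
  · exact h1.congr fun i => by ring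
  · exact h2.congr fun i => by ring

/-- `m (m - 1) / 2`. -/
def tri (m : ℤ) : ℤ := m * (m - 1) / 2

theorem tri_succ (m : ℤ) : tri (m + 1) = tri m + m := by
  rw [tri, tri, show (m + 1) * (m + 1 - 1) = m * (m - 1) + m * 2 by ring,
    Int.add_mul_ediv_right _ _ two_ne_zero]

theorem two_mul_tri (m : ℤ) : 2 * tri m = m * (m - 1) :=
  Int.mul_ediv_cancel' (Int.even_mul_pred_self m).two_dvd

/-- The coefficients `(-1) ^ m Q ^ (m (m - 1) / 2)` of the theta function. -/
noncomputable def thetaCoeff (Q : ℂ) (m : ℤ) : ℂ := (-1) ^ m * Q ^ tri m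

theorem thetaCoeff_succ (hQ0 : Q ≠ 0) (m : ℤ) :
    thetaCoeff Q (m + 1) = -(Q ^ m * thetaCoeff Q m) := by
  rw [thetaCoeff, thetaCoeff, tri_succ, zpow_add₀ hQ0, zpow_add₀ (by norm_num), zpow_one]
  ring

theorem thetaCoeff_zero : thetaCoeff Q 0 = 1 := by simp [thetaCoeff, tri]

theorem thetaCoeff_ne_zero (hQ0 : Q ≠ 0) (m : ℤ) : thetaCoeff Q m ≠ 0 :=
  mul_ne_zero (zpow_ne_zero _ (by norm_num)) (zpow_ne_zero _ hQ0)

theorem summable_norm_thetaCoeff (hQ0 : Q ≠ 0) (hQ : ‖Q‖ < 1) {x : ℂ} (hx : x ≠ 0) :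
    Summable fun m : ℤ => ‖thetaCoeff Q m * x ^ m‖ := by
  have hne : ∀ m : ℤ, ‖thetaCoeff Q m * x ^ m‖ ≠ 0 := fun m =>
    norm_ne_zero_iff.2 (mul_ne_zero (thetaCoeff_ne_zero hQ0 m) (zpow_ne_zero m hx))
  have hpow : Tendsto (fun n : ℕ => ‖Q‖ ^ n) atTop (𝓝 0) :=
    tendsto_pow_atTop_nhds_zero_of_lt_one (norm_nonneg _) hQ
  have hstep : ∀ m : ℤ, ‖thetaCoeff Q (m + 1) * x ^ (m + 1)‖ =
      ‖Q‖ ^ m * ‖x‖ * ‖thetaCoeff Q m * x ^ m‖ := fun m => by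
    rw [thetaCoeff_succ hQ0, zpow_add₀ hx, zpow_one]
    simp only [norm_mul, norm_neg, norm_zpow]
    ring
  refine Summable.of_nat_of_neg ?_ ?_
  · refine summable_of_ratio_test_tendsto_lt_one (l := 0) one_pos
      (Eventually.of_forall fun n => hne n) ?_
    have h := hpow.mul_const ‖x‖
    rw [zero_mul] at h
    refine h.congr fun n => ?_
    have e := hstep n
    rw [eq_comm, norm_norm, norm_norm, div_eq_iff (hne n)]
    push_cast
    rw [e, zpow_natCast]
  · refine summable_of_ratio_test_tendsto_lt_one (l := 0) one_pos
      (Eventually.of_forall fun n => hne _) ?_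
    have h := (hpow.comp (tendsto_add_atTop_nat 1)).mul_const ‖x‖⁻¹
    rw [zero_mul] at h
    refine h.congr fun n => ?_
    have e := hstep (-((n + 1 : ℕ) : ℤ))
    rw [show -((n + 1 : ℕ) : ℤ) + 1 = -(n : ℤ) by push_cast; ring, zpow_neg ‖Q‖, zpow_natCast ‖Q‖] at e
    have hQn : ‖Q‖ ≠ 0 := norm_ne_zero_iff.2 hQ0
    have hxn : ‖x‖ ≠ 0 := norm_ne_zero_iff.2 hx
    rw [eq_comm, norm_norm, norm_norm, e, Function.comp]
    have h1 := hne (-((n + 1 : ℕ) : ℤ))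
    rw [div_mul_eq_div_div_swap, div_self h1]
    field_simp

theorem summable_thetaCoeff (hQ0 : Q ≠ 0) (hQ : ‖Q‖ < 1) {x : ℂ} (hx : x ≠ 0) :
    Summable fun m : ℤ => thetaCoeff Q m * x ^ m :=
  (summable_norm_thetaCoeff hQ0 hQ hx).of_norm

/-- The theta function `∑ (-1) ^ m Q ^ (m (m - 1) / 2) x ^ m`. -/
noncomputable def thetaSum (Q x : ℂ) : ℂ := ∑' m : ℤ, thetaCoeff Q m * x ^ m

/-- The finite product `(Q; Q)_n`. -/
noncomputable def qFact (Q : ℂ) (n : ℕ) : ℂ := ∏ i ∈ Finset.range n, (1 - Q * Q ^ i)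

theorem qFact_ne_zero (hQ : ‖Q‖ < 1) (n : ℕ) : qFact Q n ≠ 0 :=
  Finset.prod_ne_zero_iff.2 fun i _ => one_sub_mul_pow_ne_zero hQ hQ i

theorem qFact_succ (n : ℕ) : qFact Q (n + 1) = qFact Q n * (1 - Q * Q ^ n) :=
  Finset.prod_range_succ _ _

/-- `1 / (Q; Q)_k`, extended by zero to negative `k`. -/
noncomputable def invQFact (Q : ℂ) (k : ℤ) : ℂ := if 0 ≤ k then (qFact Q k.toNat)⁻¹ else 0

theorem invQFact_sub_one (hQ : ‖Q‖ < 1) (k : ℤ) :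
    invQFact Q (k - 1) = (1 - Q ^ k) * invQFact Q k := by
  rcases lt_trichotomy k 0 with hk | rfl | hk
  · rw [invQFact, invQFact, if_neg (by omega), if_neg (by omega), mul_zero]
  · simp [invQFact]
  · obtain ⟨n, rfl⟩ : ∃ n : ℕ, k = n + 1 := ⟨(k - 1).toNat, by omega⟩
    rw [invQFact, invQFact, if_pos (by omega), if_pos (by omega), add_sub_cancel_right,
      Int.toNat_natCast, show ((n : ℤ) + 1).toNat = n + 1 by omega]
    have h1 := qFact_ne_zero hQ n
    have h2 := one_sub_mul_pow_ne_zero hQ hQ n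
    rw [qFact_succ, show Q ^ ((n : ℤ) + 1) = Q * Q ^ n by
      rw [← pow_succ']; exact zpow_natCast Q (n + 1)]
    field_simp

/-- The finite form of the triple product: the coefficients are the Gaussian binomials `[2n, n+m]`,
which vanish for `|m| > n` because `invQFact` is zero at negative arguments. -/
theorem hasSum_finite_triple (hQ0 : Q ≠ 0) (hQ : ‖Q‖ < 1) {x : ℂ} (hx : x ≠ 0) (n : ℕ) :
    HasSum (fun m : ℤ => thetaCoeff Q m * (qFact Q (2 * n) * invQFact Q (n + m) *
      invQFact Q (n - m)) * x ^ m)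
      (∏ i ∈ Finset.range n, ((1 - x * Q ^ i) * (1 - x⁻¹ * Q * Q ^ i))) := by
  induction n with
  | zero =>
    convert hasSum_single (0 : ℤ) fun m hm => ?_ using 1
    · simp [thetaCoeff_zero, qFact, invQFact]
    · rcases lt_or_gt_of_ne hm with h | h
      · simp [invQFact, not_le.2 h]
      · rw [show invQFact Q (((0 : ℕ) : ℤ) - m) = 0 from if_neg (by omega)]
        simp
  | succ n ih =>
    rw [Finset.prod_range_succ]
    have s1 := ((Equiv.subRight (1 : ℤ)).hasSum_iff.2 ih).mul_left x
    have s2 := ((Equiv.addRight (1 : ℤ)).hasSum_iff.2 ih).mul_left x⁻¹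
    -- The new factor `(1 - xQ^n)(1 - x⁻¹Q^{n+1})` expands to `1 + Q^{2n+1} - Q^n x - Q^{n+1} x⁻¹`;
    -- the last two terms shift the index by one.
    have key := ((ih.mul_left (1 + Q ^ (2 * n + 1))).sub (s1.mul_left (Q ^ n))).sub
      (s2.mul_left (Q ^ (n + 1)))
    have hval : ∀ P : ℂ, (1 + Q ^ (2 * n + 1)) * P - Q ^ n * (x * P) - Q ^ (n + 1) * (x⁻¹ * P) =
        P * ((1 - x * Q ^ n) * (1 - x⁻¹ * Q * Q ^ n)) := fun P => by
      field_simp; ring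
    rw [hval] at key
    refine key.congr_fun fun m => ?_
    · simp only [Function.comp, Equiv.subRight_apply, Equiv.coe_addRight]
      have r1 := invQFact_sub_one hQ (n + 1 + m)
      have r2 := invQFact_sub_one hQ (n + m)
      have r3 := invQFact_sub_one hQ (n + 1 - m)
      have r4 := invQFact_sub_one hQ (n - m)
      rw [show (n : ℤ) + 1 + m - 1 = n + m by ring] at r1
      rw [show (n : ℤ) + 1 - m - 1 = n - m by ring] at r3
      have t1 := thetaCoeff_succ hQ0 m
      have t2 := thetaCoeff_succ hQ0 (m - 1)
      rw [sub_add_cancel] at t2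
      have hQm := zpow_ne_zero m hQ0
      have t3 : thetaCoeff Q (m - 1) = -(thetaCoeff Q m * (Q * (Q ^ m)⁻¹)) := by
        rw [t2, zpow_sub₀ hQ0]; field_simp
      push_cast
      rw [show (n : ℤ) + (m - 1) = n + m - 1 by ring, show (n : ℤ) - (m - 1) = n + 1 - m by ring,
        show (n : ℤ) + (m + 1) = n + 1 + m by ring, show (n : ℤ) - (m + 1) = n - m - 1 by ring,
        r2, r4, r1, r3, t1, t3, zpow_sub₀ hx, zpow_add₀ hx, zpow_one]
      rw [show 2 * (n + 1) = 2 * n + 1 + 1 by ring, qFact_succ, qFact_succ]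
      rw [zpow_sub₀ hQ0, zpow_sub₀ hQ0, zpow_add₀ hQ0, zpow_add₀ hQ0, zpow_add₀ hQ0, zpow_one,
        zpow_natCast]
      field_simp
      ring

theorem tendsto_qFact (hQ : ‖Q‖ < 1) : Tendsto (qFact Q) atTop (𝓝 (qPoch Q Q)) :=
  tendsto_prod_qPoch hQ Q

theorem tendsto_invQFact (hQ : ‖Q‖ < 1) : Tendsto (invQFact Q) atTop (𝓝 (qPoch Q Q)⁻¹) := by
  have h := (tendsto_qFact hQ).inv₀ (qPoch_ne_zero_of_norm_lt hQ hQ)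
  have h2 : Tendsto Int.toNat atTop atTop :=
    tendsto_atTop.2 fun b => (eventually_ge_atTop (b : ℤ)).mono fun k hk => by omega
  refine (h.comp h2).congr' ?_
  filter_upwards [eventually_ge_atTop 0] with k hk
  simp [invQFact, hk]

theorem exists_norm_le_of_tendsto {f : ℕ → ℂ} {a : ℂ} (h : Tendsto f atTop (𝓝 a)) :
    ∃ B, ∀ n, ‖f n‖ ≤ B := by
  obtain ⟨B, hB⟩ := isBounded_iff_forall_norm_le.1 (Metric.isBounded_range_of_tendsto f h)
  exact ⟨B, fun n => hB _ ⟨n, rfl⟩⟩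

/-- The Jacobi triple product. -/
theorem thetaSum_eq (hQ0 : Q ≠ 0) (hQ : ‖Q‖ < 1) {x : ℂ} (hx : x ≠ 0) :
    thetaSum Q x = qPoch Q Q * (qPoch Q x * qPoch Q (x⁻¹ * Q)) := by
  have hE := qPoch_ne_zero_of_norm_lt hQ hQ
  obtain ⟨B, hB⟩ := exists_norm_le_of_tendsto (tendsto_qFact hQ)
  obtain ⟨B', hB'⟩ := exists_norm_le_of_tendsto ((tendsto_qFact hQ).inv₀ hE)
  have hB0 : 0 ≤ B := (norm_nonneg _).trans (hB 0)
  have hB0' : 0 ≤ B' := (norm_nonneg _).trans (hB' 0)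
  have hinv : ∀ k, ‖invQFact Q k‖ ≤ B' := fun k => by
    rw [invQFact]
    split_ifs
    · exact hB' _
    · simpa using hB0'
  have hnat : Tendsto (fun n : ℕ => (n : ℤ)) atTop atTop := tendsto_natCast_atTop_atTop
  -- Let `n → ∞` under the sum: the Gaussian binomials are bounded uniformly in `n` and `m` and tend
  -- to `1/(Q;Q)_∞`.
  have h1 : Tendsto (fun n : ℕ => ∑' m : ℤ, thetaCoeff Q m * (qFact Q (2 * n) *
      invQFact Q (n + m) * invQFact Q (n - m)) * x ^ m) atTop
      (𝓝 (∑' m : ℤ, thetaCoeff Q m * (qPoch Q Q * (qPoch Q Q)⁻¹ * (qPoch Q Q)⁻¹) * x ^ m)) := by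
    refine tendsto_tsum_of_dominated_convergence
      (bound := fun m => B * B' * B' * ‖thetaCoeff Q m * x ^ m‖)
      ((summable_norm_thetaCoeff hQ0 hQ hx).mul_left _) (fun m => ?_)
      (Eventually.of_forall fun n m => ?_)
    · refine Tendsto.mul_const _ (Tendsto.const_mul _ ((Tendsto.mul ?_ ?_).mul ?_))
      · exact (tendsto_qFact hQ).comp (tendsto_id.const_mul_atTop' two_pos)
      · exact (tendsto_invQFact hQ).comp (tendsto_atTop_add_const_right _ m hnat)
      · exact (tendsto_invQFact hQ).comp (tendsto_atTop_add_const_right _ (-m) hnat)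
    · rw [mul_right_comm, norm_mul, mul_comm, norm_mul, norm_mul]
      refine mul_le_mul_of_nonneg_right ?_ (norm_nonneg _)
      exact mul_le_mul (mul_le_mul (hB _) (hinv _) (norm_nonneg _) hB0) (hinv _) (norm_nonneg _)
        (by positivity)
  have h2 : Tendsto (fun n : ℕ => ∏ i ∈ Finset.range n,
      ((1 - x * Q ^ i) * (1 - x⁻¹ * Q * Q ^ i))) atTop
      (𝓝 (qPoch Q x * qPoch Q (x⁻¹ * Q))) := by
    simp_rw [Finset.prod_mul_distrib]
    exact (tendsto_prod_qPoch hQ x).mul (tendsto_prod_qPoch hQ (x⁻¹ * Q))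
  simp_rw [(hasSum_finite_triple hQ0 hQ hx _).tsum_eq] at h1
  rw [tendsto_nhds_unique h2 h1, thetaSum, ← tsum_mul_left]
  refine tsum_congr fun m => ?_
  field_simp

end TripleProduct

/-! ### The Kronecker sum as a theta quotient, up to a constant. -/

section Kronecker

variable {Q : ℂ}

theorem thetaSum_one (hQ0 : Q ≠ 0) (hQ : ‖Q‖ < 1) : thetaSum Q 1 = 0 := by
  rw [thetaSum_eq hQ0 hQ one_ne_zero, qPoch_eq_one_sub_mul hQ 1]
  ring

/-- The coefficients of the Kronecker (Appell–Lerch) sum. -/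
noncomputable def kronCoeff (Q y : ℂ) (j : ℤ) : ℂ := 1 / (1 - y * Q ^ j)

theorem tendsto_pow_zero (hQ : ‖Q‖ < 1) : Tendsto (fun n : ℕ => Q ^ n) atTop (𝓝 0) :=
  tendsto_pow_atTop_nhds_zero_of_norm_lt_one hQ

theorem tendsto_kronCoeff_natCast (hQ : ‖Q‖ < 1) (y : ℂ) :
    Tendsto (fun n : ℕ => kronCoeff Q y n) atTop (𝓝 1) := by
  have h : Tendsto (fun n : ℕ => 1 / (1 - y * Q ^ n)) atTop (𝓝 (1 / (1 - y * 0))) :=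
    Tendsto.div tendsto_const_nhds (((tendsto_pow_zero hQ).const_mul y).const_sub 1) (by simp)
  simpa [kronCoeff] using h

theorem kronCoeff_neg_natCast (hQ0 : Q ≠ 0) (y : ℂ) (n : ℕ) :
    kronCoeff Q y (-n) = Q ^ n * (1 / (Q ^ n - y)) := by
  have h := pow_ne_zero n hQ0
  rw [kronCoeff, zpow_neg, zpow_natCast]
  have : 1 - y * (Q ^ n)⁻¹ = (Q ^ n)⁻¹ * (Q ^ n - y) := by field_simp
  rw [this, one_div, mul_inv, inv_inv, one_div]

theorem exists_norm_kronCoeff_le (hQ0 : Q ≠ 0) (hQ : ‖Q‖ < 1) {y : ℂ} (hy : y ≠ 0) :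
    ∃ B, 0 ≤ B ∧ ∀ n : ℕ, ‖kronCoeff Q y n‖ ≤ B ∧ ‖kronCoeff Q y (-n)‖ ≤ B * ‖Q‖ ^ n := by
  obtain ⟨B1, h1⟩ := exists_norm_le_of_tendsto (tendsto_kronCoeff_natCast hQ y)
  have h : Tendsto (fun n : ℕ => 1 / (Q ^ n - y)) atTop (𝓝 (1 / (0 - y))) :=
    Tendsto.div tendsto_const_nhds ((tendsto_pow_zero hQ).sub_const y) (by simpa using hy)
  obtain ⟨B2, h2⟩ := exists_norm_le_of_tendsto h
  refine ⟨max B1 B2, ((norm_nonneg _).trans (h1 0)).trans (le_max_left _ _), fun n =>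
    ⟨(h1 n).trans (le_max_left _ _), ?_⟩⟩
  rw [kronCoeff_neg_natCast hQ0, norm_mul, norm_pow, mul_comm]
  exact mul_le_mul_of_nonneg_right ((h2 n).trans (le_max_right _ _)) (by positivity)

theorem norm_kronCoeff_le (hQ0 : Q ≠ 0) (hQ : ‖Q‖ < 1) {y : ℂ} (hy : y ≠ 0) :
    ∃ B, ∀ j : ℤ, ‖kronCoeff Q y j‖ ≤ B := by
  obtain ⟨B, hB, h⟩ := exists_norm_kronCoeff_le hQ0 hQ hy
  refine ⟨B, fun j => ?_⟩
  obtain ⟨n, rfl | rfl⟩ := j.eq_nat_or_neg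
  · exact (h n).1
  · exact (h n).2.trans (mul_le_of_le_one_right hB (pow_le_one₀ (norm_nonneg _) hQ.le))

theorem expDecay_kronCoeff (hQ0 : Q ≠ 0) {x y : ℂ} (hy : y ≠ 0) (hx1 : ‖x‖ < 1)
    (hxQ : ‖Q‖ < ‖x‖) : ExpDecay fun j => kronCoeff Q y j * x ^ j := by
  have hQ : ‖Q‖ < 1 := hxQ.trans hx1
  have hx0 : 0 < ‖x‖ := (norm_nonneg Q).trans_lt hxQ
  obtain ⟨B, hB, h⟩ := exists_norm_kronCoeff_le hQ0 hQ hy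
  have hr : 0 ≤ max ‖x‖ (‖Q‖ / ‖x‖) := (norm_nonneg x).trans (le_max_left _ _)
  refine ⟨B, max ‖x‖ (‖Q‖ / ‖x‖), hr, max_lt hx1 ((div_lt_one hx0).2 hxQ), fun j => ?_⟩
  obtain ⟨n, rfl | rfl⟩ := j.eq_nat_or_neg
  · rw [norm_mul, zpow_natCast, norm_pow, Int.natAbs_natCast]
    exact mul_le_mul (h n).1 (pow_le_pow_left₀ (norm_nonneg _) (le_max_left _ _) n)
      (by positivity) hB
  · rw [norm_mul, zpow_neg, zpow_natCast, norm_inv, norm_pow, Int.natAbs_neg, Int.natAbs_natCast]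
    calc _ ≤ B * ‖Q‖ ^ n * (‖x‖ ^ n)⁻¹ := mul_le_mul_of_nonneg_right (h n).2 (by positivity)
      _ = B * (‖Q‖ / ‖x‖) ^ n := by rw [div_pow]; ring
      _ ≤ _ := mul_le_mul_of_nonneg_left
        (pow_le_pow_left₀ (by positivity) (le_max_right _ _) n) hB

/-- The Kronecker sum `∑ x ^ j / (1 - y Q ^ j)`. -/
noncomputable def kronSum (Q x y : ℂ) : ℂ := ∑' j : ℤ, kronCoeff Q y j * x ^ j

/-- Let `G n` be the convolution and `k_j` the Kronecker coefficient. From `k_j = 1 + y Q^j k_j` and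
the recursion for `thetaCoeff` follows `G (n+1) = ∑ θ_j - y Q^n G n`. The sum of all theta
coefficients is `thetaSum Q 1 = 0`, so `G` obeys the same recursion as `thetaCoeff Q n * y ^ n`. -/
theorem kronCoeff_conv (hQ0 : Q ≠ 0) (hQ : ‖Q‖ < 1) {y : ℂ} (hy : y ≠ 0)
    (hyQ : ∀ j : ℤ, 1 - y * Q ^ j ≠ 0) (n : ℤ) :
    ∑' j, kronCoeff Q y j * thetaCoeff Q (n - j) =
      thetaCoeff Q n * y ^ n * ∑' j, kronCoeff Q y j * thetaCoeff Q (0 - j) := by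
  obtain ⟨B, hB⟩ := norm_kronCoeff_le hQ0 hQ hy
  have ht : ∀ n : ℤ, Summable fun j => ‖thetaCoeff Q (n - j)‖ := fun n => by
    have := (Equiv.subLeft n).summable_iff.2 (summable_norm_thetaCoeff hQ0 hQ one_ne_zero)
    simpa [Function.comp_def] using this
  have hs : ∀ n : ℤ, Summable fun j => kronCoeff Q y j * thetaCoeff Q (n - j) := fun n => by
    refine Summable.of_norm_bounded ((ht n).mul_left B) fun j => ?_
    rw [norm_mul]
    exact mul_le_mul_of_nonneg_right (hB j) (norm_nonneg _)
  have h0 : ∀ n : ℤ, ∑' j, thetaCoeff Q (n - j) = 0 := fun n => by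
    rw [← thetaSum_one hQ0 hQ, thetaSum, ← (Equiv.subLeft n).tsum_eq]
    simp
  set G : ℤ → ℂ := fun n => ∑' j, kronCoeff Q y j * thetaCoeff Q (n - j) with hG
  have step : ∀ n, G (n + 1) = -(y * Q ^ n * G n) := fun n => by
    have e : ∀ j, kronCoeff Q y j * thetaCoeff Q (n + 1 - j) =
        thetaCoeff Q (n + 1 - j) + -(y * Q ^ n) * (kronCoeff Q y j * thetaCoeff Q (n - j)) :=
      fun j => by
        rw [show n + 1 - j = n - j + 1 by ring, thetaCoeff_succ hQ0, kronCoeff, zpow_sub₀ hQ0]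
        have := hyQ j
        have := zpow_ne_zero j hQ0
        field_simp
        ring
    simp only [hG]
    rw [tsum_congr e, ((ht (n + 1)).of_norm).tsum_add ((hs n).mul_left _), h0, tsum_mul_left]
    ring
  change G n = thetaCoeff Q n * y ^ n * G 0
  induction n using Int.induction_on with
  | zero => simp [thetaCoeff_zero]
  | succ n ih =>
    rw [step, ih, thetaCoeff_succ hQ0, zpow_add₀ hy, zpow_one]
    ring
  | pred n ih =>
    have h1 := step (-(n : ℤ) - 1)
    rw [sub_add_cancel, ih] at h1
    have h2 := thetaCoeff_succ hQ0 (-(n : ℤ) - 1)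
    rw [sub_add_cancel] at h2
    have h3 : y ^ (-(n : ℤ)) = y ^ (-(n : ℤ) - 1) * y := by
      rw [zpow_sub₀ hy, zpow_one]; field_simp
    rw [h2, h3] at h1
    have h4 : y * Q ^ (-(n : ℤ) - 1) ≠ 0 := mul_ne_zero hy (zpow_ne_zero _ hQ0)
    apply mul_left_cancel₀ h4
    linear_combination h1

theorem kronSum_mul_thetaSum (hQ0 : Q ≠ 0) {x y : ℂ} (hy : y ≠ 0)
    (hyQ : ∀ j : ℤ, 1 - y * Q ^ j ≠ 0) (hx1 : ‖x‖ < 1) (hxQ : ‖Q‖ < ‖x‖) :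
    kronSum Q x y * thetaSum Q x =
      (∑' j, kronCoeff Q y j * thetaCoeff Q (0 - j)) * thetaSum Q (x * y) := by
  have hQ : ‖Q‖ < 1 := hxQ.trans hx1
  have hx0 : x ≠ 0 := norm_pos_iff.1 ((norm_nonneg Q).trans_lt hxQ)
  have h1 := (expDecay_kronCoeff hQ0 hy hx1 hxQ).summable_norm
  have h2 := summable_norm_thetaCoeff hQ0 hQ hx0
  have h3 : HasSum (fun z : ℤ × ℤ => (kronCoeff Q y z.1 * x ^ z.1) *
      (thetaCoeff Q z.2 * x ^ z.2)) (kronSum Q x y * thetaSum Q x) := by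
    rw [kronSum, thetaSum, tsum_mul_tsum_of_summable_norm h1 h2]
    exact (summable_mul_of_summable_norm h1 h2).hasSum
  rw [← (hasSum_conv_of_hasSum_prod h3).tsum_eq, thetaSum, ← tsum_mul_left]
  refine tsum_congr fun N => ?_
  have e : ∀ j, (kronCoeff Q y j * x ^ j) * (thetaCoeff Q (N - j) * x ^ (N - j)) =
      x ^ N * (kronCoeff Q y j * thetaCoeff Q (N - j)) := fun j => by
    rw [zpow_sub₀ hx0]
    have := zpow_ne_zero j hx0
    field_simp
  simp only
  rw [tsum_congr e, tsum_mul_left, kronCoeff_conv hQ0 hQ hy hyQ, mul_zpow]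
  ring

end Kronecker

/-! ### The constant in Kronecker's formula, from the limit `x → 1`. -/

section KroneckerLimit

variable {Q : ℂ}

theorem tendsto_kronCoeff_atTop (hQ : ‖Q‖ < 1) (y : ℂ) :
    Tendsto (kronCoeff Q y) atTop (𝓝 1) := by
  have h2 : Tendsto Int.toNat atTop atTop :=
    tendsto_atTop.2 fun b => (eventually_ge_atTop (b : ℤ)).mono fun k hk => by omega
  refine ((tendsto_kronCoeff_natCast hQ y).comp h2).congr' ?_
  filter_upwards [eventually_ge_atTop 0] with k hk
  rw [Function.comp, Int.toNat_of_nonneg hk]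

theorem tendsto_kronCoeff_atBot (hQ0 : Q ≠ 0) (hQ : ‖Q‖ < 1) {y : ℂ} (hy : y ≠ 0) :
    Tendsto (kronCoeff Q y) atBot (𝓝 0) := by
  obtain ⟨B, -, h⟩ := exists_norm_kronCoeff_le hQ0 hQ hy
  have h1 : Tendsto (fun n : ℕ => kronCoeff Q y (-n)) atTop (𝓝 0) := by
    refine squeeze_zero_norm (fun n => (h n).2) ?_
    simpa using (tendsto_pow_atTop_nhds_zero_of_lt_one (norm_nonneg Q) hQ).const_mul B
  have h2 : Tendsto (fun k : ℤ => (-k).toNat) atBot atTop :=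
    tendsto_atTop.2 fun b => (eventually_le_atBot (-(b : ℤ))).mono fun k hk => by omega
  refine (h1.comp h2).congr' ?_
  filter_upwards [eventually_le_atBot 0] with k hk
  rw [Function.comp, Int.toNat_of_nonneg (by omega), neg_neg]

/-- The coefficients tend to `1` at `+∞` and to `0` at `-∞`, so only their differences decay on both
sides. -/
theorem exists_norm_kronCoeff_sub_le (hQ0 : Q ≠ 0) (hQ : ‖Q‖ < 1) {y : ℂ} (hy : y ≠ 0)
    (hyQ : ∀ j : ℤ, 1 - y * Q ^ j ≠ 0) :
    ∃ B, 0 ≤ B ∧ ∀ j : ℤ, ‖kronCoeff Q y j - kronCoeff Q y (j - 1)‖ ≤ B * ‖Q‖ ^ j.natAbs := by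
  obtain ⟨B, hB0, h⟩ := exists_norm_kronCoeff_le hQ0 hQ hy
  obtain ⟨B', h'⟩ := norm_kronCoeff_le hQ0 hQ hy
  have hB' : 0 ≤ B' := (norm_nonneg _).trans (h' 0)
  set D := ‖y‖ * ‖Q - 1‖ * ‖Q‖⁻¹ with hD
  have hD0 : 0 ≤ D := by positivity
  refine ⟨2 * B + B' * B' * D, by positivity, fun j => ?_⟩
  obtain ⟨n, rfl | rfl⟩ := j.eq_nat_or_neg
  · have e : kronCoeff Q y n - kronCoeff Q y (n - 1) =
        kronCoeff Q y n * kronCoeff Q y (n - 1) * (y * (Q - 1) * Q⁻¹ * Q ^ n) := by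
      have h1 := hyQ n
      have h2 := hyQ (n - 1)
      rw [zpow_sub₀ hQ0, zpow_natCast, zpow_one] at h2
      rw [zpow_natCast] at h1
      have h3 : Q - y * Q ^ n ≠ 0 := by
        intro h3
        apply h2
        field_simp
        linear_combination h3
      rw [kronCoeff, kronCoeff, zpow_sub₀ hQ0, zpow_natCast, zpow_one]
      field_simp
      ring
    rw [e, norm_mul, norm_mul, Int.natAbs_natCast]
    have e2 : ‖y * (Q - 1) * Q⁻¹ * Q ^ n‖ = D * ‖Q‖ ^ n := by
      simp only [norm_mul, norm_inv, norm_pow, hD]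
    rw [e2, ← mul_assoc]
    refine mul_le_mul_of_nonneg_right ?_ (by positivity)
    calc _ ≤ B' * B' * D :=
          mul_le_mul_of_nonneg_right (mul_le_mul (h' _) (h' _) (norm_nonneg _) hB') hD0
      _ ≤ _ := by linarith
  · have h1 := (h n).2
    have h2 := (h (n + 1)).2
    rw [show -((n + 1 : ℕ) : ℤ) = -(n : ℤ) - 1 by push_cast; ring] at h2
    have h3 : B * ‖Q‖ ^ (n + 1) ≤ B * ‖Q‖ ^ n :=
      mul_le_mul_of_nonneg_left (pow_le_pow_of_le_one (norm_nonneg _) hQ.le n.le_succ) hB0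
    have h4 := norm_sub_le (kronCoeff Q y (-(n : ℤ))) (kronCoeff Q y (-(n : ℤ) - 1))
    have h5 : 0 ≤ B' * B' * D * ‖Q‖ ^ n := by positivity
    rw [Int.natAbs_neg, Int.natAbs_natCast]
    linarith

/-- Summation by parts: `(1-t) ∑ k_j t^j = ∑ (k_j - k_{j-1}) t^j`, which tends to the telescoping
sum `1 - 0`. -/
theorem tendsto_one_sub_mul_kronSum (hQ0 : Q ≠ 0) (hQ : ‖Q‖ < 1) {y : ℂ} (hy : y ≠ 0)
    (hyQ : ∀ j : ℤ, 1 - y * Q ^ j ≠ 0) :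
    Tendsto (fun t : ℝ => (1 - (t : ℂ)) * kronSum Q t y) (𝓝[<] 1) (𝓝 1) := by
  obtain ⟨B, hB0, hB⟩ := exists_norm_kronCoeff_sub_le hQ0 hQ hy hyQ
  have hQpos : 0 < ‖Q‖ := norm_pos_iff.2 hQ0
  -- For `t` in `(s, 1)` the factor `t^{-n}` at index `-n` costs at most `s^{-n}` against `‖Q‖^n =
  -- s^{2n}`, so `B * s^|j|` dominates on both sides.
  set s := √‖Q‖ with hs
  have hs0 : 0 < s := Real.sqrt_pos.2 hQpos
  have hs2 : s * s = ‖Q‖ := Real.mul_self_sqrt hQpos.le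
  have hs1 : s < 1 := by rw [hs, Real.sqrt_lt' one_pos]; simpa using hQ
  have hQs : ‖Q‖ < s := by nlinarith
  have hd : Summable fun j : ℤ => B * s ^ j.natAbs := by
    refine Summable.mul_left _ (Summable.of_nat_of_neg ?_ ?_)
    · simpa using summable_geometric_of_lt_one hs0.le hs1
    · simpa using summable_geometric_of_lt_one hs0.le hs1
  have hsum : HasSum (fun j : ℤ => kronCoeff Q y j - kronCoeff Q y (j - 1)) 1 := by
    have h := hasSum_int_telescope (H := fun j => kronCoeff Q y (j - 1)) (L := 1) (M := 0) ?_
      ((tendsto_kronCoeff_atTop hQ y).comp (tendsto_atTop_add_const_right _ (-1) tendsto_id))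
      ((tendsto_kronCoeff_atBot hQ0 hQ hy).comp (tendsto_atBot_add_const_right _ (-1) tendsto_id))
    · simpa using h
    · refine Summable.of_norm_bounded hd fun j => ?_
      rw [add_sub_cancel_right]
      exact (hB j).trans (mul_le_mul_of_nonneg_left (pow_le_pow_left₀ hQpos.le hQs.le _) hB0)
  have hlim : Tendsto (fun t : ℝ => ∑' j : ℤ, (t : ℂ) ^ j *
      (kronCoeff Q y j - kronCoeff Q y (j - 1))) (𝓝[<] 1) (𝓝 1) := by
    have h : Tendsto (fun t : ℝ => ∑' j : ℤ, (t : ℂ) ^ j *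
        (kronCoeff Q y j - kronCoeff Q y (j - 1))) (𝓝[<] 1)
        (𝓝 (∑' j : ℤ, (1 : ℂ) ^ j * (kronCoeff Q y j - kronCoeff Q y (j - 1)))) := by
      refine tendsto_tsum_of_dominated_convergence hd (fun j => ?_) ?_
      · refine Tendsto.mul_const _ ?_
        have h1 : ContinuousAt (fun t : ℝ => (t : ℂ) ^ j) 1 :=
          (Complex.continuous_ofReal.continuousAt).zpow₀ j (Or.inl (by simp))
        have h2 := h1.tendsto.mono_left (nhdsWithin_le_nhds (s := Set.Iio 1))
        simpa using h2
      · filter_upwards [Ioo_mem_nhdsLT hs1] with t ht j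
        have ht0 : 0 < t := hs0.trans ht.1
        rw [norm_mul, norm_zpow, Complex.norm_real, Real.norm_of_nonneg ht0.le]
        refine (mul_le_mul_of_nonneg_left (hB j) (zpow_nonneg ht0.le _)).trans ?_
        obtain ⟨n, rfl | rfl⟩ := j.eq_nat_or_neg
        · rw [zpow_natCast, Int.natAbs_natCast]
          have h1 : t ^ n ≤ 1 := pow_le_one₀ ht0.le ht.2.le
          have h2 : ‖Q‖ ^ n ≤ s ^ n := pow_le_pow_left₀ hQpos.le hQs.le _
          calc t ^ n * (B * ‖Q‖ ^ n) ≤ 1 * (B * s ^ n) :=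
                mul_le_mul h1 (mul_le_mul_of_nonneg_left h2 hB0) (by positivity) zero_le_one
            _ = _ := one_mul _
        · rw [zpow_neg, zpow_natCast, Int.natAbs_neg, Int.natAbs_natCast, ← hs2, mul_pow]
          have h1 : (t ^ n)⁻¹ ≤ (s ^ n)⁻¹ :=
            inv_anti₀ (by positivity) (pow_le_pow_left₀ hs0.le ht.1.le n)
          calc (t ^ n)⁻¹ * (B * (s ^ n * s ^ n)) ≤ (s ^ n)⁻¹ * (B * (s ^ n * s ^ n)) :=
                mul_le_mul_of_nonneg_right h1 (by positivity)
            _ = B * s ^ n := by field_simp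
    simp_rw [one_zpow, one_mul] at h
    rwa [hsum.tsum_eq] at h
  refine hlim.congr' ?_
  filter_upwards [Ioo_mem_nhdsLT hs1] with t ht
  have ht0 : 0 < t := hs0.trans ht.1
  have htn : ‖(t : ℂ)‖ = t := by rw [Complex.norm_real, Real.norm_of_nonneg ht0.le]
  have htc : (t : ℂ) ≠ 0 := by exact_mod_cast ht0.ne'
  have hK : Summable fun j : ℤ => kronCoeff Q y j * (t : ℂ) ^ j :=
    (expDecay_kronCoeff hQ0 hy (by rw [htn]; exact ht.2)
      (by rw [htn]; exact hQs.trans ht.1)).summable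
  have h1 := hK.hasSum
  have h2 := ((Equiv.subRight (1 : ℤ)).hasSum_iff.2 h1).mul_left (t : ℂ)
  rw [← kronSum] at h1 h2
  rw [sub_mul, one_mul]
  refine ((h1.sub h2).congr_fun fun j => ?_).tsum_eq
  simp only [Function.comp, Equiv.subRight_apply]
  rw [zpow_sub₀ htc, zpow_one]
  field_simp

theorem thetaSum_eq_one_sub_mul (hQ0 : Q ≠ 0) (hQ : ‖Q‖ < 1) {x : ℂ} (hx : x ≠ 0) :
    thetaSum Q x = (1 - x) * (qPoch Q Q * (qPoch Q (x * Q) * qPoch Q (x⁻¹ * Q))) := by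
  rw [thetaSum_eq hQ0 hQ hx, qPoch_eq_one_sub_mul hQ x]
  ring

/-- Kronecker's product formula for the sum `∑ x ^ j / (1 - y Q ^ j)`. -/
theorem kronSum_mul_thetaSum_mul_thetaSum (hQ0 : Q ≠ 0) {x y : ℂ} (hy : y ≠ 0)
    (hyQ : ∀ j : ℤ, 1 - y * Q ^ j ≠ 0) (hx1 : ‖x‖ < 1) (hxQ : ‖Q‖ < ‖x‖) :
    kronSum Q x y * (thetaSum Q x * thetaSum Q y) = qPoch Q Q ^ 3 * thetaSum Q (x * y) := by
  have hQ : ‖Q‖ < 1 := hxQ.trans hx1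
  have hcont := continuous_qPoch hQ
  -- The unknown constant `G` does not depend on `x`. As `x → 1` the simple zero of `thetaSum`
  -- cancels the pole of `kronSum`, and comparing limits gives `(Q;Q)_∞³ = G * thetaSum Q y`.
  set G := ∑' j, kronCoeff Q y j * thetaCoeff Q (0 - j) with hG
  have hofReal : Tendsto (fun t : ℝ => (t : ℂ)) (𝓝[<] 1) (𝓝 1) := by
    have := (Complex.continuous_ofReal.tendsto 1).mono_left (nhdsWithin_le_nhds (s := Set.Iio 1))
    simpa using this
  have hinv : Tendsto (fun t : ℝ => (t : ℂ)⁻¹) (𝓝[<] 1) (𝓝 1) := by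
    simpa using hofReal.inv₀ one_ne_zero
  have hev : ∀ᶠ t : ℝ in 𝓝[<] 1, ‖(t : ℂ)‖ < 1 ∧ ‖Q‖ < ‖(t : ℂ)‖ := by
    filter_upwards [Ioo_mem_nhdsLT hQ] with t ht
    rw [Complex.norm_real, Real.norm_of_nonneg ((norm_nonneg Q).trans ht.1.le)]
    exact ⟨ht.2, ht.1⟩
  have hl : Tendsto (fun t : ℝ => kronSum Q t y * thetaSum Q t) (𝓝[<] 1)
      (𝓝 (1 * (qPoch Q Q * (qPoch Q (1 * Q) * qPoch Q (1 * Q))))) := by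
    have h := (tendsto_one_sub_mul_kronSum hQ0 hQ hy hyQ).mul
      (((hcont.tendsto _).comp (hofReal.mul_const Q)).mul
        ((hcont.tendsto _).comp (hinv.mul_const Q)) |>.const_mul (qPoch Q Q))
    refine h.congr' ?_
    filter_upwards [hev] with t ht
    have ht0 : (t : ℂ) ≠ 0 := norm_pos_iff.1 ((norm_nonneg Q).trans_lt ht.2)
    rw [thetaSum_eq_one_sub_mul hQ0 hQ ht0]
    simp only [Function.comp]
    ring
  have hr : Tendsto (fun t : ℝ => kronSum Q t y * thetaSum Q t) (𝓝[<] 1)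
      (𝓝 (G * (qPoch Q Q * (qPoch Q (1 * y) * qPoch Q (1 * y⁻¹ * Q))))) := by
    have h := (((hcont.tendsto _).comp (hofReal.mul_const y)).mul
        ((hcont.tendsto _).comp ((hinv.mul_const y⁻¹).mul_const Q)) |>.const_mul
          (qPoch Q Q)).const_mul G
    refine h.congr' ?_
    filter_upwards [hev] with t ht
    have ht0 : (t : ℂ) ≠ 0 := norm_pos_iff.1 ((norm_nonneg Q).trans_lt ht.2)
    rw [kronSum_mul_thetaSum hQ0 hy hyQ ht.1 ht.2, thetaSum_eq hQ0 hQ (mul_ne_zero ht0 hy), mul_inv]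
    rfl
  have hE := tendsto_nhds_unique hl hr
  rw [one_mul, one_mul, one_mul, one_mul, ← thetaSum_eq hQ0 hQ hy] at hE
  rw [← mul_assoc, kronSum_mul_thetaSum hQ0 hy hyQ hx1 hxQ]
  linear_combination (-thetaSum Q (x * y)) * hE

end KroneckerLimit

/-! ### Product formulas for the zeroth moments. -/

section NullValues

variable {p : ℂ}

theorem norm_pow_lt_one (hp1 : ‖p‖ < 1) {n : ℕ} (hn : n ≠ 0) : ‖p ^ n‖ < 1 := by
  rw [norm_pow]; exact pow_lt_one₀ (norm_nonneg _) hp1 hn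

theorem one_sub_neg_one_mul_zpow_ne_zero (hp0 : p ≠ 0) (hp1 : ‖p‖ < 1) (n : ℤ) :
    1 + p ^ n * p ^ n ≠ 0 := by
  have h := zpow_add_zpow_neg_ne_zero hp0 hp1 n
  have h2 := zpow_ne_zero n hp0
  rw [zpow_neg] at h
  intro h3
  apply h
  field_simp
  linear_combination h3

theorem one_sub_zpow_ne_zero (hp0 : p ≠ 0) (hp1 : ‖p‖ < 1) {n : ℤ} (hn : n ≠ 0) :
    1 - p ^ n * p ^ n ≠ 0 := by
  have h := zpow_neg_sub_zpow_ne_zero hp0 hp1 hn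
  have h2 := zpow_ne_zero n hp0
  rw [zpow_neg] at h
  intro h3
  apply h
  field_simp
  linear_combination h3

theorem sechCoeff_eq (hp0 : p ≠ 0) (n : ℤ) :
    sechCoeff p n = p ^ n * (1 / (1 + p ^ n * p ^ n)) := by
  have h := zpow_ne_zero n hp0
  rw [sechCoeff, zpow_neg, show p ^ n + (p ^ n)⁻¹ = (p ^ n)⁻¹ * (1 + p ^ n * p ^ n) by
    field_simp; ring, one_div, mul_inv, inv_inv, one_div]

theorem cschCoeff_eq (hp0 : p ≠ 0) (n : ℤ) :
    cschCoeff p n = p ^ n * (1 / (1 - p ^ n * p ^ n)) := by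
  have h := zpow_ne_zero n hp0
  rw [cschCoeff, zpow_neg, show (p ^ n)⁻¹ - p ^ n = (p ^ n)⁻¹ * (1 - p ^ n * p ^ n) by
    field_simp, one_div, mul_inv, inv_inv, one_div]

theorem moment_parity (ω : ℂ) (r : ℤ) (f : ℤ → ℂ) (m : ℕ) :
    moment ω (parity r f) m =
      ∑' j : ℤ, ω ^ (2 * j + r) * (((2 * j + r : ℤ) : ℂ) ^ m * f (2 * j + r)) := by
  have hinj : Function.Injective fun j : ℤ => 2 * j + r := fun a b h => by simpa using h
  have hpar : ∀ j : ℤ, Even (2 * j + r + r) := fun j => ⟨j + r, by ring⟩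
  rw [moment, ← hinj.tsum_eq]
  · refine tsum_congr fun j => ?_
    rw [parity, if_pos (hpar j)]
  · intro n hn
    by_cases h : Even (n + r)
    · obtain ⟨k, hk⟩ := h
      exact ⟨k - r, by simp only; omega⟩
    · simp [parity, h] at hn

theorem zpow_two_mul (a : ℂ) (j : ℤ) : a ^ (2 * j) = (a ^ 2) ^ j := by
  rw [zpow_mul]; norm_cast

theorem zpow_two_mul_add_one {a : ℂ} (ha : a ≠ 0) (j : ℤ) : a ^ (2 * j + 1) = a * (a ^ 2) ^ j := by
  rw [zpow_add₀ ha, zpow_two_mul, zpow_one, mul_comm]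

variable (hp0 : p ≠ 0) (hp1 : ‖p‖ < 1)

include hp0

/-- With `q = p²` and `Q = q²`, the coefficient at `n = 2j` is `q^j/(1 + Q^j)`. The next three
lemmas treat odd `n` and the twist `i`, where `i^{2j}` replaces `q` by `-q`. -/
theorem moment_one_even_sech : moment 1 (parity 0 (sechCoeff p)) 0 =
    kronSum ((p ^ 2) ^ 2) (p ^ 2) (-1) := by
  rw [moment_parity, kronSum]
  refine tsum_congr fun j => ?_
  rw [add_zero, one_zpow, sechCoeff_eq hp0, kronCoeff, zpow_two_mul, ← mul_zpow, ← sq]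
  simp
  ring

theorem moment_I_even_sech : moment Complex.I (parity 0 (sechCoeff p)) 0 =
    kronSum ((p ^ 2) ^ 2) (-(p ^ 2)) (-1) := by
  rw [moment_parity, kronSum]
  refine tsum_congr fun j => ?_
  rw [add_zero, sechCoeff_eq hp0, kronCoeff, zpow_two_mul, zpow_two_mul, ← mul_zpow, ← sq,
    Complex.I_sq, neg_eq_neg_one_mul (p ^ 2), mul_zpow]
  simp
  ring

theorem moment_one_odd_sech : moment 1 (parity 1 (sechCoeff p)) 0 =
    p * kronSum ((p ^ 2) ^ 2) (p ^ 2) (-(p ^ 2)) := by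
  rw [moment_parity, kronSum, ← tsum_mul_left]
  refine tsum_congr fun j => ?_
  rw [sechCoeff_eq hp0, kronCoeff, zpow_two_mul_add_one hp0, ← zpow_natCast (p ^ 2) 2, ← zpow_mul,
    show ((2 : ℕ) : ℤ) * j = j + j by push_cast; ring, zpow_add₀ (pow_ne_zero 2 hp0)]
  simp
  ring

theorem moment_I_odd_csch : moment Complex.I (parity 1 (cschCoeff p)) 0 =
    Complex.I * p * kronSum ((p ^ 2) ^ 2) (-(p ^ 2)) (p ^ 2) := by
  rw [moment_parity, kronSum, ← tsum_mul_left]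
  refine tsum_congr fun j => ?_
  rw [cschCoeff_eq hp0, kronCoeff, zpow_two_mul_add_one hp0, zpow_two_mul_add_one Complex.I_ne_zero,
    ← zpow_natCast (p ^ 2) 2, ← zpow_mul,
    show ((2 : ℕ) : ℤ) * j = j + j by push_cast; ring, zpow_add₀ (pow_ne_zero 2 hp0),
    Complex.I_sq, neg_eq_neg_one_mul (p ^ 2), mul_zpow]
  simp
  ring

include hp1

/-- The values at the origin of the Lambert series of `cn`, `dn` and their quarter-period shifts,
as products. Here `a = (q; q²)_∞`, `b = (-q; q²)_∞`, `c = (-q²; q²)_∞`, `e = (q²; q²)_∞`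
with `q = p²`. -/
theorem moment_values : ∃ a b c e : ℂ, a * b * c = 1 ∧ e ≠ 0 ∧
    qPoch (p ^ 2) (p ^ 2) = a * e ∧ qPoch ((p ^ 2) ^ 2) ((p ^ 2) ^ 2) = e ∧
    qPoch (((p ^ 2) ^ 2) ^ 2) (((p ^ 2) ^ 2) ^ 2) = e * c ∧
    thetaSum ((p ^ 2) ^ 2) (-(p ^ 2)) = e * b ^ 2 ∧
    moment 1 (parity 0 (sechCoeff p)) 0 = e ^ 2 * b ^ 4 / 2 ∧
    moment Complex.I (parity 0 (sechCoeff p)) 0 = e ^ 2 * a ^ 4 / 2 ∧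
    moment 1 (parity 1 (sechCoeff p)) 0 = 2 * p * e ^ 2 * c ^ 4 ∧
    moment Complex.I (parity 1 (cschCoeff p)) 0 = Complex.I * (2 * p * e ^ 2 * c ^ 4) := by
  set q := p ^ 2 with hq
  have hq0 : q ≠ 0 := pow_ne_zero 2 hp0
  have hq1 : ‖q‖ < 1 := norm_pow_lt_one hp1 two_ne_zero
  set Q := q ^ 2 with hQ
  have hQ0 : Q ≠ 0 := pow_ne_zero 2 hq0
  have hQ1 : ‖Q‖ < 1 := norm_pow_lt_one hq1 two_ne_zero
  set a := qPoch Q q with ha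
  set b := qPoch Q (-q) with hb
  set c := qPoch Q (-Q) with hc
  set e := qPoch Q Q with he
  set e4 := qPoch (Q ^ 2) (Q ^ 2) with he4
  have he0 : e ≠ 0 := qPoch_ne_zero_of_norm_lt hQ1 hQ1
  have he40 : e4 ≠ 0 := qPoch_ne_zero_of_norm_lt (norm_pow_lt_one hQ1 two_ne_zero)
    (norm_pow_lt_one hQ1 two_ne_zero)
  have r1 : a * e = qPoch q q := by
    have := qPoch_sq_mul hq1 q
    rwa [← sq] at this
  have r2 : a * b * e4 = e := by
    rw [ha, hb, qPoch_mul_qPoch_neg hQ1, he, ← qPoch_sq_mul hQ1 Q, ← sq]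
  have r3 : e * c = e4 := qPoch_mul_qPoch_neg hQ1 Q
  -- Euler's identity `(q;q²)_∞ (-q;q²)_∞ (-q²;q²)_∞ = 1`.
  have habc : a * b * c = 1 := by
    apply mul_left_cancel₀ he0
    linear_combination r2 + a * b * r3
  have ha0 : a ≠ 0 := by rintro h; simp [h] at habc
  have hb0 : b ≠ 0 := by rintro h; simp [h] at habc
  have hc0 : c ≠ 0 := by rintro h; simp [h] at habc
  have r4 : qPoch Q (-1) = 2 * c := by
    rw [qPoch_eq_one_sub_mul hQ1, neg_one_mul, hc]; ring
  have t1 : thetaSum Q q = e * a ^ 2 := by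
    rw [thetaSum_eq hQ0 hQ1 hq0, show q⁻¹ * Q = q by rw [hQ]; field_simp, ← sq]
  have t2 : thetaSum Q (-q) = e * b ^ 2 := by
    rw [thetaSum_eq hQ0 hQ1 (neg_ne_zero.2 hq0), show (-q)⁻¹ * Q = -q by
      rw [hQ, inv_neg]; field_simp, ← sq]
  have t3 : thetaSum Q (-1) = 2 * e * c ^ 2 := by
    rw [thetaSum_eq hQ0 hQ1 (by norm_num), show (-1 : ℂ)⁻¹ * Q = -Q by norm_num, r4]
    ring
  have t4 : thetaSum Q (-Q) = 2 * e * c ^ 2 := by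
    rw [thetaSum_eq hQ0 hQ1 (neg_ne_zero.2 hQ0), show (-Q)⁻¹ * Q = -1 by
      rw [inv_neg, neg_mul, inv_mul_cancel₀ hQ0], r4]
    ring
  have hQq : ‖Q‖ < ‖q‖ := by
    rw [hQ, norm_pow]
    nlinarith [norm_pos_iff.2 hq0]
  have hn : ‖-q‖ = ‖q‖ := norm_neg q
  have y1 : ∀ j : ℤ, 1 - -1 * Q ^ j ≠ 0 := fun j => by
    have := one_sub_neg_one_mul_zpow_ne_zero hp0 hp1 (2 * j)
    rw [zpow_two_mul, ← mul_zpow, ← sq] at this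
    simpa using this
  have eqQ : ∀ j : ℤ, p ^ (2 * j + 1) * p ^ (2 * j + 1) = q * Q ^ j := fun j => by
    rw [zpow_two_mul_add_one hp0, ← hq, hQ, sq q, mul_zpow, hq]; ring
  have y2 : ∀ j : ℤ, 1 - -q * Q ^ j ≠ 0 := fun j => by
    have := one_sub_neg_one_mul_zpow_ne_zero hp0 hp1 (2 * j + 1)
    rw [eqQ] at this
    simpa using this
  have y3 : ∀ j : ℤ, 1 - q * Q ^ j ≠ 0 := fun j => by
    have := one_sub_zpow_ne_zero hp0 hp1 (n := 2 * j + 1) (by omega)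
    rwa [eqQ] at this
  -- Kronecker's formula at `(x, y) = (q, -1), (-q, -1), (q, -q), (-q, q)`.
  have k1 := kronSum_mul_thetaSum_mul_thetaSum hQ0 (by norm_num) y1 hq1 hQq
  have k2 := kronSum_mul_thetaSum_mul_thetaSum hQ0 (by norm_num) y1 (hn ▸ hq1) (hn.symm ▸ hQq)
  have k3 := kronSum_mul_thetaSum_mul_thetaSum hQ0 (neg_ne_zero.2 hq0) y2 hq1 hQq
  have k4 := kronSum_mul_thetaSum_mul_thetaSum hQ0 hq0 y3 (hn ▸ hq1) (hn.symm ▸ hQq)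
  rw [mul_neg_one, t1, t2, t3] at k1
  rw [neg_mul_neg, mul_one, t1, t2, t3] at k2
  rw [mul_neg, ← sq, ← hQ, t1, t2, t4] at k3
  rw [neg_mul, ← sq, ← hQ, t1, t2, t4] at k4
  refine ⟨a, b, c, e, habc, he0, r1.symm, rfl, r3.symm, t2, ?_, ?_, ?_, ?_⟩
  · rw [moment_one_even_sech hp0, ← hq, ← hQ]
    apply mul_right_cancel₀ (b := e * a ^ 2 * (2 * e * c ^ 2))
      (mul_ne_zero (mul_ne_zero he0 (pow_ne_zero 2 ha0)) (mul_ne_zero (mul_ne_zero two_ne_zero he0) (pow_ne_zero 2 hc0)))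
    rw [k1]
    linear_combination (-(e ^ 4 * b ^ 2)) * (a * b * c + 1) * habc
  · rw [moment_I_even_sech hp0, ← hq, ← hQ]
    apply mul_right_cancel₀ (b := e * b ^ 2 * (2 * e * c ^ 2))
      (mul_ne_zero (mul_ne_zero he0 (pow_ne_zero 2 hb0)) (mul_ne_zero (mul_ne_zero two_ne_zero he0) (pow_ne_zero 2 hc0)))
    rw [k2]
    linear_combination (-(e ^ 4 * a ^ 2)) * (a * b * c + 1) * habc
  · rw [moment_one_odd_sech hp0, ← hq, ← hQ]
    apply mul_right_cancel₀ (b := e * a ^ 2 * (e * b ^ 2))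
      (mul_ne_zero (mul_ne_zero he0 (pow_ne_zero 2 ha0)) (mul_ne_zero he0 (pow_ne_zero 2 hb0)))
    rw [mul_assoc p, k3]
    linear_combination (-(2 * p * e ^ 4 * c ^ 2)) * (a * b * c + 1) * habc
  · rw [moment_I_odd_csch hp0, ← hq, ← hQ]
    apply mul_right_cancel₀ (b := e * b ^ 2 * (e * a ^ 2))
      (mul_ne_zero (mul_ne_zero he0 (pow_ne_zero 2 hb0)) (mul_ne_zero he0 (pow_ne_zero 2 ha0)))
    rw [mul_assoc (Complex.I * p), k4]
    linear_combination (-(2 * Complex.I * p * e ^ 4 * c ^ 2)) * (a * b * c + 1) * habc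

end NullValues

/-! ### Folding the moments onto positive indices: the Eisenstein series. -/

section LambertMoments

variable {p : ℂ}

theorem tsum_int_eq_of_reflect {f : ℤ → ℂ} {ε : ℂ} (hf : Summable f)
    (h : ∀ n : ℕ, f (-((n : ℤ) + 1)) = ε * f n) : ∑' j, f j = (1 + ε) * ∑' n : ℕ, f n := by
  have h1 : Summable fun n : ℕ => f n := hf.comp_injective Nat.cast_injective
  have h2 : HasSum (fun n : ℕ => f (-((n : ℤ) + 1))) (ε * ∑' n : ℕ, f n) := by
    simp_rw [h]
    exact h1.hasSum.mul_left ε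
  rw [(h1.hasSum.of_nat_of_neg_add_one h2).tsum_eq]
  ring

theorem summable_moment_parity {ω : ℂ} (hω : ‖ω‖ = 1) (r : ℤ)
    {f : ℤ → ℂ} (hf : ExpDecay f) (m : ℕ) :
    Summable fun j : ℤ => ω ^ (2 * j + r) * (((2 * j + r : ℤ) : ℂ) ^ m * f (2 * j + r)) := by
  have hinj : Function.Injective fun j : ℤ => 2 * j + r := fun a b h => by simpa using h
  exact (hf.summable_norm_moment hω m).of_norm.comp_injective hinj

theorem reflect_index (n : ℕ) : 2 * -((n : ℤ) + 1) + 1 = -(2 * n + 1) := by ring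

/-- The reflection `n ↦ -n` of odd integers is `j ↦ -(j+1)` for `n = 2j+1`. The moment either
doubles or vanishes according to the combined sign. -/
theorem moment_odd_reflect {ω ε δ : ℂ} (hω : ‖ω‖ = 1) {f : ℤ → ℂ}
    (hf : ExpDecay f) (m : ℕ) (hε : ∀ n, f (-n) = ε * f n)
    (hδ : ∀ n : ℤ, ω ^ (-(2 * n + 1)) = δ * ω ^ (2 * n + 1)) :
    moment ω (parity 1 f) m = (1 + δ * (-1) ^ m * ε) *
      ∑' n : ℕ, ω ^ (2 * (n : ℤ) + 1) * (((2 * n + 1 : ℕ) : ℂ) ^ m * f ((2 * n + 1 : ℕ) : ℤ)) := by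
  rw [moment_parity, tsum_int_eq_of_reflect (ε := δ * (-1) ^ m * ε)
    (summable_moment_parity hω 1 hf m)]
  · congr 1
  · intro n
    rw [reflect_index, hε, hδ, Int.cast_neg, neg_pow ((2 * (n : ℤ) + 1 : ℤ) : ℂ)]
    ring

theorem one_zpow_reflect (n : ℤ) : (1 : ℂ) ^ (-(2 * n + 1)) = 1 * 1 ^ (2 * n + 1) := by simp

/-- This extra sign interchanges the parities of `m` for which the moments survive; hence `Eis_k`
with even `k` is found at `ω = i`. -/
theorem I_zpow_reflect (n : ℤ) :
    Complex.I ^ (-(2 * n + 1)) = -1 * Complex.I ^ (2 * n + 1) := by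
  rw [zpow_neg, zpow_two_mul_add_one Complex.I_ne_zero, Complex.I_sq, mul_inv, Complex.inv_I,
    ← inv_zpow]
  norm_num

theorem sechCoeff_reflect (n : ℤ) : sechCoeff p (-n) = 1 * sechCoeff p n := by
  rw [sechCoeff_neg, one_mul]

theorem cschCoeff_reflect (n : ℤ) : cschCoeff p (-n) = -1 * cschCoeff p n := by
  rw [cschCoeff_neg, neg_one_mul]

theorem sechCoeff_odd (hp0 : p ≠ 0) (n : ℕ) : sechCoeff p ((2 * n + 1 : ℕ) : ℤ) =
    p * ((p ^ 2) ^ n / (1 + (p ^ 2) ^ (2 * n + 1))) := by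
  rw [sechCoeff_natCast hp0, ← pow_mul, ← pow_mul, pow_succ' p (2 * n), mul_div_assoc]

variable (hp0 : p ≠ 0) (hp1 : ‖p‖ < 1)

include hp0 hp1

theorem moment_one_odd_csch_zero : moment 1 (parity 1 (cschCoeff p)) 0 = 0 := by
  rw [moment_odd_reflect (by simp) (expDecay_cschCoeff hp0 hp1) 0 cschCoeff_reflect
    one_zpow_reflect]
  simp

theorem moment_I_odd_sech_zero : moment Complex.I (parity 1 (sechCoeff p)) 0 = 0 := by
  rw [moment_odd_reflect (by simp) (expDecay_sechCoeff hp0 hp1) 0 sechCoeff_reflect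
    I_zpow_reflect]
  simp

theorem moment_one_odd_sech_even {m : ℕ} (hm : Even m) :
    moment 1 (parity 1 (sechCoeff p)) m = 2 * (p * ∑' n : ℕ, ((2 * n + 1 : ℕ) : ℂ) ^ m *
      ((-1) ^ m * p ^ 2) ^ n / (1 + (p ^ 2) ^ (2 * n + 1))) := by
  rw [moment_odd_reflect (by simp) (expDecay_sechCoeff hp0 hp1) m sechCoeff_reflect
    one_zpow_reflect, hm.neg_one_pow]
  have e : ∀ n : ℕ, (1 : ℂ) ^ (2 * (n : ℤ) + 1) * (((2 * n + 1 : ℕ) : ℂ) ^ m *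
      sechCoeff p ((2 * n + 1 : ℕ) : ℤ)) = p * (((2 * n + 1 : ℕ) : ℂ) ^ m * (1 * p ^ 2) ^ n /
        (1 + (p ^ 2) ^ (2 * n + 1))) := fun n => by
    rw [sechCoeff_odd hp0, one_zpow, one_mul, one_mul]
    ring
  rw [tsum_congr e, tsum_mul_left]
  ring

theorem moment_I_odd_sech_odd {m : ℕ} (hm : Odd m) :
    moment Complex.I (parity 1 (sechCoeff p)) m = 2 * Complex.I *
      (p * ∑' n : ℕ, ((2 * n + 1 : ℕ) : ℂ) ^ m *
      ((-1) ^ m * p ^ 2) ^ n / (1 + (p ^ 2) ^ (2 * n + 1))) := by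
  rw [moment_odd_reflect (by simp) (expDecay_sechCoeff hp0 hp1) m sechCoeff_reflect
    I_zpow_reflect, hm.neg_one_pow]
  have e : ∀ n : ℕ, Complex.I ^ (2 * (n : ℤ) + 1) * (((2 * n + 1 : ℕ) : ℂ) ^ m *
      sechCoeff p ((2 * n + 1 : ℕ) : ℤ)) = Complex.I * p * (((2 * n + 1 : ℕ) : ℂ) ^ m *
        (-1 * p ^ 2) ^ n / (1 + (p ^ 2) ^ (2 * n + 1))) := fun n => by
    rw [sechCoeff_odd hp0, zpow_two_mul_add_one Complex.I_ne_zero, Complex.I_sq, zpow_natCast,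
      mul_pow]
    ring
  rw [tsum_congr e, tsum_mul_left]
  ring

/-- `m ≠ 0` removes the term `n = 0`. For `m = 0` a constant `1/2` would remain, which is why `k =
1` is excluded for the second Eisenstein family. -/
theorem moment_I_even_sech_even {m : ℕ} (hm : Even m) (hm0 : m ≠ 0) :
    moment Complex.I (parity 0 (sechCoeff p)) m = 2 * 2 ^ m *
      ∑' n : ℕ, ((n + 1 : ℕ) : ℂ) ^ m * (-p ^ 2) ^ (n + 1) / (1 + (p ^ 2) ^ (2 * (n + 1))) := by
  rw [moment_parity]
  set f : ℤ → ℂ := fun j => Complex.I ^ (2 * j + 0) *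
    (((2 * j + 0 : ℤ) : ℂ) ^ m * sechCoeff p (2 * j + 0)) with hf
  have hs : Summable f := summable_moment_parity (by simp) 0 (expDecay_sechCoeff hp0 hp1) m
  have e1 : ∀ n : ℕ, f ((n : ℤ) + 1) = 2 ^ m * (((n + 1 : ℕ) : ℂ) ^ m * (-p ^ 2) ^ (n + 1) /
      (1 + (p ^ 2) ^ (2 * (n + 1)))) := fun n => by
    simp only [hf]
    rw [show 2 * ((n : ℤ) + 1) + 0 = 2 * ((n + 1 : ℕ) : ℤ) by push_cast; ring, zpow_two_mul,
      Complex.I_sq, zpow_natCast,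
      show 2 * ((n + 1 : ℕ) : ℤ) = ((2 * (n + 1) : ℕ) : ℤ) by push_cast; ring,
      sechCoeff_natCast hp0, neg_pow (p ^ 2), Int.cast_natCast, ← pow_mul, ← pow_mul, Nat.cast_mul,
      mul_pow, Nat.cast_two]
    ring
  have e2 : ∀ j : ℤ, f (-j) = f j := fun j => by
    simp only [hf]
    rw [show 2 * -j + 0 = -(2 * j + 0) by ring, sechCoeff_neg, Int.cast_neg, hm.neg_pow, add_zero,
      zpow_neg, zpow_two_mul, Complex.I_sq, ← inv_zpow]
    norm_num
  have hinj : Function.Injective fun n : ℕ => (n : ℤ) + 1 := fun a b h => by simpa using h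
  have h1 : HasSum (fun n : ℕ => f ((n : ℤ) + 1)) (∑' n : ℕ, f ((n : ℤ) + 1)) :=
    (hs.comp_injective hinj).hasSum
  have h2 : HasSum (fun n : ℕ => f (-((n : ℤ) + 1))) (∑' n : ℕ, f ((n : ℤ) + 1)) := by
    simp_rw [e2]
    exact h1
  have h0 : f 0 = 0 := by simp [hf, hm0]
  rw [(HasSum.of_add_one_of_neg_add_one h1 h2).tsum_eq, h0]
  rw [tsum_congr e1, tsum_mul_left]
  ring

end LambertMoments

/-! ### Eta quotients, theta, and closed forms of the Eisenstein series. -/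

section ModularFunctions

open Complex in
/-- `q ^ (1 / 2)`. -/
noncomputable def halfNome (τ : UpperHalfPlane) : ℂ := exp (Real.pi * I * τ)

theorem halfNome_sq (τ : UpperHalfPlane) : halfNome τ ^ 2 = nome τ := by
  rw [halfNome, nome, ← Complex.exp_nat_mul]
  congr 1
  push_cast
  ring

theorem halfNome_ne_zero (τ : UpperHalfPlane) : halfNome τ ≠ 0 := Complex.exp_ne_zero _

theorem norm_halfNome_lt_one (τ : UpperHalfPlane) : ‖halfNome τ‖ < 1 := by
  rw [halfNome, Complex.norm_exp, Real.exp_lt_one_iff]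
  have : (Real.pi * Complex.I * (τ : ℂ)).re = -(Real.pi * τ.im) := by
    simp [Complex.mul_re, Complex.mul_im]
  rw [this]
  have := mul_pos Real.pi_pos τ.im_pos
  linarith

theorem etaScaled_eq (m : ℕ) (τ : UpperHalfPlane) : etaScaled m τ =
    Complex.exp (2 * Real.pi * Complex.I * τ / 24) ^ m * qPoch (nome τ ^ m) (nome τ ^ m) := by
  rw [etaScaled, ModularForm.eta, Function.Periodic.qParam, ← Complex.exp_nat_mul, qPoch]
  congr 1
  · congr 1
    push_cast
    ring
  · refine tprod_congr fun n => ?_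
    rw [ModularForm.eta_q_eq_pow, nome, ← pow_succ', ← Complex.exp_nat_mul _ m]
    congr 3
    ring

theorem thetaCoeff_sq_mul {q : ℂ} (hq0 : q ≠ 0) (m : ℤ) :
    thetaCoeff (q ^ 2) m * (-q) ^ m = q ^ (m * m) := by
  rw [thetaCoeff, neg_eq_neg_one_mul q, mul_zpow, ← zpow_two_mul, two_mul_tri]
  have h1 : ((-1 : ℂ) ^ m) * (-1) ^ m = 1 := by rw [← mul_zpow]; norm_num
  have h2 : q ^ (m * (m - 1)) * q ^ m = q ^ (m * m) := by
    rw [← zpow_add₀ hq0]; congr 1; ring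
  linear_combination h2 + (q ^ (m * (m - 1)) * q ^ m) * h1

theorem theta_eq (τ : UpperHalfPlane) : theta τ = thetaSum (nome τ ^ 2) (-nome τ) := by
  have hq : nome τ = halfNome τ ^ 2 := (halfNome_sq τ).symm
  have hq0 : nome τ ≠ 0 := hq ▸ pow_ne_zero 2 (halfNome_ne_zero τ)
  have hq1 : ‖nome τ‖ < 1 := hq ▸ norm_pow_lt_one (norm_halfNome_lt_one τ) two_ne_zero
  have hs := summable_thetaCoeff (pow_ne_zero 2 hq0) (norm_pow_lt_one hq1 two_ne_zero)
    (neg_ne_zero.2 hq0)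
  rw [theta, thetaSum]
  simp_rw [thetaCoeff_sq_mul hq0] at hs ⊢
  have hinj : Function.Injective fun n : ℕ => (n : ℤ) + 1 := fun a b h => by simpa using h
  have h1 : HasSum (fun n : ℕ => nome τ ^ (((n : ℤ) + 1) * ((n : ℤ) + 1)))
      (∑' n : ℕ, nome τ ^ (((n : ℤ) + 1) * ((n : ℤ) + 1))) := (hs.comp_injective hinj).hasSum
  have h2 : HasSum (fun n : ℕ => nome τ ^ (-((n : ℤ) + 1) * -((n : ℤ) + 1)))
      (∑' n : ℕ, nome τ ^ (((n : ℤ) + 1) * ((n : ℤ) + 1))) := by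
    simp_rw [neg_mul_neg]
    exact h1
  rw [(HasSum.of_add_one_of_neg_add_one (f := fun m : ℤ => nome τ ^ (m * m)) h1 h2).tsum_eq]
  have e : ∀ n : ℕ, nome τ ^ (((n : ℤ) + 1) * ((n : ℤ) + 1)) = nome τ ^ ((n + 1) ^ 2) := fun n => by
    rw [← zpow_natCast]; congr 1; push_cast; ring
  simp only [e, mul_zero, zpow_zero]
  ring

/-- The values at the origin, in terms of `F`, `z` and `z̃`. -/
theorem moment_values_eq (τ : UpperHalfPlane) :
    F τ ≠ 0 ∧ z τ ≠ 0 ∧ zTilde τ ≠ 0 ∧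
    moment 1 (parity 0 (sechCoeff (halfNome τ))) 0 = F τ / 2 ∧
    moment Complex.I (parity 0 (sechCoeff (halfNome τ))) 0 = F τ * zTilde τ / 2 ∧
    moment 1 (parity 1 (sechCoeff (halfNome τ))) 0 = F τ * z τ / 2 ∧
    moment Complex.I (parity 1 (cschCoeff (halfNome τ))) 0 = Complex.I * (F τ * z τ / 2) := by
  obtain ⟨a, b, c, e, habc, he, h1, h2, h4, hθ, hY, hW, hX, hV⟩ :=
    moment_values (halfNome_ne_zero τ) (norm_halfNome_lt_one τ)
  have hp0 := halfNome_ne_zero τ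
  have ha : a ≠ 0 := by rintro rfl; simp at habc
  have hb : b ≠ 0 := by rintro rfl; simp at habc
  have hc : c ≠ 0 := by rintro rfl; simp at habc
  rw [halfNome_sq] at h1 h2 h4 hθ
  rw [← theta_eq] at hθ
  rw [← pow_mul, show 2 * 2 = 4 from rfl] at h4
  set w := Complex.exp (2 * Real.pi * Complex.I * τ / 24) with hw
  have hw0 : w ≠ 0 := Complex.exp_ne_zero _
  -- Here `w = q^{1/24}`. Its exponents add up to `4 + 32 - 24 = 12` in `z` and to `8 + 16 - 24 = 0`
  -- in `zTilde`.
  have hwp : w ^ 12 = halfNome τ := by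
    rw [hw, halfNome, ← Complex.exp_nat_mul]
    congr 1
    push_cast
    ring
  have hF : F τ = e ^ 2 * b ^ 4 := by rw [F, hθ]; ring
  have hz : z τ = 4 * halfNome τ * a ^ 4 * c ^ 8 := by
    rw [z, etaScaled_eq, etaScaled_eq, etaScaled_eq, pow_one (nome τ), h1, h2, h4, ← hwp, ← hw]
    field_simp
  have hzt : zTilde τ = a ^ 8 * c ^ 4 := by
    rw [zTilde, etaScaled_eq, etaScaled_eq, etaScaled_eq, pow_one (nome τ), h1, h2, h4, ← hw]
    field_simp
  have k4 : a ^ 4 * b ^ 4 * c ^ 4 = 1 := by rw [← mul_pow, ← mul_pow, habc, one_pow]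
  refine ⟨?_, ?_, ?_, ?_, ?_, ?_, ?_⟩
  · rw [hF]; exact mul_ne_zero (pow_ne_zero _ he) (pow_ne_zero _ hb)
  · rw [hz]
    exact mul_ne_zero (mul_ne_zero (mul_ne_zero (by norm_num) hp0) (pow_ne_zero _ ha))
      (pow_ne_zero _ hc)
  · rw [hzt]; exact mul_ne_zero (pow_ne_zero _ ha) (pow_ne_zero _ hc)
  · rw [hY, hF]
  · rw [hW, hF, hzt]
    linear_combination (-(e ^ 2 * a ^ 4 / 2)) * k4
  · rw [hX, hF, hz]
    linear_combination (-(2 * halfNome τ * e ^ 2 * c ^ 4)) * k4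
  · rw [hV, hF, hz]
    linear_combination (-(Complex.I * (2 * halfNome τ * e ^ 2 * c ^ 4))) * k4

/-- The twist-independent `D² - C²` is `F²(1 - z²)/4` at `ω = 1` and `F² z̃²/4` at `ω = i`, where
`C` vanishes. -/
theorem zTilde_sq (τ : UpperHalfPlane) : zTilde τ ^ 2 = 1 - z τ ^ 2 := by
  obtain ⟨hF, -, -, hY, hW, hX, -⟩ := moment_values_eq τ
  have h := moment_sq_sub_sq (halfNome_ne_zero τ) (norm_halfNome_lt_one τ) Complex.norm_I
  rw [moment_I_odd_sech_zero (halfNome_ne_zero τ) (norm_halfNome_lt_one τ), hY, hW, hX] at h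
  apply mul_left_cancel₀ (pow_ne_zero 2 hF)
  linear_combination 4 * h

theorem binomConv_comm {R : Type*} [CommRing R] (f g : ℕ → R) (n : ℕ) :
    binomConv f g n = binomConv g f n := by
  rw [binomConv, binomConv, ← Finset.Nat.sum_antidiagonal_swap]
  refine Finset.sum_congr rfl fun ij hij => ?_
  have h := Finset.HasAntidiagonal.mem_antidiagonal.1 hij
  rw [Prod.fst_swap, Prod.snd_swap, mul_comm (f ij.2), Nat.choose_symm_of_eq_add (show n = ij.2 + ij.1 by omega)]

/-- At `ω = 1` the triple starts at `(0, Fz/2, F/2)`; rescaling time by `F` leaves the constants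
`(1, 1, z²)`. -/
theorem Eis_of_odd {k : ℕ} (hk : Odd k) (τ : UpperHalfPlane) :
    Eis k τ = 1 / 4 * F τ ^ k * z τ * eulerC 1 1 (z τ ^ 2) (k - 1) := by
  obtain ⟨m, rfl⟩ := hk
  have hp0 := halfNome_ne_zero τ
  have hp1 := norm_halfNome_lt_one τ
  obtain ⟨hF, -, -, hY, hW, hX, -⟩ := moment_values_eq τ
  have key := ((isEulerTriple_moment hp0 hp1 (ω := 1) (by simp)).eq_scale (α := 1) (β := 1)
    (γ := z τ ^ 2) (σ := F τ * z τ / 2) (l := F τ) (moment_one_odd_csch_zero hp0 hp1) hX hY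
    (by ring) (by ring) (by ring) (2 * m)).2.1
  rw [moment_one_odd_sech_even hp0 hp1 (even_two_mul m), halfNome_sq] at key
  rw [Eis, ← halfNome, Nat.add_sub_cancel, pow_succ]
  linear_combination key / 2

/-- At `ω = i` it is the odd `sech` series that vanishes at the origin, so it takes the role of `S`.
The constant `-z²` comes from `i² = -1` in the initial values and `1 - z²` from `zTilde_sq`. -/
theorem isEulerTriple_moment_I (τ : UpperHalfPlane) (n : ℕ) :
    moment Complex.I (parity 1 (sechCoeff (halfNome τ))) n =
      zTilde τ * (Complex.I * (F τ * z τ / 2)) * F τ ^ n * eulerS 1 (-z τ ^ 2) (1 - z τ ^ 2) n ∧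
    moment Complex.I (parity 0 (sechCoeff (halfNome τ))) n =
      F τ * zTilde τ / 2 * F τ ^ n * eulerC 1 (-z τ ^ 2) (1 - z τ ^ 2) n := by
  have hp0 := halfNome_ne_zero τ
  have hp1 := norm_halfNome_lt_one τ
  obtain ⟨hF, -, -, hY, hW, hX, hV⟩ := moment_values_eq τ
  have h := isEulerTriple_moment hp0 hp1 (ω := Complex.I) (by simp)
  have h' : IsEulerTriple 2 2 2 (moment Complex.I (parity 1 (sechCoeff (halfNome τ))))
      (moment Complex.I (parity 0 (sechCoeff (halfNome τ))))
      (moment Complex.I (parity 1 (cschCoeff (halfNome τ)))) :=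
    ⟨fun n => by rw [h.snd, binomConv_comm], fun n => by rw [h.trd, binomConv_comm], h.fst⟩
  have key := h'.eq_scale (α := 1) (β := -z τ ^ 2) (γ := 1 - z τ ^ 2)
    (σ := zTilde τ * (Complex.I * (F τ * z τ / 2))) (l := F τ) (moment_I_odd_sech_zero hp0 hp1)
    hW hV (by ring)
    (by linear_combination (zTilde τ * F τ ^ 2 * z τ ^ 2 / 2) * Complex.I_sq)
    (by linear_combination (Complex.I * F τ ^ 2 * z τ / 2) * zTilde_sq τ) n
  exact ⟨key.1, key.2.1⟩

theorem Eis_of_even {k : ℕ} (hk1 : 1 ≤ k) (hk : Even k) (τ : UpperHalfPlane) :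
    Eis k τ = 1 / 4 * F τ ^ k * z τ * zTilde τ * eulerS 1 (-z τ ^ 2) (1 - z τ ^ 2) (k - 1) := by
  obtain ⟨n, rfl⟩ : ∃ n, k = n + 1 := ⟨k - 1, by omega⟩
  have hn : Odd n := by
    rw [← Nat.not_even_iff_odd]
    exact Nat.even_add_one.1 hk
  have key := (isEulerTriple_moment_I τ n).1
  rw [moment_I_odd_sech_odd (halfNome_ne_zero τ) (norm_halfNome_lt_one τ) hn, halfNome_sq] at key
  rw [Eis, ← halfNome, Nat.add_sub_cancel, pow_succ]
  apply mul_left_cancel₀ Complex.I_ne_zero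
  linear_combination key / 2

/-- The moments run over even integers `2n`, so `(2n)^{k-1}` produces the factor that `(1/2)^{k-1}`
undoes; this is the argument `t/2` in the generating function. -/
theorem EisTilde_of_odd {k : ℕ} (hk1 : 1 < k) (hk : Odd k) (τ : UpperHalfPlane) :
    EisTilde k τ = 1 / 4 * F τ ^ k * zTilde τ *
      ((1 / 2) ^ (k - 1) * eulerC 1 (-z τ ^ 2) (1 - z τ ^ 2) (k - 1)) := by
  obtain ⟨n, rfl⟩ : ∃ n, k = n + 1 := ⟨k - 1, by omega⟩
  have hn : Even n := by
    rw [← Nat.not_odd_iff_even]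
    exact Nat.odd_add_one.1 hk
  have key := (isEulerTriple_moment_I τ n).2
  rw [moment_I_even_sech_even (halfNome_ne_zero τ) (norm_halfNome_lt_one τ) hn (by omega),
    halfNome_sq] at key
  have h2 : ((1 / 2 : ℂ)) ^ n * 2 ^ n = 1 := by rw [← mul_pow]; norm_num
  rw [EisTilde, Nat.add_sub_cancel, pow_succ]
  linear_combination (1 / 2 * (1 / 2) ^ n) * key - (∑' m : ℕ, ((m + 1 : ℕ) : ℂ) ^ n *
    (-nome τ) ^ (m + 1) / (1 + nome τ ^ (2 * (m + 1)))) * h2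

theorem tendsto_qPoch_self : Tendsto (fun Q : ℂ => qPoch Q Q) (𝓝 0) (𝓝 1) := by
  have h := ModularForm.differentiableOn_tprod_one_sub_pow.differentiableAt
    (Metric.isOpen_ball.mem_nhds (Metric.mem_ball_self one_pos))
  have h2 := h.continuousAt.tendsto
  simpa [qPoch, pow_succ'] using h2

/-- Along `τ = (n+1)i` the values tend to `0`. A finite set is closed, so `0` would be a value, but
`z` has no zero. -/
theorem infinite_range_z_sq : (Set.range fun τ : UpperHalfPlane => z τ ^ 2).Infinite := by
  intro hfin
  let t : ℕ → UpperHalfPlane := fun n => ⟨((n : ℂ) + 1) * Complex.I, by simp; positivity⟩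
  have hp : Tendsto (fun n => halfNome (t n)) atTop (𝓝 0) := by
    rw [tendsto_zero_iff_norm_tendsto_zero]
    have h1 : Tendsto (fun n : ℕ => Real.pi * ((n : ℝ) + 1)) atTop atTop :=
      (tendsto_atTop_add_const_right _ 1 tendsto_natCast_atTop_atTop).const_mul_atTop Real.pi_pos
    refine (Real.tendsto_exp_neg_atTop_nhds_zero.comp h1).congr fun n => ?_
    rw [halfNome, Complex.norm_exp, Function.comp]
    congr 1
    simp [t, Complex.mul_re, Complex.mul_im]
  have hE : ∀ m : ℕ, m ≠ 0 → Tendsto (fun n => qPoch (nome (t n) ^ m) (nome (t n) ^ m)) atTop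
      (𝓝 1) := fun m hm => by
    refine tendsto_qPoch_self.comp ?_
    simp_rw [← halfNome_sq, ← pow_mul]
    simpa [hm] using hp.pow (2 * m)
  have hz : ∀ τ : UpperHalfPlane, z τ = 4 * halfNome τ * qPoch (nome τ ^ 1) (nome τ ^ 1) ^ 4 *
      qPoch (nome τ ^ 4) (nome τ ^ 4) ^ 8 / qPoch (nome τ ^ 2) (nome τ ^ 2) ^ 12 := fun τ => by
    set w := Complex.exp (2 * Real.pi * Complex.I * τ / 24) with hw
    have hw0 : w ≠ 0 := Complex.exp_ne_zero _
    have hwp : w ^ 12 = halfNome τ := by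
      rw [hw, halfNome, ← Complex.exp_nat_mul]
      congr 1
      push_cast
      ring
    rw [z, etaScaled_eq, etaScaled_eq, etaScaled_eq, ← hw, ← hwp]
    simp only [mul_pow, ← pow_mul]
    rw [show w ^ (2 * 12) = w ^ (1 * 4) * w ^ (4 * 8) / w ^ 12 by field_simp; ring]
    field_simp
  have hlim : Tendsto (fun n => z (t n) ^ 2) atTop (𝓝 0) := by
    simp_rw [hz]
    have := (((((hp.const_mul 4).mul ((hE 1 one_ne_zero).pow 4)).mul
      ((hE 4 four_ne_zero).pow 8)).div ((hE 2 two_ne_zero).pow 12) (by simp))).pow 2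
    simpa using this
  obtain ⟨τ, hτ⟩ := hfin.isClosed.mem_of_tendsto hlim (Eventually.of_forall fun n => ⟨t n, rfl⟩)
  exact (moment_values_eq τ).2.1 (pow_eq_zero_iff two_ne_zero |>.1 hτ)

end ModularFunctions

/-! ### The polynomials: existence, uniqueness and integrality. -/

section LabelPolynomials

open Polynomial

/-- The polynomials `μ_k`. -/
noncomputable def muPoly (k : ℕ) : ℂ[X] :=
  if Even k then eulerS 1 (-X) (1 - X) (k - 1) else eulerC 1 1 X (k - 1)

/-- The polynomials `ν_k`. -/
noncomputable def nuPoly (k : ℕ) : ℂ[X] :=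
  C (1 / 2) ^ (k - 1) * eulerC 1 (-X) (1 - X) (k - 1)

theorem eval_muPoly_even {k : ℕ} (hk : Even k) (x : ℂ) :
    (muPoly k).eval x = eulerS 1 (-x) (1 - x) (k - 1) := by
  rw [muPoly, if_pos hk]
  have h := (map_euler (evalRingHom x) 1 (-X) (1 - X) (k - 1)).1
  simpa only [coe_evalRingHom, eval_one, eval_neg, eval_X, eval_sub] using h

theorem eval_muPoly_odd {k : ℕ} (hk : Odd k) (x : ℂ) :
    (muPoly k).eval x = eulerC 1 1 x (k - 1) := by
  rw [muPoly, if_neg (Nat.not_even_iff_odd.2 hk)]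
  simpa using (map_euler (evalRingHom x) 1 1 X (k - 1)).2.1

theorem eval_nuPoly (k : ℕ) (x : ℂ) :
    (nuPoly k).eval x = (1 / 2) ^ (k - 1) * eulerC 1 (-x) (1 - x) (k - 1) := by
  have h := (map_euler (evalRingHom x) 1 (-X) (1 - X) (k - 1)).2.1
  simp only [coe_evalRingHom, eval_one, eval_neg, eval_X, eval_sub] at h
  rw [nuPoly, eval_mul, h, eval_pow, eval_C]

theorem labelRelations_muPoly_nuPoly : LabelRelations muPoly nuPoly where
  eis_even k hk1 hk τ := by rw [eval_muPoly_even hk, Eis_of_even hk1 hk]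
  eis_odd k hk τ := by rw [eval_muPoly_odd hk, Eis_of_odd hk]
  eisTilde_odd k hk1 hk τ := by rw [eval_nuPoly, EisTilde_of_odd hk1 hk]
  nu_one := by simp [nuPoly]

/-- The prefactors `F`, `z`, `z̃` never vanish, so the relations fix each polynomial at all values
of `z²`. For `ν 1` the normalization is used instead. -/
theorem LabelRelations.eq {μ ν : ℕ → ℂ[X]} (h : LabelRelations μ ν) :
    (∀ k, 1 ≤ k → μ k = muPoly k) ∧ ∀ k, Odd k → ν k = nuPoly k := by
  have h' := labelRelations_muPoly_nuPoly
  have main : ∀ f g : ℂ[X], (∀ τ, f.eval (z τ ^ 2) = g.eval (z τ ^ 2)) → f = g := fun f g hfg =>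
    eq_of_infinite_eval_eq f g (infinite_range_z_sq.mono (by rintro _ ⟨τ, rfl⟩; exact hfg τ))
  refine ⟨fun k hk => main _ _ fun τ => ?_, fun k hk => ?_⟩
  · obtain ⟨hF, hz, hzt, -⟩ := moment_values_eq τ
    have h4 : (1 / 4 : ℂ) ≠ 0 := by norm_num
    rcases Nat.even_or_odd k with he | ho
    · refine mul_left_cancel₀ ?_ ((h.eis_even k hk he τ).symm.trans (h'.eis_even k hk he τ))
      exact mul_ne_zero (mul_ne_zero (mul_ne_zero h4 (pow_ne_zero k hF)) hz) hzt
    · refine mul_left_cancel₀ ?_ ((h.eis_odd k ho τ).symm.trans (h'.eis_odd k ho τ))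
      exact mul_ne_zero (mul_ne_zero h4 (pow_ne_zero k hF)) hz
  · rcases eq_or_ne k 1 with rfl | hk1
    · rw [h.nu_one, h'.nu_one]
    · have hk1' : 1 < k := by have := hk.pos; omega
      refine main _ _ fun τ => ?_
      obtain ⟨hF, hz, hzt, -⟩ := moment_values_eq τ
      have h4 : (1 / 4 : ℂ) ≠ 0 := by norm_num
      refine mul_left_cancel₀ ?_
        ((h.eisTilde_odd k hk1' hk τ).symm.trans (h'.eisTilde_odd k hk1' hk τ))
      exact mul_ne_zero (mul_ne_zero h4 (pow_ne_zero k hF)) hzt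

theorem muPoly_mem (k : ℕ) : muPoly k ∈ Algebra.adjoin ℤ {(X : ℂ[X])} := by
  set A := (Algebra.adjoin ℤ {(X : ℂ[X])}).toSubring
  have hX : X ∈ A := Algebra.subset_adjoin (Set.mem_singleton _)
  change muPoly k ∈ A
  rw [muPoly]
  split_ifs
  · exact (euler_mem A A.one_mem (A.neg_mem hX) (A.sub_mem A.one_mem hX) _).1
  · exact (euler_mem A A.one_mem A.one_mem hX _).2.1

theorem nuPoly_mem (k : ℕ) : nuPoly k ∈ Algebra.adjoin ℤ {C (1 / 4 : ℂ) * X} := by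
  refine half_pow_mul_eulerC_mem (Algebra.adjoin ℤ {C (1 / 4 : ℂ) * X}).toSubring
    (y := C (1 / 4 : ℂ) * X) ?_ ?_ (Algebra.subset_adjoin (Set.mem_singleton _)) _
  · rw [← C_ofNat, ← C_mul]; norm_num
  · rw [← mul_assoc, ← C_ofNat, ← C_mul]; norm_num

end LabelPolynomials

end LabelGF

theorem mainTheorem7 :
    (∃ μ ν : ℕ → Polynomial ℂ, LabelGF.LabelRelations μ ν) ∧
    ∀ μ ν : ℕ → Polynomial ℂ, LabelGF.LabelRelations μ ν →
      (∀ k, 1 ≤ k → μ k ∈ Algebra.adjoin ℤ {(Polynomial.X : Polynomial ℂ)}) ∧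
      (∀ k, Odd k → ν k ∈ Algebra.adjoin ℤ {Polynomial.C (1 / 4 : ℂ) * Polynomial.X}) ∧
      ∀ x κ κ' : ℂ, κ ^ 2 = x → κ' ^ 2 = 1 - x →
        (∀ᶠ t in nhds (0 : ℂ),
          HasSum (fun j : ℕ =>
              (μ (2 * j + 2)).eval x / ((2 * j + 1).factorial : ℂ) * t ^ (2 * j + 1))
            (LabelGF.sd t κ') ∧
          -Complex.I * LabelGF.sd (Complex.I * t) κ = LabelGF.sd t κ') ∧
        (∀ᶠ t in nhds (0 : ℂ),
          HasSum (fun j : ℕ => (μ (2 * j + 1)).eval x / ((2 * j).factorial : ℂ) * t ^ (2 * j))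
            (LabelGF.nc t κ') ∧
          LabelGF.cn (Complex.I * t) κ = LabelGF.nc t κ') ∧
        (∀ᶠ t in nhds (0 : ℂ),
          HasSum (fun j : ℕ => (ν (2 * j + 1)).eval x / ((2 * j).factorial : ℂ) * t ^ (2 * j))
            (LabelGF.cd (t / 2) κ') ∧
          LabelGF.nd (Complex.I * t / 2) κ = LabelGF.cd (t / 2) κ') := by
  refine ⟨⟨_, _, LabelGF.labelRelations_muPoly_nuPoly⟩, fun μ ν h => ?_⟩
  obtain ⟨hμ, hν⟩ := h.eq
  refine ⟨fun k hk => hμ k hk ▸ LabelGF.muPoly_mem k, fun k hk => hν k hk ▸ LabelGF.nuPoly_mem k,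
    fun x κ κ' hκ hκ' => ?_⟩
  have hq := LabelGF.eventually_jacobi_quotients hκ hκ'
  refine ⟨?_, ?_, ?_⟩
  · filter_upwards [hq, LabelGF.eventually_hasSum_serS 1 (-x) (1 - x)] with t ht hs
    refine ⟨?_, ht.1.2⟩
    rw [← ht.1.1]
    refine hs.congr_fun fun j => ?_
    rw [hμ _ (by omega), LabelGF.eval_muPoly_even ⟨j + 1, by ring⟩]
    rfl
  · filter_upwards [hq, LabelGF.eventually_hasSum_serC 1 1 x] with t ht hs
    refine ⟨?_, ht.2.1.2⟩
    rw [← ht.2.1.1]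
    refine hs.congr_fun fun j => ?_
    rw [hμ _ (by omega), LabelGF.eval_muPoly_odd ⟨j, rfl⟩]
    rfl
  -- The factor `(1/2)^{2j}` in `ν (2j+1)` is absorbed by evaluating the series at `t / 2`.
  · have hlim : Filter.Tendsto (fun t : ℂ => t / 2) (nhds 0) (nhds 0) := by
      have : Continuous fun t : ℂ => t / 2 := by fun_prop
      simpa using this.tendsto 0
    filter_upwards [hlim.eventually hq,
      hlim.eventually (LabelGF.eventually_hasSum_serC 1 (-x) (1 - x))] with t ht hs
    refine ⟨?_, by rw [mul_div_assoc]; exact ht.2.2.2⟩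
    rw [← ht.2.2.1]
    refine hs.congr_fun fun j => ?_
    rw [hν _ ⟨j, rfl⟩, LabelGF.eval_nuPoly, Nat.add_sub_cancel, div_pow t, one_div, inv_pow]
    ring
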